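/- Let $E\to M$ be a Courant algebroid over a smooth manifold, with pairing $\langle\cdot,\cdot\rangle$, anchor $\rho$ and bracket $[\cdot,\cdot]$. Indices refer to local frames of $E$ and are raised and lowered with the pairing. A generalized pseudometric is an endomorphism $\mathcal G$ of $E$ with $\mathcal G^T=\mathcal G$ and $\mathcal G^2=\mathrm{Id}$ whose eigenbundles $V_\pm$ (for the eigenvalues $\pm1$) do not have rank $1$. A divergence is an $\mathbb R$-linear map $\operatorname{div}\colon\Gamma(E)\to C^\infty(M)$ with $\operatorname{div}(fu)=f\operatorname{div}u+\rho(u)f$. A Courant algebroid connection is a map $(u,v)\mapsto D_uv$ on $\Gamma(E)$ that is $C^\infty(M)$-linear in $u$, satisfies $D_u(fv)=fD_uv+(\rho(u)f)v$ and preserves the pairing. Write $LC(\mathcal G,\operatorname{div})$ for the set of connections $D$ with $D\mathcal G=0$, with vanishing torsion, i.e. $D_uv-D_vu-[u,v]+\langle Du,v\rangle=0$, and with $D_\alpha u^\alpha=\operatorname{div}u$ for all $u$. For $D\in LC(\mathcal G,\operatorname{div})$ put $$\mathrm{Rm}(w,z,x,y)=\tfrac12 w^\delta y^\beta\big(x^\alpha[D_\alpha,D_\beta]z_\delta+z^\alpha[D_\alpha,D_\delta]x_\beta-(D_\alpha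 x_\beta)(D^\alpha z_\delta)\big),$$ where $D_\alpha D_\beta$ are components of the second covariant derivative, and $$\langle v,\mathrm{Ric}(u)\rangle=\mathrm{Rm}(e^\alpha,v,e_\alpha,u),\qquad \mathrm{Rc}=\mathrm{Ric}-\mathcal G\,\mathrm{Ric}\,\mathcal G,\qquad \mathcal R=\operatorname{Tr}(\mathcal G\,\mathrm{Ric}).$$ Let $(\mathcal G_s,\operatorname{div}_s)$ be a smooth one-parameter family of generalized pseudometrics and divergences on $E$, with $s$ in an open set of real numbers, let $\chi=\frac{\partial}{\partial s}\mathcal G\in\Gamma(\operatorname{End}E)$ and $\varepsilon=\frac{\partial}{\partial s}\operatorname{div}\in\Gamma(E^*)\cong\Gamma(E)$, and let $D_s\in LC(\mathcal G_s,\operatorname{div}_s)$ be arbitrary for each $s$. Then $\mathrm{Rc}$ and $\mathcal R$, computed with $D_s$, are differentiable in $s$ at every point of $M$, and $$\frac{\partial}{\partial s}\mathrm{Rc}=-\tfrac12\Delta\chi-\tfrac12\mathcal L_{\operatorname{Tr}D\chi+\mathcal G\varepsilon}\mathcal G+\mathcal A(\chi)+\chi\,\mathcal G\,\mathrm{Rc}+\mathcal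 G[\chi,\mathrm{Ric}],$$ $$\frac{\partial}{\partial s}\mathcal R=\mathcal G^\alpha{}_\gamma\mathcal G^\beta{}_\delta D_\alpha D_\beta\chi^{\gamma\delta}-2\mathcal G^{\alpha\beta}D_\alpha\varepsilon_\beta+\tfrac12\chi^{\alpha\beta}\mathrm{Rc}_{\alpha\beta}.$$ On the right-hand sides all quantities are taken at the parameter $s$ with $D=D_s$. Here $\Delta=\mathcal G^{\alpha\beta}D_\alpha D_\beta$, $(\operatorname{Tr}D\chi)^\beta=D_\alpha\chi^{\alpha\beta}$, $(\mathcal L_w\mathcal G)u=[w,\mathcal Gu]-\mathcal G[w,u]$, and $$\mathcal A(\chi)_{\alpha\beta}=\tfrac12\big(\mathcal G^\gamma{}_\beta[D_\delta,D_\gamma]\chi_\alpha{}^\delta-\mathcal G^\gamma{}_\beta[D_\delta,D_\alpha]\chi_\gamma{}^\delta\big)+(\alpha\leftrightarrow\beta).$$ Moreover $\mathcal A$ is a linear differential operator of order at most one. -/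

import Mathlib

open scoped Manifold ContDiff

set_option linter.unusedSectionVars false

noncomputable section

namespace CourantGeometry

variable {EM : Type*} [NormedAddCommGroup EM] [NormedSpace ℝ EM]
  {H : Type*} [TopologicalSpace H] (I : ModelWithCorners ℝ EM H)
  {M : Type*} [TopologicalSpace M] [ChartedSpace H M] [IsManifold I ∞ M]
  (F : Type*) [NormedAddCommGroup F] [NormedSpace ℝ F]
  (E : M → Type*) [TopologicalSpace (Bundle.TotalSpace F E)]
  [∀ x, TopologicalSpace (E x)] [FiberBundle F E]

/-- Smooth sections `Γ(E)`. -/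
abbrev Sec := ContMDiffSection I F ∞ E

variable (M) in
/-- Smooth real-valued functions `C^∞(M)`. -/
abbrev Fun := ContMDiffMap I 𝓘(ℝ, ℝ) M ℝ ∞

variable [∀ x, AddCommGroup (E x)] [∀ x, Module ℝ (E x)] [VectorBundle ℝ F E]

section FunctionMultiples
variable {I F E}

/-- The product `f u` of a smooth function and a smooth section. -/
def fsmul (f : Fun I M) (u : Sec I F E) : Sec I F E :=
  ⟨fun x => f x • u x, f.contMDiff.smul_section u.contMDiff⟩

@[simp] theorem fsmul_apply (f : Fun I M) (u : Sec I F E) (x : M) :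
    fsmul f u x = f x • u x := rfl

end FunctionMultiples

/-! ### Courant algebroids -/

/-- A Courant algebroid structure on the vector bundle `E → M`. The pairing and the anchor are
fibrewise (bi)linear and send smooth sections to smooth objects, that is, they are smooth bundle
maps. Equations between sections or functions are stated at every point; `mvfderiv I f x X` is the
derivative of the function `f` along the tangent vector `X` at `x`. -/
structure CourantAlgebroid where
  /-- the pairing `⟨·,·⟩` -/
  pairing : ∀ x, LinearMap.BilinForm ℝ (E x)
  pairing_symm : ∀ x, (pairing x).IsSymm
  pairing_nondegenerate : ∀ x, (pairing x).Nondegenerate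
  contMDiff_pairing : ∀ u v : Sec I F E, ContMDiff I 𝓘(ℝ, ℝ) ∞ fun x => pairing x (u x) (v x)
  /-- the anchor `ρ` -/
  anchor : ∀ x, E x →ₗ[ℝ] TangentSpace I x
  contMDiff_anchor : ∀ u : Sec I F E, ContMDiff I I.tangent ∞
    fun x => (Bundle.TotalSpace.mk' EM x (anchor x (u x)) : TangentBundle I M)
  /-- the bracket `[·,·]` -/
  bracket : Sec I F E →ₗ[ℝ] Sec I F E →ₗ[ℝ] Sec I F E
  jacobi : ∀ u v w, bracket u (bracket v w) = bracket (bracket u v) w + bracket v (bracket u w)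
  leibniz : ∀ (u : Sec I F E) (f : Fun I M) (v : Sec I F E) (x : M),
    bracket u (fsmul f v) x = f x • bracket u v x + mvfderiv I f x (anchor x (u x)) • v x
  invariance : ∀ (u v w : Sec I F E) (x : M),
    mvfderiv I (fun y => pairing y (v y) (w y)) x (anchor x (u x)) =
      pairing x (bracket u v x) (w x) + pairing x (v x) (bracket u w x)
  /-- `[u,v] + [v,u] = 𝒟⟨u,v⟩`, where `⟨𝒟f, w⟩ = ρ(w)f` -/
  symmetric_part : ∀ (u v w : Sec I F E) (x : M),
    pairing x (bracket u v x + bracket v u x) (w x) =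
      mvfderiv I (fun y => pairing y (u y) (v y)) x (anchor x (w x))

/-- Smooth endomorphisms of the vector bundle `E`, covering the identity. -/
structure BundleEnd where
  /-- the linear map on each fibre -/
  toFun : ∀ x, E x →ₗ[ℝ] E x
  contMDiff_toFun : ∀ u : Sec I F E,
    ContMDiff I (I.prod 𝓘(ℝ, F)) ∞ fun x => Bundle.TotalSpace.mk' F x (toFun x (u x))

variable {I F E}

namespace BundleEnd

/-- The action of a bundle endomorphism on sections. -/
def onSec (T : BundleEnd I F E) : Sec I F E →ₗ[ℝ] Sec I F E where
  toFun u := ⟨fun x => T.toFun x (u x), T.contMDiff_toFun u⟩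
  map_add' u v := by ext x; simp
  map_smul' c u := by ext x; simp

@[simp] theorem onSec_apply (T : BundleEnd I F E) (u : Sec I F E) (x : M) :
    T.onSec u x = T.toFun x (u x) := rfl

instance : Add (BundleEnd I F E) where
  add S T := ⟨fun x => S.toFun x + T.toFun x, fun u => (S.onSec u + T.onSec u).contMDiff⟩

/-- The product of a smooth function and a bundle endomorphism. -/
def fsmul (f : Fun I M) (T : BundleEnd I F E) : BundleEnd I F E :=
  ⟨fun x => f x • T.toFun x, fun u => (CourantGeometry.fsmul f (T.onSec u)).contMDiff⟩

end BundleEnd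

/-- A divergence operator on a Courant algebroid. -/
structure Divergence (C : CourantAlgebroid I F E) where
  /-- the operator `Γ(E) → C^∞(M)` -/
  toFun : Sec I F E →ₗ[ℝ] Fun I M
  leibniz : ∀ (f : Fun I M) (u : Sec I F E) (x : M),
    toFun (fsmul f u) x = f x * toFun u x + mvfderiv I f x (C.anchor x (u x))

/-- A Courant algebroid connection; `D u v` is `D_u v`. -/
structure Connection (C : CourantAlgebroid I F E) where
  /-- the map `(u, v) ↦ D_u v` -/
  D : Sec I F E →ₗ[ℝ] Sec I F E →ₗ[ℝ] Sec I F E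
  fsmul_left : ∀ (f : Fun I M) (u v : Sec I F E), D (fsmul f u) v = fsmul f (D u v)
  leibniz : ∀ (f : Fun I M) (u v : Sec I F E) (x : M),
    D u (fsmul f v) x = f x • D u v x + mvfderiv I f x (C.anchor x (u x)) • v x
  metric : ∀ (u v w : Sec I F E) (x : M),
    mvfderiv I (fun y => C.pairing y (v y) (w y)) x (C.anchor x (u x)) =
      C.pairing x (D u v x) (w x) + C.pairing x (v x) (D u w x)

/-- A generalized pseudometric: a self-adjoint bundle endomorphism squaring to the identity whose
eigenbundles `V₊` and `V₋` do not have rank one. -/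
structure PseudoMetric (C : CourantAlgebroid I F E) extends BundleEnd I F E where
  selfAdjoint : ∀ x a b, C.pairing x (toFun x a) b = C.pairing x a (toFun x b)
  involutive : ∀ x a, toFun x (toFun x a) = a
  rank_plus : ∀ x, Module.finrank ℝ (Module.End.eigenspace (toFun x) 1) ≠ 1
  rank_minus : ∀ x, Module.finrank ℝ (Module.End.eigenspace (toFun x) (-1)) ≠ 1

namespace CourantAlgebroid
variable (C : CourantAlgebroid I F E)

/-- The function `⟨u, v⟩`. -/
def ip (u v : Sec I F E) (x : M) : ℝ := C.pairing x (u x) (v x)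

/-- The Lie derivative `ℒ_w T` of an endomorphism: `(ℒ_w T) u = [w, T u] - T [w, u]`. -/
def lieEnd (w : Sec I F E) (T : Sec I F E →ₗ[ℝ] Sec I F E) : Sec I F E →ₗ[ℝ] Sec I F E :=
  C.bracket w ∘ₗ T - T ∘ₗ C.bracket w

end CourantAlgebroid

/-! ### Contractions -/

section Extension

theorem sec_sum_apply {ι : Type*} (t : Finset ι) (s : ι → Sec I F E) (x : M) :
    (∑ i ∈ t, s i) x = ∑ i ∈ t, s i x := by
  classical
  induction t using Finset.induction_on with
  | empty => rfl
  | insert i t hi ih => rw [Finset.sum_insert hi, Finset.sum_insert hi, ← ih]; rfl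

variable (F E) in
theorem finrank_fiber (x : M) : Module.finrank ℝ (E x) = Module.finrank ℝ F :=
  (VectorBundle.continuousLinearEquivAt ℝ F E x).toLinearEquiv.finrank_eq

variable [FiniteDimensional ℝ EM] [T2Space M] [FiniteDimensional ℝ F]
  [ContMDiffVectorBundle ∞ F E I]

theorem exists_sec_through (x : M) (a : E x) : ∃ s : Sec I F E, s x = a := by
  obtain ⟨U, hU, hs⟩ := FiberBundle.exists_contMDiffOn_extend (k := ∞) I F a
  obtain ⟨f, -, hf⟩ := (SmoothBumpFunction.nhds_basis_tsupport (I := I) x).mem_iff.1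
    (interior_mem_nhds.2 hU)
  refine ⟨⟨fun y => f y • FiberBundle.extend F a y, ?_⟩, ?_⟩
  · exact ContMDiffOn.smul_section_of_tsupport f.contMDiff.contMDiffOn isOpen_interior hf
      (hs.mono interior_subset)
  · simp

/-- Some global smooth section with the prescribed value `a` at `x`. -/
def secThrough (x : M) (a : E x) : Sec I F E := (exists_sec_through x a).choose

@[simp] theorem secThrough_apply (x : M) (a : E x) :
    (secThrough x a : Sec I F E) x = a := (exists_sec_through x a).choose_spec


variable (F E) in
/-- A basis of the fibre `E x`. -/
def fiberBasis (x : M) : Module.Basis (Fin (Module.finrank ℝ F)) ℝ (E x) :=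
  haveI := VectorBundle.finiteDimensional ℝ F E x
  Module.finBasisOfFinrankEq ℝ (E x) (finrank_fiber F E x)

namespace CourantAlgebroid
variable (C : CourantAlgebroid I F E)

/-- Sections `e_α` whose values at `x` form a basis of `E x`. -/
def frame (_C : CourantAlgebroid I F E) (x : M) (α : Fin (Module.finrank ℝ F)) : Sec I F E :=
  secThrough x (fiberBasis F E x α)

/-- Sections `e^α` whose values at `x` form the basis dual to that of `frame x`: at `x`,
`⟨e_α, e^β⟩ = δ_α^β`. -/
def coframe (x : M) (α : Fin (Module.finrank ℝ F)) : Sec I F E :=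
  secThrough x ((C.pairing x).dualBasis (C.pairing_nondegenerate x) (fiberBasis F E x) α)

/-- The contraction `T_α^α` at `x` of two indices with the pairing, that is `∑_α T(e_α, e^α)(x)`.
It is applied only to expressions that are tensorial in both arguments, for which it does not
depend on the choice of the frame or of its extension off `x`. -/
def contr (x : M) (T : Sec I F E → Sec I F E → ℝ) : ℝ :=
  ∑ α, T (C.frame x α) (C.coframe x α)

/-- The vector-valued variant of `contr`. -/
def contrVec (B : Sec I F E → Sec I F E → Sec I F E) (x : M) : E x :=
  ∑ α, B (C.frame x α) (C.coframe x α) x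

theorem ip_symm (u v : Sec I F E) (x : M) : C.ip u v x = C.ip v u x :=
  (C.pairing_symm x).eq _ _

/-- The Gram matrix of the sections `frame p`. -/
def gram (p q : M) : Matrix (Fin (Module.finrank ℝ F)) (Fin (Module.finrank ℝ F)) ℝ :=
  Matrix.of fun i j => C.ip (C.frame p i) (C.frame p j) q

theorem contMDiff_det {ι : Type*} [Fintype ι] [DecidableEq ι] {A : M → Matrix ι ι ℝ}
    (hA : ∀ i j, ContMDiff I 𝓘(ℝ, ℝ) ∞ fun q => A q i j) :
    ContMDiff I 𝓘(ℝ, ℝ) ∞ fun q => (A q).det := by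
  simp only [Matrix.det_apply]
  refine contMDiff_finsetSum fun σ _ => ?_
  have h : ContMDiff I 𝓘(ℝ, ℝ) ∞ fun q => ∏ i, A q (σ i) i :=
    contMDiff_finsetProd fun i _ => hA _ _
  rcases Int.units_eq_one_or (Equiv.Perm.sign σ) with hs | hs
  · simpa [hs] using h
  · simpa [hs] using h.neg

theorem contMDiff_gram (p : M) (i j) : ContMDiff I 𝓘(ℝ, ℝ) ∞ fun q => C.gram p q i j :=
  C.contMDiff_pairing _ _

theorem contMDiff_adjugate_gram (p : M) (i j) :
    ContMDiff I 𝓘(ℝ, ℝ) ∞ fun q => (C.gram p q).adjugate i j := by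
  simp only [Matrix.adjugate_apply]
  refine contMDiff_det fun k l => ?_
  by_cases h : k = j
  · subst h
    simpa using! contMDiff_const
  · simpa [Matrix.updateRow_ne h] using C.contMDiff_gram p k l

/-- Cramer's rule for the expansion of a vector in the sections `frame p`. -/
theorem gram_expand (p q : M) (h : (C.gram p q).det ≠ 0) (a : E q) :
    (C.gram p q).det • a =
      ∑ i, ∑ j, ((C.gram p q).adjugate i j * C.pairing q (C.frame p j q) a) • C.frame p i q := by
  have := VectorBundle.finiteDimensional ℝ F E q
  have hli : LinearIndependent ℝ fun i => C.frame p i q := by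
    rw [Fintype.linearIndependent_iff]
    intro g hg
    have hz : (C.gram p q).mulVec g = 0 := by
      ext k
      have := congrArg (C.pairing q (C.frame p k q)) hg
      simpa [Matrix.mulVec, dotProduct, gram, ip, mul_comm] using this
    have := Matrix.eq_zero_of_mulVec_eq_zero h hz
    intro i; simp [this]
  have hspan := hli.span_eq_top_of_card_eq_finrank' (by simp [finrank_fiber F E q])
  rw [← sub_eq_zero]
  set w := (C.gram p q).det • a -
    ∑ i, ∑ j, ((C.gram p q).adjugate i j * C.pairing q (C.frame p j q) a) • C.frame p i q with hw
  have hk : ∀ k, C.pairing q (C.frame p k q) w = 0 := by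
    intro k
    have hA := Matrix.mul_adjugate (C.gram p q)
    have h1 : ∀ j, ∑ i, C.gram p q k i * (C.gram p q).adjugate i j =
        if k = j then (C.gram p q).det else 0 := by
      intro j
      have := congrFun (congrFun hA k) j
      simpa [Matrix.mul_apply, Matrix.one_apply] using this
    have h2 : ∑ i, ∑ j, ((C.gram p q).adjugate i j * C.pairing q (C.frame p j q) a) *
        C.gram p q k i = (C.gram p q).det * C.pairing q (C.frame p k q) a := by
      rw [Finset.sum_comm]
      calc _ = ∑ j, (∑ i, C.gram p q k i * (C.gram p q).adjugate i j) *
            C.pairing q (C.frame p j q) a := by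
              refine Finset.sum_congr rfl fun j _ => ?_
              rw [Finset.sum_mul]
              exact Finset.sum_congr rfl fun i _ => by ring
        _ = _ := by simp [h1]
    have h3 : C.pairing q (C.frame p k q) w = (C.gram p q).det * C.pairing q (C.frame p k q) a -
        ∑ i, ∑ j, ((C.gram p q).adjugate i j * C.pairing q (C.frame p j q) a) *
          C.gram p q k i := by
      simp [hw, gram, ip]
    rw [h3, h2, sub_self]
  refine (C.pairing_nondegenerate q).2 w fun b => ?_
  have hb : b ∈ Submodule.span ℝ (Set.range fun i => C.frame p i q) := by
    rw [hspan]; trivial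
  induction hb using Submodule.span_induction with
  | mem b hb => obtain ⟨k, rfl⟩ := hb; exact hk k
  | zero => simp
  | add b c _ _ hb hc => simp [hb, hc]
  | smul r b _ hb => simp [hb]

theorem det_gram_ne_zero (p : M) : (C.gram p p).det ≠ 0 := by
  intro h
  obtain ⟨g, hg0, hg⟩ := Matrix.exists_mulVec_eq_zero_iff.2 h
  refine hg0 ?_
  have hz : ∑ i, g i • fiberBasis F E p i = 0 := by
    refine (C.pairing_nondegenerate p).2 _ fun b => ?_
    have : ∀ k, C.pairing p (fiberBasis F E p k)
        (∑ i, g i • fiberBasis F E p i) = 0 := by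
      intro k
      have := congrFun hg k
      simpa [Matrix.mulVec, dotProduct, gram, ip, frame, mul_comm] using this
    rw [← (fiberBasis F E p).sum_repr b, map_sum (C.pairing p), LinearMap.sum_apply]
    exact Finset.sum_eq_zero fun k _ => by
      rw [map_smul, LinearMap.smul_apply, this, smul_zero]
  funext i
  exact Fintype.linearIndependent_iff.1 (fiberBasis F E p).linearIndependent g hz i

/-- A `C^∞(M)`-linear operation on sections depends at each point only on the value there. -/
theorem tensorial (C : CourantAlgebroid I F E) (Φ : Sec I F E →ₗ[ℝ] Sec I F E)
    (hΦ : ∀ (f : Fun I M) u, Φ (fsmul f u) = fsmul f (Φ u)) {u v : Sec I F E} {p : M}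
    (h : u p = v p) : Φ u p = Φ v p := by
  suffices H : ∀ w : Sec I F E, w p = 0 → Φ w p = 0 by
    have := H (u - v) (by simp [h])
    rw [map_sub] at this
    exact sub_eq_zero.1 this
  intro w hw
  let d : Fun I M := ⟨fun q => (C.gram p q).det, contMDiff_det (C.contMDiff_gram p)⟩
  let c : Fin (Module.finrank ℝ F) → Fin (Module.finrank ℝ F) → Fun I M := fun i j =>
    ⟨fun q => (C.gram p q).det * ((C.gram p q).adjugate i j * C.ip (C.frame p j) w q),
      (contMDiff_det (C.contMDiff_gram p)).mul
        ((C.contMDiff_adjugate_gram p i j).mul (C.contMDiff_pairing _ _))⟩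
  have hd : ∀ q, d q = (C.gram p q).det := fun q => rfl
  have hc : ∀ i j q, c i j q =
    (C.gram p q).det * ((C.gram p q).adjugate i j * C.ip (C.frame p j) w q) := fun i j q => rfl
  have key : fsmul d (fsmul d w) = ∑ i, ∑ j, fsmul (c i j) (C.frame p i) := by
    ext q
    simp only [sec_sum_apply, fsmul_apply, hd, hc, mul_smul]
    by_cases h0 : (C.gram p q).det = 0
    · simp [h0]
    · rw [C.gram_expand p q h0 (w q)]
      simp only [Finset.smul_sum, mul_smul, ip]
  have key2 := congrArg (fun s : Sec I F E => s p) (congrArg Φ key)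
  simp only [hΦ, map_sum, sec_sum_apply, fsmul_apply, hd, hc, ip, hw, map_zero, mul_zero, zero_smul,
    Finset.sum_const_zero] at key2
  have hne := C.det_gram_ne_zero p
  simpa [hne] using key2

theorem contMDiff_contrVec (B : Sec I F E →ₗ[ℝ] Sec I F E →ₗ[ℝ] Sec I F E)
    (hl : ∀ (f : Fun I M) u v, B (fsmul f u) v = fsmul f (B u v))
    (hr : ∀ (f : Fun I M) u v, B u (fsmul f v) = fsmul f (B u v)) :
    ContMDiff I (I.prod 𝓘(ℝ, F)) ∞
      fun x => Bundle.TotalSpace.mk' F x (C.contrVec (fun u v => B u v) x) := by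
  intro p
  have hev : ∀ᶠ q in nhds p, (C.gram p q).det ≠ 0 :=
    (contMDiff_det (C.contMDiff_gram p)).continuous.continuousAt.eventually_ne
      (C.det_gram_ne_zero p)
  have hformula : ∀ q, (C.gram p q).det ≠ 0 → C.contrVec (fun u v => B u v) q =
      ∑ i, ∑ j, ((C.gram p q).det⁻¹ * (C.gram p q).adjugate i j) •
        B (C.frame p i) (C.frame p j) q := by
    intro q hq
    have h1 : ∀ α, B (C.frame q α) (C.coframe q α) q = ∑ i, ∑ j,
        ((C.gram p q).det⁻¹ * (C.gram p q).adjugate i j) •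
          (C.ip (C.frame p j) (C.frame q α) q • B (C.frame p i) (C.coframe q α) q) := by
      intro α
      have hval : C.frame q α q = (∑ i, ∑ j, ((C.gram p q).det⁻¹ * ((C.gram p q).adjugate i j *
          C.ip (C.frame p j) (C.frame q α) q)) • C.frame p i) q := by
        have := congrArg ((C.gram p q).det⁻¹ • ·) (C.gram_expand p q hq (C.frame q α q))
        simpa only [smul_smul, inv_mul_cancel₀ hq, one_smul, Finset.smul_sum, sec_sum_apply, ip,
          ContMDiffSection.coe_smul, Pi.smul_apply] using this
      have := C.tensorial (B.flip (C.coframe q α)) (fun f u => hl f u _) hval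
      simp only [LinearMap.flip_apply] at this
      rw [this]
      simp only [map_sum, map_smul, LinearMap.sum_apply, LinearMap.smul_apply, sec_sum_apply,
        ContMDiffSection.coe_smul, Pi.smul_apply, smul_smul, mul_assoc]
    have h2 : ∀ i j, ∑ α, C.ip (C.frame p j) (C.frame q α) q •
        B (C.frame p i) (C.coframe q α) q = B (C.frame p i) (C.frame p j) q := by
      intro i j
      have hval : (∑ α, C.ip (C.frame p j) (C.frame q α) q • C.coframe q α) q =
          C.frame p j q := by
        have := ((C.pairing q).dualBasis (C.pairing_nondegenerate q)
          (fiberBasis F E q)).sum_repr (C.frame p j q)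
        simpa [sec_sum_apply, ip, frame, coframe] using this
      have := C.tensorial (B (C.frame p i)) (fun f v => hr f _ v) hval
      rw [← this]
      simp only [map_sum, map_smul, sec_sum_apply, ContMDiffSection.coe_smul, Pi.smul_apply]
    calc C.contrVec (fun u v => B u v) q = ∑ α, ∑ i, ∑ j,
        ((C.gram p q).det⁻¹ * (C.gram p q).adjugate i j) •
          (C.ip (C.frame p j) (C.frame q α) q • B (C.frame p i) (C.coframe q α) q) :=
            Finset.sum_congr rfl fun α _ => h1 α
      _ = _ := by
        rw [Finset.sum_comm]
        refine Finset.sum_congr rfl fun i _ => ?_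
        rw [Finset.sum_comm]
        refine Finset.sum_congr rfl fun j _ => ?_
        rw [← Finset.smul_sum, h2]
  have hsm : ContMDiffAt I (I.prod 𝓘(ℝ, F)) ∞ (fun q => Bundle.TotalSpace.mk' F q
      (∑ i, ∑ j, ((C.gram p q).det⁻¹ * (C.gram p q).adjugate i j) •
        B (C.frame p i) (C.frame p j) q)) p := by
    refine ContMDiffAt.sum_section fun i _ => ContMDiffAt.sum_section fun j _ => ?_
    refine ContMDiffAt.smul_section (f := fun q =>
      (C.gram p q).det⁻¹ * (C.gram p q).adjugate i j) (s := fun q =>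
      B (C.frame p i) (C.frame p j) q) ?_ (B (C.frame p i) (C.frame p j)).contMDiff.contMDiffAt
    exact ((contMDiff_det (C.contMDiff_gram p)).contMDiffAt.inv₀ (C.det_gram_ne_zero p)).mul
      (C.contMDiff_adjugate_gram p i j).contMDiffAt
  refine hsm.congr_of_eventuallyEq ?_
  filter_upwards [hev] with q hq
  rw [hformula q hq]

end CourantAlgebroid

/-! ### Levi-Civita connections and curvature -/

namespace Connection
variable {C : CourantAlgebroid I F E} (D : Connection C)

/-- The torsion `⟨T(u, v), w⟩ = ⟨D_u v - D_v u - [u, v], w⟩ + ⟨D_w u, v⟩`. -/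
def torsion (u v w : Sec I F E) (x : M) : ℝ :=
  C.ip (D.D u v - D.D v u - C.bracket u v) w x + C.ip (D.D w u) v x

/-- The divergence of a connection, `div_D u = D_α u^α`. -/
def divergence (u : Sec I F E) (x : M) : ℝ :=
  C.contr x fun e e' => C.ip (D.D e u) e' x

/-- `D` is a Levi-Civita connection of `G`: it preserves `G` and has no torsion. -/
structure IsLeviCivita (G : PseudoMetric C) : Prop where
  compatible : ∀ u v, D.D u (G.onSec v) = G.onSec (D.D u v)
  torsion_eq_zero : ∀ u v w x, D.torsion u v w x = 0

/-- `D ∈ LC(G, div)`. -/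
structure MemLC (G : PseudoMetric C) (δ : Divergence C) : Prop extends D.IsLeviCivita G where
  divergence_eq : ∀ u x, D.divergence u x = δ.toFun u x

/-- The second covariant derivative of a section,
`u^α v^β D_α D_β z = D_u D_v z - D_{D_u v} z`. -/
def second (u v z : Sec I F E) : Sec I F E := D.D u (D.D v z) - D.D (D.D u v) z

/-- `u^α v^β [D_α, D_β] z`. -/
def comm (u v z : Sec I F E) : Sec I F E := D.second u v z - D.second v u z

/-- The generalized Riemann tensor `Rm(w, z, x, y)` at the point `p`:
`½ w^δ y^β (x^α [D_α,D_β] z_δ + z^α [D_α,D_δ] x_β - (D_α x_β)(D^α z_δ))`. -/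
def riemann (w z x y : Sec I F E) (p : M) : ℝ :=
  1 / 2 * (C.ip (D.comm x y z) w p + C.ip (D.comm z w x) y p
    - C.contr p fun e e' => C.ip (D.D e x) y p * C.ip (D.D e' z) w p)

/-- The full Ricci tensor `⟨v, Ric u⟩ = Rm(e^α, v, e_α, u)`. -/
def fullRicci (v u : Sec I F E) (p : M) : ℝ :=
  C.contr p fun e e' => D.riemann e' v e u p

/-- The Ricci tensor `Rc = Ric - G Ric G`, in the form `⟨v, Rc u⟩`; here `⟨v, G a⟩ = ⟨G v, a⟩` is
used in the second term. -/
def ricci (G : PseudoMetric C) (v u : Sec I F E) (p : M) : ℝ :=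
  D.fullRicci v u p - D.fullRicci (G.onSec v) (G.onSec u) p

/-- The scalar curvature `Tr (G Ric) = G^{αβ} Ric_{αβ}`. -/
def scalar (G : PseudoMetric C) (p : M) : ℝ :=
  C.contr p fun e e' => D.fullRicci (G.onSec e) e' p

/-- The covariant derivative `D_u T` of an endomorphism: `(D_u T) z = D_u (T z) - T (D_u z)`. -/
def covEnd (u : Sec I F E) (T : Sec I F E →ₗ[ℝ] Sec I F E) : Sec I F E →ₗ[ℝ] Sec I F E :=
  D.D u ∘ₗ T - T ∘ₗ D.D u

/-- The second covariant derivative of an endomorphism,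
`u^α v^β D_α D_β T = D_u D_v T - D_{D_u v} T`. -/
def secondEnd (u v : Sec I F E) (T : Sec I F E →ₗ[ℝ] Sec I F E) :
    Sec I F E →ₗ[ℝ] Sec I F E :=
  D.covEnd u (D.covEnd v T) - D.covEnd (D.D u v) T

/-- `u^α v^β [D_α, D_β] T`. -/
def commEnd (u v : Sec I F E) (T : Sec I F E →ₗ[ℝ] Sec I F E) : Sec I F E →ₗ[ℝ] Sec I F E :=
  D.secondEnd u v T - D.secondEnd v u T

/-- The bilinear map `(u, v) ↦ (D_u T) v`. -/
def covEndBilin (T : Sec I F E →ₗ[ℝ] Sec I F E) :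
    Sec I F E →ₗ[ℝ] Sec I F E →ₗ[ℝ] Sec I F E :=
  LinearMap.mk₂ ℝ (fun u v => D.covEnd u T v)
    (fun u u' v => by simp only [covEnd, LinearMap.sub_apply, LinearMap.comp_apply, map_add,
      LinearMap.add_apply]; abel)
    (fun c u v => by simp only [covEnd, LinearMap.sub_apply, LinearMap.comp_apply, map_smul,
      LinearMap.smul_apply, smul_sub])
    (fun u v v' => map_add _ _ _) (fun c u v => map_smul _ _ _)

/-- The section `Tr (D T)` with `(Tr D T)^β = D_α T^{αβ}`, for a self-adjoint endomorphism `T`. -/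
def trCov (T : BundleEnd I F E) : Sec I F E :=
  ⟨C.contrVec fun e e' => D.covEndBilin T.onSec e e', C.contMDiff_contrVec _
    (fun f u v => by
      ext x
      simp [covEndBilin, covEnd, D.fsmul_left, smul_sub])
    (fun f u v => by
      ext x
      have h : T.onSec (fsmul f v) = fsmul f (T.onSec v) := by ext y; simp
      simp [covEndBilin, covEnd, D.leibniz, h, smul_sub])⟩

/-- The Laplacian `G^{αβ} D_α D_β T` of an endomorphism, in the form `⟨v, (Δ T) u⟩`. -/
def laplaceEnd (G : PseudoMetric C) (T : BundleEnd I F E) (v u : Sec I F E) (p : M) : ℝ :=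
  C.contr p fun e e' => C.ip v (D.secondEnd (G.onSec e) e' T.onSec u) p

/-- One half of the operator `𝒜`:
`½ (G^γ_β [D_δ,D_γ] T_α^δ - G^γ_β [D_δ,D_α] T_γ^δ)`, evaluated on `v^α u^β`. -/
def opAHalf (G : PseudoMetric C) (T : BundleEnd I F E) (v u : Sec I F E) (p : M) : ℝ :=
  1 / 2 * ((C.contr p fun e e' => C.ip v (D.commEnd e (G.onSec u) T.onSec e') p)
    - C.contr p fun e e' => C.ip (G.onSec u) (D.commEnd e v T.onSec e') p)

/-- The operator
`𝒜(T)_{αβ} = ½ (G^γ_β [D_δ,D_γ] T_α^δ - G^γ_β [D_δ,D_α] T_γ^δ) + (α ↔ β)`,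
evaluated on `v^α u^β`. -/
def opA (G : PseudoMetric C) (T : BundleEnd I F E) (v u : Sec I F E) (p : M) : ℝ :=
  D.opAHalf G T v u p + D.opAHalf G T u v p

end Connection

end Extension

/-- `P` is a linear differential operator of order at most one from `End(E)` to
`E^* ⊗ E^*`: its values are smooth tensors, it is additive, and its commutators with two
multiplications by smooth functions vanish (`f` constant in `smul` gives real linearity). -/
structure IsFirstOrderOperator (P : BundleEnd I F E → Sec I F E → Sec I F E → M → ℝ) : Prop where
  smooth : ∀ T v u, ContMDiff I 𝓘(ℝ, ℝ) ∞ (P T v u)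
  add_left : ∀ T v v' u x, P T (v + v') u x = P T v u x + P T v' u x
  fsmul_left : ∀ T (f : Fun I M) v u x, P T (fsmul f v) u x = f x * P T v u x
  add_right : ∀ T v u u' x, P T v (u + u') x = P T v u x + P T v u' x
  fsmul_right : ∀ T (f : Fun I M) v u x, P T v (fsmul f u) x = f x * P T v u x
  add : ∀ S T v u x, P (S + T) v u x = P S v u x + P T v u x
  const_smul : ∀ (c : ℝ) T v u x, P (BundleEnd.fsmul (.const c) T) v u x = c * P T v u x
  commutator : ∀ (f g : Fun I M) T v u x,
    P (BundleEnd.fsmul f (BundleEnd.fsmul g T)) v u x - f x * P (BundleEnd.fsmul g T) v u x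
      - g x * P (BundleEnd.fsmul f T) v u x + f x * g x * P T v u x = 0

end CourantGeometry

end

noncomputable section

namespace CourantGeometry

variable {EM : Type*} [NormedAddCommGroup EM] [NormedSpace ℝ EM] [FiniteDimensional ℝ EM]
  {H : Type*} [TopologicalSpace H] {I : ModelWithCorners ℝ EM H}
  {M : Type*} [TopologicalSpace M] [ChartedSpace H M] [IsManifold I ∞ M] [T2Space M]
  {F : Type*} [NormedAddCommGroup F] [NormedSpace ℝ F] [FiniteDimensional ℝ F]
  {E : M → Type*} [TopologicalSpace (Bundle.TotalSpace F E)]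
  [∀ x, TopologicalSpace (E x)] [FiberBundle F E]
  [∀ x, AddCommGroup (E x)] [∀ x, Module ℝ (E x)] [VectorBundle ℝ F E]
  [ContMDiffVectorBundle ∞ F E I]

/-! ### Tensors at a point -/

/-! Fix `s` and write `D` for `D_s`. The chosen connections `D_t` need not depend on `t` in any
regular way, so they cannot be differentiated. They are compared with an explicit family that can.

A torsion-free `D` is deformed to a Levi-Civita connection of `G_t` by adding a tensor `Λ_t`,
algebraic in `G_t` and linear in `D G_t` (`deformTensor`, `deformed_isLeviCivita`). Since `D G_s =
0`, the tensor `Λ_t` vanishes at `t = s`. Hence the derivative of `Λ_t` is the same expression in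
`Dχ`, that of `DΛ_t` is the same expression in `DDχ` (`ip_cov_deformTensor`), and terms quadratic in
`Λ_t` do not contribute (`hasDerivAt_fullRicci_deformed`).

The deformed connection and `D_t` are both Levi-Civita for `G_t`. Their difference therefore
commutes with `G_t` in every slot (`diff_onSec_left`). The formula `riemann_change` then shows that
`Rc` and `R` see this difference only through its trace, the difference of the divergences
(`ricci_eq_of_isLeviCivita`, `scalar_eq_of_isLeviCivita`). That trace is `div_t - div_s - Tr Λ_t`
(`divGap`), which depends on the given smooth data alone and vanishes at `t = s`. This yields
differentiability for arbitrary `D_t`; the derivative brings in `Dε` and further second derivatives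
of `χ` (`hasDerivAt_divDiff`).

What remains is algebra in one fibre. The endomorphism `χ` is symmetric and anticommutes with `G`,
and so are the values of `DDχ`; with `trace_lam_second` and the `trace_second` lemmas all
contractions are sorted into the Laplacian, the Lie derivative, `𝒜` and the scalar double
divergence. Finally `𝒜` has order at most one because on `f T` the commutator of covariant
derivatives differs from `f` times its value on `T` only by a term that is `C^∞(M)`-linear in `T`
(`commEnd_fsmul_end`). -/

/-- `φ` is a tensorial operation at the point `p`, with values in a vector space. -/
structure TensAt {W : Type*} [AddCommGroup W] [Module ℝ W] (p : M) (φ : Sec I F E → W) :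
    Prop where
  add : ∀ u v, φ (u + v) = φ u + φ v
  fsmul : ∀ (f : Fun I M) u, φ (fsmul f u) = f p • φ u

/-- Multiplication by a constant function is multiplication by the constant. -/
theorem fsmul_const (c : ℝ) (u : Sec I F E) : fsmul (.const c) u = c • u := by
  ext x; simp [ContMDiffMap.const]; rfl

namespace TensAt
variable {W : Type*} [AddCommGroup W] [Module ℝ W] {p : M} {φ : Sec I F E → W}

theorem smul (h : TensAt p φ) (c : ℝ) (u : Sec I F E) : φ (c • u) = c • φ u := by
  rw [← fsmul_const, h.fsmul]; rfl

theorem map_sum {ι : Type*} (h : TensAt p φ) (t : Finset ι) (s : ι → Sec I F E) :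
    φ (∑ i ∈ t, s i) = ∑ i ∈ t, φ (s i) := by
  let ψ : Sec I F E →ₗ[ℝ] W := ⟨⟨φ, h.add⟩, h.smul⟩
  exact _root_.map_sum ψ s t

theorem map_sub (h : TensAt p φ) (u v : Sec I F E) : φ (u - v) = φ u - φ v := by
  let ψ : Sec I F E →ₗ[ℝ] W := ⟨⟨φ, h.add⟩, h.smul⟩
  exact _root_.map_sub ψ u v

/-- Up to a factor that is nonzero at `p`, a section vanishing at `p` is a global combination of
sections whose coefficients vanish at `p`. No partition of unity is needed. -/
theorem congr (C : CourantAlgebroid I F E) (hφ : TensAt p φ) {u v : Sec I F E}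
    (h : u p = v p) : φ u = φ v := by
  suffices H : ∀ w : Sec I F E, w p = 0 → φ w = 0 by
    have := H (u - v) (by simp [h])
    rwa [hφ.map_sub, sub_eq_zero] at this
  intro w hw
  let d : Fun I M := ⟨fun q => (C.gram p q).det,
    CourantAlgebroid.contMDiff_det (C.contMDiff_gram p)⟩
  let c : Fin (Module.finrank ℝ F) → Fin (Module.finrank ℝ F) → Fun I M := fun i j =>
    ⟨fun q => (C.gram p q).det * ((C.gram p q).adjugate i j * C.ip (C.frame p j) w q),
      (CourantAlgebroid.contMDiff_det (C.contMDiff_gram p)).mul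
        ((C.contMDiff_adjugate_gram p i j).mul (C.contMDiff_pairing _ _))⟩
  have hd : ∀ q, d q = (C.gram p q).det := fun q => rfl
  have hc : ∀ i j q, c i j q =
    (C.gram p q).det * ((C.gram p q).adjugate i j * C.ip (C.frame p j) w q) := fun i j q => rfl
  -- Cramer's rule is available only where the Gram determinant `d` is nonzero. The second factor
  -- `d` makes both sides vanish elsewhere, so the identity is global.
  have key : CourantGeometry.fsmul d (CourantGeometry.fsmul d w) =
      ∑ i, ∑ j, CourantGeometry.fsmul (c i j) (C.frame p i) := by
    ext q
    simp only [sec_sum_apply, fsmul_apply, hd, hc, mul_smul]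
    by_cases h0 : (C.gram p q).det = 0
    · simp [h0]
    · rw [C.gram_expand p q h0 (w q)]
      simp only [Finset.smul_sum, mul_smul, CourantAlgebroid.ip]
  have key2 := congrArg φ key
  simp only [hφ.fsmul, hφ.map_sum, hd, hc, CourantAlgebroid.ip, hw, map_zero, mul_zero,
    zero_smul, Finset.sum_const_zero] at key2
  simpa [C.det_gram_ne_zero p] using key2

end TensAt

/-- A linear choice of sections with prescribed value at `p`. -/
def secLift (C : CourantAlgebroid I F E) (p : M) : E p →ₗ[ℝ] Sec I F E :=
  (fiberBasis F E p).constr ℝ (C.frame p)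

@[simp] theorem secLift_apply (C : CourantAlgebroid I F E) (p : M) (a : E p) :
    secLift C p a p = a := by
  conv_rhs => rw [← (fiberBasis F E p).sum_repr a]
  simp [secLift, Module.Basis.constr_apply_fintype, sec_sum_apply, CourantAlgebroid.frame]

/-! ### Tensorial operations as multilinear maps on one fibre. -/

section Representation
variable {W : Type*} [AddCommGroup W] [Module ℝ W] {p : M}

/-- By `TensAt.congr` the operation factors through evaluation at `p`, and evaluating it on the
linear lift `secLift` makes the factor visibly linear. -/
theorem TensAt.exists_lin (C : CourantAlgebroid I F E) {φ : Sec I F E → W} (h : TensAt p φ) :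
    ∃ ℓ : E p →ₗ[ℝ] W, ∀ u, φ u = ℓ (u p) :=
  ⟨{ toFun := fun a => φ (secLift C p a)
     map_add' := fun a b => by rw [map_add, h.add]
     map_smul' := fun c a => by rw [map_smul, h.smul]; rfl },
    fun u => h.congr C (by simp)⟩

theorem linearMap_ext_sec (C : CourantAlgebroid I F E) {ℓ ℓ' : E p →ₗ[ℝ] W}
    (h : ∀ u : Sec I F E, ℓ (u p) = ℓ' (u p)) : ℓ = ℓ' := by
  ext a
  simpa using h (secLift C p a)

/-- The second slot is represented first. A linear map on the fibre is determined by its values on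
sections, so the representing map is again tensorial in the first slot. -/
theorem exists_tensor₂ (C : CourantAlgebroid I F E) {φ : Sec I F E → Sec I F E → W}
    (h₁ : ∀ v, TensAt p fun u => φ u v) (h₂ : ∀ u, TensAt p fun v => φ u v) :
    ∃ ℓ : E p →ₗ[ℝ] E p →ₗ[ℝ] W, ∀ u v, φ u v = ℓ (u p) (v p) := by
  choose m hm using fun u => (h₂ u).exists_lin C
  have : TensAt p m := by
    constructor
    · intro u v
      refine linearMap_ext_sec C fun w => ?_
      rw [LinearMap.add_apply, ← hm, ← hm, ← hm, (h₁ w).add]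
    · intro f u
      refine linearMap_ext_sec C fun w => ?_
      rw [LinearMap.smul_apply, ← hm, ← hm, (h₁ w).fsmul]
  obtain ⟨ℓ, hℓ⟩ := this.exists_lin C
  exact ⟨ℓ, fun u v => by rw [hm, hℓ]⟩

theorem exists_tensor₃ (C : CourantAlgebroid I F E)
    {φ : Sec I F E → Sec I F E → Sec I F E → W}
    (h₁ : ∀ v w, TensAt p fun u => φ u v w) (h₂ : ∀ u w, TensAt p fun v => φ u v w)
    (h₃ : ∀ u v, TensAt p fun w => φ u v w) :
    ∃ ℓ : E p →ₗ[ℝ] E p →ₗ[ℝ] E p →ₗ[ℝ] W, ∀ u v w, φ u v w = ℓ (u p) (v p) (w p) := by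
  choose m hm using fun u => exists_tensor₂ C (h₂ u) (h₃ u)
  have : TensAt p m := by
    constructor
    · intro u v
      refine linearMap_ext_sec C fun w => linearMap_ext_sec C fun w' => ?_
      simp only [LinearMap.add_apply, ← hm, (h₁ w w').add]
    · intro f u
      refine linearMap_ext_sec C fun w => linearMap_ext_sec C fun w' => ?_
      simp only [LinearMap.smul_apply, ← hm, (h₁ w w').fsmul]
  obtain ⟨ℓ, hℓ⟩ := this.exists_lin C
  exact ⟨ℓ, fun u v w => by rw [hm, hℓ]⟩

end Representation

/-! ### Contraction in a fibre -/

/-- A real-valued map that is linear in both of its arguments. -/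
structure Bilin {V : Type*} [AddCommGroup V] [Module ℝ V] (b : V → V → ℝ) : Prop where
  add_left : ∀ x x' y, b (x + x') y = b x y + b x' y
  smul_left : ∀ (c : ℝ) x y, b (c • x) y = c * b x y
  add_right : ∀ x y y', b x (y + y') = b x y + b x y'
  smul_right : ∀ (c : ℝ) x y, b x (c • y) = c * b x y

namespace CourantAlgebroid
variable (C : CourantAlgebroid I F E) {p : M}

/-- The contraction of a bilinear form on the fibre `E p` with the pairing. -/
def trace (p : M) (b : E p → E p → ℝ) : ℝ :=
  ∑ i, b (fiberBasis F E p i)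
    ((C.pairing p).dualBasis (C.pairing_nondegenerate p) (fiberBasis F E p) i)

/-- The passage from contractions of sections to linear algebra in the fibre; all trace identities
are proved on the fibre side. -/
theorem contr_eq_trace (b : E p → E p → ℝ) :
    C.contr p (fun e e' => b (e p) (e' p)) = C.trace p b := by
  simp [contr, trace, frame, coframe]

theorem sum_pairing_basis (a : E p) :
    ∑ i, C.pairing p ((C.pairing p).dualBasis (C.pairing_nondegenerate p) (fiberBasis F E p) i) a •
      fiberBasis F E p i = a := by
  refine (fiberBasis F E p).ext_elem fun j => ?_
  have h : ∀ i, C.pairing p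
      ((C.pairing p).dualBasis (C.pairing_nondegenerate p) (fiberBasis F E p) i) a =
      (fiberBasis F E p).repr a i := by
    intro i
    conv_lhs => rw [← (fiberBasis F E p).sum_repr a]
    simp only [map_sum, map_smul, smul_eq_mul]
    rw [Finset.sum_congr rfl fun j _ => by rw [LinearMap.BilinForm.apply_dualBasis_left]]
    simp
  simp [h]

theorem sum_pairing_dualBasis (a : E p) :
    ∑ i, C.pairing p (fiberBasis F E p i) a •
      (C.pairing p).dualBasis (C.pairing_nondegenerate p) (fiberBasis F E p) i = a := by
  refine ((C.pairing p).dualBasis (C.pairing_nondegenerate p) (fiberBasis F E p)).ext_elem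
    fun j => ?_
  simp [LinearMap.BilinForm.dualBasis_repr_apply, Finsupp.single_apply, (C.pairing_symm p).eq a]

theorem trace_pairing_left (φ : E p →ₗ[ℝ] ℝ) (a : E p) :
    C.trace p (fun x y => C.pairing p x a * φ y) = φ a := by
  conv_rhs => rw [← C.sum_pairing_dualBasis a]
  simp [trace]

theorem trace_pairing_right (φ : E p →ₗ[ℝ] ℝ) (a : E p) :
    C.trace p (fun x y => C.pairing p y a * φ x) = φ a := by
  conv_rhs => rw [← C.sum_pairing_basis a]
  simp [trace]

variable {C}

theorem _root_.CourantGeometry.Bilin.sum_left {V ι : Type*} [AddCommGroup V] [Module ℝ V]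
    {b : V → V → ℝ} (hb : Bilin b) (t : Finset ι) (c : ι → ℝ) (x : ι → V) (y : V) :
    b (∑ i ∈ t, c i • x i) y = ∑ i ∈ t, c i * b (x i) y := by
  let ψ : V →ₗ[ℝ] ℝ := ⟨⟨fun x => b x y, fun x x' => hb.add_left x x' y⟩,
    fun c x => hb.smul_left c x y⟩
  exact (map_sum ψ _ t).trans (Finset.sum_congr rfl fun i _ => hb.smul_left _ _ _)

theorem _root_.CourantGeometry.Bilin.sum_right {V ι : Type*} [AddCommGroup V] [Module ℝ V]
    {b : V → V → ℝ} (hb : Bilin b) (t : Finset ι) (c : ι → ℝ) (x : V) (y : ι → V) :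
    b x (∑ i ∈ t, c i • y i) = ∑ i ∈ t, c i * b x (y i) := by
  let ψ : V →ₗ[ℝ] ℝ := ⟨⟨b x, fun y y' => hb.add_right x y y'⟩, fun c y => hb.smul_right c x y⟩
  exact (map_sum ψ _ t).trans (Finset.sum_congr rfl fun i _ => hb.smul_right _ _ _)

/-- The contraction may be computed with any pair of dual families. -/
theorem trace_eq_sum {b : E p → E p → ℝ} (hb : Bilin b) {ι : Type*} [Fintype ι] {e f : ι → E p}
    (h : ∀ a, ∑ i, C.pairing p (e i) a • f i = a) : C.trace p b = ∑ i, b (e i) (f i) := by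
  have h1 : ∀ i, b (fiberBasis F E p i)
      ((C.pairing p).dualBasis (C.pairing_nondegenerate p) (fiberBasis F E p) i) =
      ∑ k, C.pairing p ((C.pairing p).dualBasis (C.pairing_nondegenerate p)
        (fiberBasis F E p) i) (e k) * b (fiberBasis F E p i) (f k) := by
    intro i
    conv_lhs => rw [← h ((C.pairing p).dualBasis (C.pairing_nondegenerate p)
      (fiberBasis F E p) i)]
    rw [hb.sum_right]
    exact Finset.sum_congr rfl fun k _ => by rw [(C.pairing_symm p).eq]
  rw [trace, Finset.sum_congr rfl fun i _ => h1 i, Finset.sum_comm]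
  refine Finset.sum_congr rfl fun k _ => ?_
  rw [← hb.sum_left, C.sum_pairing_basis]

/-- The dual basis followed by the basis is again a pair of dual families, because the pairing is
symmetric. -/
theorem trace_comm {b : E p → E p → ℝ} (hb : Bilin b) :
    C.trace p b = C.trace p fun x y => b y x :=
  trace_eq_sum hb C.sum_pairing_basis

/-- Adjoint maps move across a contraction. -/
theorem trace_move {b : E p → E p → ℝ} (hb : Bilin b) {K K' : E p →ₗ[ℝ] E p}
    (h : ∀ x y, C.pairing p (K x) y = C.pairing p x (K' y)) :
    C.trace p (fun x y => b (K x) y) = C.trace p fun x y => b x (K' y) := by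
  set β := fiberBasis F E p with hβ
  set β' := (C.pairing p).dualBasis (C.pairing_nondegenerate p) (fiberBasis F E p) with hβ'
  have h1 : ∀ i, b (K (β i)) (β' i) =
      ∑ j, C.pairing p (β i) (K' (β' j)) * b (β j) (β' i) := by
    intro i
    conv_lhs => rw [← C.sum_pairing_basis (K (β i))]
    rw [hb.sum_left]
    exact Finset.sum_congr rfl fun j _ => by rw [(C.pairing_symm p).eq, h]
  calc C.trace p (fun x y => b (K x) y) = ∑ i, b (K (β i)) (β' i) := rfl
    _ = ∑ j, ∑ i, C.pairing p (β i) (K' (β' j)) * b (β j) (β' i) := by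
      rw [Finset.sum_congr rfl fun i _ => h1 i, Finset.sum_comm]
    _ = C.trace p fun x y => b x (K' y) := by
      refine Finset.sum_congr rfl fun j _ => ?_
      rw [← hb.sum_right, C.sum_pairing_dualBasis]

theorem trace_congr {b b' : E p → E p → ℝ} (h : ∀ x y, b x y = b' x y) :
    C.trace p b = C.trace p b' :=
  Finset.sum_congr rfl fun _ _ => h _ _

theorem trace_add (b b' : E p → E p → ℝ) :
    C.trace p (fun x y => b x y + b' x y) = C.trace p b + C.trace p b' :=
  Finset.sum_add_distrib

theorem trace_sub (b b' : E p → E p → ℝ) :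
    C.trace p (fun x y => b x y - b' x y) = C.trace p b - C.trace p b' :=
  Finset.sum_sub_distrib ..

theorem trace_neg (b : E p → E p → ℝ) :
    C.trace p (fun x y => -b x y) = -C.trace p b :=
  Finset.sum_neg_distrib ..

theorem trace_mul_left (c : ℝ) (b : E p → E p → ℝ) :
    C.trace p (fun x y => c * b x y) = c * C.trace p b :=
  (Finset.mul_sum ..).symm

theorem trace_trace (b : E p → E p → E p → E p → ℝ) :
    C.trace p (fun x y => C.trace p fun z w => b x y z w) =
      C.trace p fun z w => C.trace p fun x y => b x y z w :=
  Finset.sum_comm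

theorem eq_of_pairing {a b : E p} (h : ∀ c, C.pairing p a c = C.pairing p b c) : a = b := by
  rw [← sub_eq_zero]
  refine (C.pairing_nondegenerate p).1 _ fun c => ?_
  simp [h]

theorem eq_of_ip {u v : Sec I F E} (h : ∀ (w : Sec I F E) x, C.ip u w x = C.ip v w x) :
    u = v := by
  ext x
  exact eq_of_pairing fun c => by simpa [ip] using h (secThrough x c) x

end CourantAlgebroid

end CourantGeometry

end

noncomputable section

namespace CourantGeometry

variable {EM : Type*} [NormedAddCommGroup EM] [NormedSpace ℝ EM]
  {H : Type*} [TopologicalSpace H] {I : ModelWithCorners ℝ EM H}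
  {M : Type*} [TopologicalSpace M] [ChartedSpace H M] [IsManifold I ∞ M]

/-! ### Derivatives of families of functions -/

section Families

open Filter Topology

/-- The partial derivative of a jointly smooth function along a smooth vector field is jointly
smooth. -/
theorem contMDiffOn_mvfderiv_family {U : Set (ℝ × M)} (hU : IsOpen U) {φ : ℝ → M → ℝ}
    (hφ : ContMDiffOn (𝓘(ℝ, ℝ).prod I) 𝓘(ℝ, ℝ) ∞ (Function.uncurry φ) U)
    {X : ∀ x : M, TangentSpace I x}
    (hX : ContMDiff I I.tangent ∞ fun x => (Bundle.TotalSpace.mk' EM x (X x) : TangentBundle I M)) :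
    ContMDiffOn (𝓘(ℝ, ℝ).prod I) 𝓘(ℝ, ℝ) ∞
      (fun z : ℝ × M => mvfderiv I (φ z.1) z.2 (X z.2)) U := by
  have : IsManifold I 1 M := .of_le (n := ∞) (by simp)
  have hT : ContMDiffOn (𝓘(ℝ, ℝ).prod I).tangent 𝓘(ℝ, ℝ).tangent ∞
      (tangentMapWithin (𝓘(ℝ, ℝ).prod I) 𝓘(ℝ, ℝ) (Function.uncurry φ) U)
      (Bundle.TotalSpace.proj ⁻¹' U) :=
    hφ.contMDiffOn_tangentMapWithin (by simp) hU.uniqueMDiffOn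
  -- The lift of `X` to `ℝ × M` with no component along the parameter: differentiating the joint
  -- function along it differentiates each slice along `X`.
  let V : ℝ × M → TangentBundle (𝓘(ℝ, ℝ).prod I) (ℝ × M) := fun z =>
    (equivTangentBundleProd 𝓘(ℝ, ℝ) ℝ I M).symm (⟨z.1, 0⟩, ⟨z.2, X z.2⟩)
  have hV : ContMDiff (𝓘(ℝ, ℝ).prod I) (𝓘(ℝ, ℝ).prod I).tangent ∞ V := by
    refine contMDiff_equivTangentBundleProd_symm.comp (ContMDiff.prodMk ?_ ?_)
    · exact (Bundle.contMDiff_zeroSection ℝ (TangentSpace 𝓘(ℝ, ℝ) : ℝ → Type _)).comp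
        contMDiff_fst
    · exact hX.comp contMDiff_snd
  have h := contMDiff_snd_tangentBundle_modelSpace ℝ 𝓘(ℝ, ℝ) (n := ∞)
  have hc := h.comp_contMDiffOn (hT.comp hV.contMDiffOn (s := U) (fun z hz => hz))
  refine hc.congr fun z hz => ?_
  have hd : MDifferentiableAt (𝓘(ℝ, ℝ).prod I) 𝓘(ℝ, ℝ) (Function.uncurry φ) z :=
    (hφ.contMDiffAt (hU.mem_nhds hz)).mdifferentiableAt (by simp)
  have h1 : mfderiv I 𝓘(ℝ, ℝ) (φ z.1) z.2 (X z.2) =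
      mfderiv (𝓘(ℝ, ℝ).prod I) 𝓘(ℝ, ℝ) (Function.uncurry φ) z
        (mfderiv I (𝓘(ℝ, ℝ).prod I) (fun q : M => (z.1, q)) z.2 (X z.2)) := by
    rw [← mfderiv_comp_apply z.2 (g := Function.uncurry φ) (f := fun q : M => (z.1, q)) hd]
    · rfl
    · exact mdifferentiableAt_const.prodMk mdifferentiableAt_id
  have h2 : mfderiv I (𝓘(ℝ, ℝ).prod I) (fun q : M => (z.1, q)) z.2 (X z.2) = (0, X z.2) := by
    have h3 : mfderiv I (𝓘(ℝ, ℝ).prod I) (fun q : M => (z.1, q)) z.2 =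
        (mfderiv I 𝓘(ℝ, ℝ) (fun _ : M => z.1) z.2).prod (mfderiv I I (fun q : M => q) z.2) :=
      mfderiv_prodMk mdifferentiableAt_const mdifferentiableAt_id
    have h4 : mfderiv I I (fun q : M => q) z.2 = ContinuousLinearMap.id ℝ _ := mfderiv_id
    rw [h3, mfderiv_const, h4]
    rfl
  have h5 : mfderivWithin (𝓘(ℝ, ℝ).prod I) 𝓘(ℝ, ℝ) (Function.uncurry φ) U z =
      mfderiv (𝓘(ℝ, ℝ).prod I) 𝓘(ℝ, ℝ) (Function.uncurry φ) z := mfderivWithin_of_isOpen hU hz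
  have h6 := h1.trans (congrArg (mfderiv (𝓘(ℝ, ℝ).prod I) 𝓘(ℝ, ℝ) (Function.uncurry φ) z) h2)
  exact h6.trans (congrArg (fun L => L ((0, X z.2) : ℝ × EM)) h5.symm)

/-- The derivative of a smooth function along a smooth vector field is smooth. -/
theorem contMDiff_mvfderiv {f : M → ℝ} (hf : ContMDiff I 𝓘(ℝ, ℝ) ∞ f)
    {X : ∀ x : M, TangentSpace I x}
    (hX : ContMDiff I I.tangent ∞ fun x => (Bundle.TotalSpace.mk' EM x (X x) : TangentBundle I M)) :
    ContMDiff I 𝓘(ℝ, ℝ) ∞ fun x => mvfderiv I f x (X x) := by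
  have h := contMDiffOn_mvfderiv_family (φ := fun _ => f) isOpen_univ
    ((hf.comp contMDiff_snd).contMDiffOn) hX
  exact (contMDiffOn_univ.1 h).comp (contMDiff_const (c := (0 : ℝ)).prodMk contMDiff_id)

/-- Without boundary the chart has full range, so the derivative within the range is the ordinary
one. -/
theorem mvfderiv_eq_fderiv [I.Boundaryless] {f : M → ℝ} {p : M}
    (hf : MDifferentiableAt I 𝓘(ℝ, ℝ) f p) (X : TangentSpace I p) :
    mvfderiv I f p X = fderiv ℝ (f ∘ (extChartAt I p).symm) (extChartAt I p p) X := by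
  simp only [mvfderiv, mfderiv, hf, writtenInExtChartAt, I.range_eq_univ,
    fderivWithin_univ, extChartAt_model_space_eq_id]
  rfl

/-- Differentiation in the parameter commutes with differentiation along the manifold. -/
theorem hasDerivAt_mvfderiv [I.Boundaryless] {φ : ℝ → M → ℝ} {φ' : M → ℝ} {s : ℝ} {p : M}
    (hφ : ∀ᶠ z in 𝓝 (s, p),
      ContMDiffAt (𝓘(ℝ, ℝ).prod I) 𝓘(ℝ, ℝ) ∞ (Function.uncurry φ) z)
    (hφ' : ∀ᶠ q in 𝓝 p, HasDerivAt (fun t => φ t q) (φ' q) s) (X : TangentSpace I p) :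
    HasDerivAt (fun t => mvfderiv I (φ t) p X) (mvfderiv I φ' p X) s := by
  have : IsManifold I 1 M := .of_le (n := ∞) (by simp)
  set c := extChartAt I p with hc
  set y₀ : EM := c p with hy₀
  let X' : EM := X
  -- In a chart the claim becomes the symmetry of the second derivative of `Φ` on the pair `(1, 0)`,
  -- `(0, X)`.
  let Φ : ℝ × EM → ℝ := fun z => φ z.1 (c.symm z.2)
  have hcy : c.symm y₀ = p := extChartAt_to_inv p
  have hsymm : ContMDiffAt 𝓘(ℝ, EM) I ∞ c.symm y₀ :=
    (contMDiffOn_extChartAt_symm p).contMDiffAt (extChartAt_target_mem_nhds p)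
  have hΦ : ContDiffAt ℝ 2 Φ (s, y₀) := by
    have h1 : ContMDiffAt (𝓘(ℝ, ℝ).prod 𝓘(ℝ, EM)) (𝓘(ℝ, ℝ).prod I) ∞
        (fun z : ℝ × EM => (z.1, c.symm z.2)) (s, y₀) :=
      contMDiffAt_fst.prodMk (ContMDiffAt.comp (s, y₀) hsymm contMDiffAt_snd)
    have h2 : ContMDiffAt (𝓘(ℝ, ℝ).prod 𝓘(ℝ, EM)) 𝓘(ℝ, ℝ) ∞ Φ (s, y₀) := by
      refine ContMDiffAt.comp (g := Function.uncurry φ) (s, y₀) ?_ h1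
      simpa only [hcy] using hφ.self_of_nhds
    rw [← modelWithCornersSelf_prod, chartedSpaceSelf_prod] at h2
    exact (contMDiffAt_iff_contDiffAt.1 h2).of_le (by norm_cast)
  have hev : ∀ᶠ z in 𝓝 (s, y₀), DifferentiableAt ℝ Φ z :=
    (hΦ.eventually (by simp)).mono fun z hz => hz.differentiableAt (by simp)
  have hD : DifferentiableAt ℝ (fderiv ℝ Φ) (s, y₀) :=
    (hΦ.fderiv_right (m := 1) (by norm_num)).differentiableAt (by simp)
  have hsym : IsSymmSndFDerivAt ℝ Φ (s, y₀) := hΦ.isSymmSndFDerivAt (by simp)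
  have hvert : ∀ t y, DifferentiableAt ℝ Φ (t, y) →
      HasFDerivAt (fun y => Φ (t, y)) ((fderiv ℝ Φ (t, y)).comp (.inr ℝ ℝ EM)) y := fun t y h =>
    h.hasFDerivAt.comp y (hasFDerivAt_prodMk_right t y)
  have hhor : ∀ t y, DifferentiableAt ℝ Φ (t, y) →
      HasDerivAt (fun t => Φ (t, y)) (fderiv ℝ Φ (t, y) (1, 0)) t := fun t y h =>
    HasFDerivAt.comp_hasDerivAt (l := Φ) (f := fun t => (t, y)) t h.hasFDerivAt ((hasDerivAt_id t).prodMk (hasDerivAt_const t y))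
  have hmd : ∀ᶠ t in 𝓝 s, MDifferentiableAt I 𝓘(ℝ, ℝ) (φ t) p := by
    have : ∀ᶠ t in 𝓝 s, ContMDiffAt (𝓘(ℝ, ℝ).prod I) 𝓘(ℝ, ℝ) ∞ (Function.uncurry φ) (t, p) :=
      (Continuous.prodMk_left p).continuousAt.eventually hφ
    filter_upwards [this] with t ht
    exact (ContMDiffAt.comp (g := Function.uncurry φ) p ht
      (contMDiffAt_const.prodMk contMDiffAt_id)).mdifferentiableAt (by simp)
  have hL : ∀ᶠ t in 𝓝 s, mvfderiv I (φ t) p X = fderiv ℝ Φ (t, y₀) ((0 : ℝ), X') := by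
    have : ∀ᶠ t in 𝓝 s, DifferentiableAt ℝ Φ (t, y₀) :=
      (Continuous.prodMk_left y₀).continuousAt.eventually hev
    filter_upwards [hmd, this] with t ht ht'
    rw [mvfderiv_eq_fderiv ht]
    exact congrArg (fun L => L X') (hvert t y₀ ht').fderiv
  -- No regularity of `φ'` is assumed; near the point it is the parameter derivative of `Φ`, which
  -- supplies its differentiability.
  have hφc : ∀ᶠ y in 𝓝 y₀, φ' (c.symm y) = fderiv ℝ Φ (s, y) (1, 0) := by
    have h1 : ∀ᶠ y in 𝓝 y₀, HasDerivAt (fun t => φ t (c.symm y)) (φ' (c.symm y)) s := by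
      have := hsymm.continuousAt
      rw [ContinuousAt, hcy] at this
      exact this.eventually hφ'
    have h2 : ∀ᶠ y in 𝓝 y₀, DifferentiableAt ℝ Φ (s, y) :=
      (Continuous.prodMk_right s).continuousAt.eventually hev
    filter_upwards [h1, h2] with y h1 h2
    exact h1.unique (hhor s y h2)
  have hR : HasFDerivAt (φ' ∘ c.symm)
      (((ContinuousLinearMap.apply ℝ ℝ ((1 : ℝ), (0 : EM))).comp
        (fderiv ℝ (fderiv ℝ Φ) (s, y₀))).comp (.inr ℝ ℝ EM)) y₀ := by
    have h1 : HasFDerivAt (fun z => fderiv ℝ Φ z ((1 : ℝ), (0 : EM)))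
        ((ContinuousLinearMap.apply ℝ ℝ ((1 : ℝ), (0 : EM))).comp
          (fderiv ℝ (fderiv ℝ Φ) (s, y₀))) (s, y₀) :=
      (ContinuousLinearMap.apply ℝ ℝ ((1 : ℝ), (0 : EM))).hasFDerivAt.comp (s, y₀) hD.hasFDerivAt
    exact (h1.comp y₀ (hasFDerivAt_prodMk_right s y₀)).congr_of_eventuallyEq hφc
  have hmd' : MDifferentiableAt I 𝓘(ℝ, ℝ) φ' p := by
    have h1 : MDifferentiableAt I 𝓘(ℝ, ℝ) ((φ' ∘ c.symm) ∘ c) p :=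
      MDifferentiableAt.comp p hR.differentiableAt.mdifferentiableAt
        (mdifferentiableAt_extChartAt (mem_chart_source H p))
    refine h1.congr_of_eventuallyEq ?_
    filter_upwards [extChartAt_source_mem_nhds (I := I) p] with q hq
    exact congrArg φ' ((extChartAt I p).left_inv hq).symm
  have hval : mvfderiv I φ' p X =
      fderiv ℝ (fderiv ℝ Φ) (s, y₀) ((1 : ℝ), (0 : EM)) ((0 : ℝ), X') := by
    rw [mvfderiv_eq_fderiv hmd', hsym.eq]
    exact congrArg (fun L => L X') hR.fderiv
  rw [hval]
  have h1 : HasFDerivAt (fun t => fderiv ℝ Φ (t, y₀))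
      ((fderiv ℝ (fderiv ℝ Φ) (s, y₀)).comp (.inl ℝ ℝ EM)) s :=
    hD.hasFDerivAt.comp s (hasFDerivAt_prodMk_left s y₀)
  have h2 := ((ContinuousLinearMap.apply ℝ ℝ ((0 : ℝ), X')).hasFDerivAt.comp s h1).hasDerivAt
  exact (h2.congr_of_eventuallyEq hL)

end Families

end CourantGeometry

end

noncomputable section

namespace CourantGeometry

variable {EM : Type*} [NormedAddCommGroup EM] [NormedSpace ℝ EM] [FiniteDimensional ℝ EM]
  {H : Type*} [TopologicalSpace H] {I : ModelWithCorners ℝ EM H}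
  {M : Type*} [TopologicalSpace M] [ChartedSpace H M] [IsManifold I ∞ M] [T2Space M]
  {F : Type*} [NormedAddCommGroup F] [NormedSpace ℝ F] [FiniteDimensional ℝ F]
  {E : M → Type*} [TopologicalSpace (Bundle.TotalSpace F E)]
  [∀ x, TopologicalSpace (E x)] [FiberBundle F E]
  [∀ x, AddCommGroup (E x)] [∀ x, Module ℝ (E x)] [VectorBundle ℝ F E]
  [ContMDiffVectorBundle ∞ F E I]

/-! ### The action of sections on functions -/

theorem _root_.ContMDiff.mdiffAt {f : M → ℝ} (hf : ContMDiff I 𝓘(ℝ, ℝ) ∞ f) (x : M) :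
    MDifferentiableAt I 𝓘(ℝ, ℝ) f x := (hf x).mdifferentiableAt (by simp)

namespace CourantAlgebroid
variable (C : CourantAlgebroid I F E)

/-- The derivative `ρ(u) f`. -/
def adv (u : Sec I F E) (f : M → ℝ) (x : M) : ℝ := mvfderiv I f x (C.anchor x (u x))

theorem contMDiff_adv (u : Sec I F E) {f : M → ℝ} (hf : ContMDiff I 𝓘(ℝ, ℝ) ∞ f) :
    ContMDiff I 𝓘(ℝ, ℝ) ∞ (C.adv u f) :=
  contMDiff_mvfderiv hf (C.contMDiff_anchor u)

/-- The derivative `ρ(u) f` as a smooth function. -/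
def advF (u : Sec I F E) (f : Fun I M) : Fun I M := ⟨C.adv u f, C.contMDiff_adv u f.contMDiff⟩

@[simp] theorem advF_apply (u : Sec I F E) (f : Fun I M) (x : M) :
    C.advF u f x = C.adv u f x := rfl

variable {C}

theorem contMDiff_ip (u v : Sec I F E) : ContMDiff I 𝓘(ℝ, ℝ) ∞ (C.ip u v) :=
  C.contMDiff_pairing u v

theorem adv_congr_fun {f g : M → ℝ} {x : M} (h : f =ᶠ[nhds x] g) (u : Sec I F E) :
    C.adv u f x = C.adv u g x := by
  unfold adv mvfderiv
  rw [h.mfderiv_eq, h.eq_of_nhds]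

@[simp] theorem adv_add_left (u v : Sec I F E) (f : M → ℝ) (x : M) :
    C.adv (u + v) f x = C.adv u f x + C.adv v f x := by simp [adv]

@[simp] theorem adv_sub_left (u v : Sec I F E) (f : M → ℝ) (x : M) :
    C.adv (u - v) f x = C.adv u f x - C.adv v f x := by simp [adv]

@[simp] theorem adv_fsmul_left (g : Fun I M) (u : Sec I F E) (f : M → ℝ) (x : M) :
    C.adv (fsmul g u) f x = g x * C.adv u f x := by simp [adv]

theorem tensAt_adv (f : M → ℝ) (x : M) : TensAt x fun u : Sec I F E => C.adv u f x :=
  ⟨fun u v => adv_add_left u v f x, fun g u => adv_fsmul_left g u f x⟩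

theorem adv_add (u : Sec I F E) {f g : M → ℝ} {x : M} (hf : MDifferentiableAt I 𝓘(ℝ, ℝ) f x)
    (hg : MDifferentiableAt I 𝓘(ℝ, ℝ) g x) :
    C.adv u (fun y => f y + g y) x = C.adv u f x + C.adv u g x := by
  simp [adv, mvfderiv_fun_add hf hg]

theorem adv_neg (u : Sec I F E) (f : M → ℝ) (x : M) :
    C.adv u (fun y => -f y) x = -C.adv u f x := by
  simp [adv, mvfderiv_fun_neg]

theorem adv_sub (u : Sec I F E) {f g : M → ℝ} {x : M} (hf : MDifferentiableAt I 𝓘(ℝ, ℝ) f x)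
    (hg : MDifferentiableAt I 𝓘(ℝ, ℝ) g x) :
    C.adv u (fun y => f y - g y) x = C.adv u f x - C.adv u g x := by
  simp [adv, mvfderiv_fun_sub hf hg]

theorem adv_mul (u : Sec I F E) {f g : M → ℝ} {x : M} (hf : MDifferentiableAt I 𝓘(ℝ, ℝ) f x)
    (hg : MDifferentiableAt I 𝓘(ℝ, ℝ) g x) :
    C.adv u (fun y => f y * g y) x = f x * C.adv u g x + g x * C.adv u f x := by
  simp [adv, mvfderiv_fun_mul hf hg]

@[simp] theorem adv_const (u : Sec I F E) (c : ℝ) (x : M) : C.adv u (fun _ => c) x = 0 := by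
  simp [adv, mvfderiv_const]

theorem adv_sum (u : Sec I F E) {ι : Type*} (t : Finset ι) {f : ι → M → ℝ} {x : M}
    (hf : ∀ i ∈ t, MDifferentiableAt I 𝓘(ℝ, ℝ) (f i) x) :
    C.adv u (fun y => ∑ i ∈ t, f i y) x = ∑ i ∈ t, C.adv u (f i) x := by
  classical
  have hm : ∀ s ⊆ t, MDifferentiableAt I 𝓘(ℝ, ℝ) (fun y => ∑ i ∈ s, f i y) x ∧
      C.adv u (fun y => ∑ i ∈ s, f i y) x = ∑ i ∈ s, C.adv u (f i) x := by
    intro s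
    induction s using Finset.induction_on with
    | empty => intro _; exact ⟨by simpa using mdifferentiableAt_const, by simp⟩
    | insert i s hi ih =>
      intro hs
      obtain ⟨h1, h2⟩ := ih fun j hj => hs (Finset.mem_insert_of_mem hj)
      have h3 := hf i (hs (Finset.mem_insert_self i s))
      simp only [Finset.sum_insert hi]
      exact ⟨h3.add h1, by rw [adv_add u h3 h1, h2]⟩
  exact (hm t subset_rfl).2

/-! ### Algebra of the pairing -/

@[simp] theorem ip_add_left (u v w : Sec I F E) (x : M) :
    C.ip (u + v) w x = C.ip u w x + C.ip v w x := by simp [ip]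
@[simp] theorem ip_add_right (u v w : Sec I F E) (x : M) :
    C.ip u (v + w) x = C.ip u v x + C.ip u w x := by simp [ip]
@[simp] theorem ip_sub_left (u v w : Sec I F E) (x : M) :
    C.ip (u - v) w x = C.ip u w x - C.ip v w x := by simp [ip]
@[simp] theorem ip_sub_right (u v w : Sec I F E) (x : M) :
    C.ip u (v - w) x = C.ip u v x - C.ip u w x := by simp [ip]
@[simp] theorem ip_neg_left (u w : Sec I F E) (x : M) : C.ip (-u) w x = -C.ip u w x := by
  simp [ip]
@[simp] theorem ip_fsmul_left (f : Fun I M) (u w : Sec I F E) (x : M) :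
    C.ip (fsmul f u) w x = f x * C.ip u w x := by simp [ip]
@[simp] theorem ip_fsmul_right (f : Fun I M) (u w : Sec I F E) (x : M) :
    C.ip u (fsmul f w) x = f x * C.ip u w x := by simp [ip]
@[simp] theorem ip_smul_left (c : ℝ) (u w : Sec I F E) (x : M) :
    C.ip (c • u) w x = c * C.ip u w x := by simp [ip]
@[simp] theorem ip_zero_left (w : Sec I F E) (x : M) : C.ip 0 w x = 0 := by simp [ip]

/-- Completeness of a pair of dual bases: contracting with `⟨a, ·⟩` substitutes `a`. -/
theorem contr_ip (a : Sec I F E) {p : M} {φ : Sec I F E → ℝ} (hφ : TensAt p φ) :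
    C.contr p (fun e e' => C.ip a e p * φ e') = φ a := by
  obtain ⟨ℓ, hℓ⟩ := hφ.exists_lin C
  simp only [hℓ, ip]
  rw [C.contr_eq_trace (fun x y => C.pairing p (a p) x * ℓ y), ← C.trace_pairing_left]
  exact trace_congr fun x y => by rw [(C.pairing_symm p).eq]

/-! ### The anchor is a homomorphism -/

theorem bracket_fsmul (u : Sec I F E) (f : Fun I M) (v : Sec I F E) :
    C.bracket u (fsmul f v) = fsmul f (C.bracket u v) + fsmul (C.advF u f) v := by
  ext x
  rw [C.leibniz]
  simp [adv]

/-- The Jacobi identity for `u`, `v`, `f w`, minus `f` times the one for `u`, `v`, `w`, leaves the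
difference of the two sides multiplied by `w`. A section nonzero at `x` isolates it; in a zero fibre
every anchor value is zero. -/
theorem adv_bracket (u v : Sec I F E) (f : Fun I M) (x : M) :
    C.adv (C.bracket u v) f x = C.adv u (C.advF v f) x - C.adv v (C.advF u f) x := by
  have key : ∀ w : Sec I F E,
      (C.adv (C.bracket u v) f x - (C.adv u (C.advF v f) x - C.adv v (C.advF u f) x)) • w x = 0 := by
    intro w
    have h := congrArg (fun s : Sec I F E => s x) (C.jacobi u v (fsmul f w))
    have h0 := congrArg (fun s : Sec I F E => f x • s x) (C.jacobi u v w)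
    simp only [bracket_fsmul, map_add, ContMDiffSection.coe_add, Pi.add_apply, fsmul_apply,
      advF_apply, smul_add] at h h0
    rw [h0] at h
    rw [← sub_eq_zero] at h
    rw [← neg_eq_zero, ← h]
    module
  by_cases hw : ∃ a : E x, a ≠ 0
  · obtain ⟨a, ha⟩ := hw
    have := key (secThrough x a)
    rw [secThrough_apply, smul_eq_zero, or_iff_left ha, sub_eq_zero] at this
    exact this
  · have h0 : ∀ w : Sec I F E, w x = 0 := fun w => by
      by_contra h
      exact hw ⟨_, h⟩
    simp [adv, h0]

end CourantAlgebroid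

/-! ### Covariant derivatives -/

namespace Connection
open CourantAlgebroid
variable {C : CourantAlgebroid I F E} (D : Connection C)

theorem D_fsmul (u : Sec I F E) (f : Fun I M) (v : Sec I F E) :
    D.D u (fsmul f v) = fsmul f (D.D u v) + fsmul (C.advF u f) v := by
  ext x
  rw [D.leibniz]
  simp [adv]

theorem adv_ip (u v w : Sec I F E) (x : M) :
    C.adv u (C.ip v w) x = C.ip (D.D u v) w x + C.ip v (D.D u w) x :=
  D.metric u v w x

theorem tensAt_D (v : Sec I F E) (p : M) : TensAt p fun u => D.D u v p :=
  ⟨fun u u' => by simp, fun f u => by simp [D.fsmul_left]⟩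

theorem tensAt_ip_D (v w : Sec I F E) (p : M) : TensAt p fun u => C.ip (D.D u v) w p :=
  ⟨fun u u' => by simp, fun f u => by simp [D.fsmul_left]⟩

/-- `[u, v] - D_u v + D_v u`, which is the section dual to `w ↦ ⟨D_w u, v⟩` when there is no
torsion. -/
def curl (u v : Sec I F E) : Sec I F E := C.bracket u v - D.D u v + D.D v u

variable {D} in
theorem ip_curl (h : ∀ u v w x, D.torsion u v w x = 0) (u v w : Sec I F E) (x : M) :
    C.ip (D.curl u v) w x = C.ip (D.D w u) v x := by
  have := h u v w x
  simp only [torsion, ip_sub_left] at this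
  simp only [curl, ip_sub_left, ip_add_left]
  linarith

theorem second_fsmul_left (f : Fun I M) (u v z : Sec I F E) :
    D.second (fsmul f u) v z = fsmul f (D.second u v z) := by
  ext x; simp [second, D.fsmul_left, smul_sub]

theorem second_fsmul_middle (f : Fun I M) (u v z : Sec I F E) :
    D.second u (fsmul f v) z = fsmul f (D.second u v z) := by
  ext x; simp [second, D.fsmul_left, D.D_fsmul, smul_sub]

theorem second_add_left (u u' v z : Sec I F E) :
    D.second (u + u') v z = D.second u v z + D.second u' v z := by
  simp only [second, map_add, LinearMap.add_apply]; abel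

theorem second_add_middle (u v v' z : Sec I F E) :
    D.second u (v + v') z = D.second u v z + D.second u v' z := by
  simp only [second, map_add, LinearMap.add_apply]; abel

theorem second_add_right (u v z z' : Sec I F E) :
    D.second u v (z + z') = D.second u v z + D.second u v z' := by
  simp only [second, map_add]; abel

theorem comm_fsmul_left (f : Fun I M) (u v z : Sec I F E) :
    D.comm (fsmul f u) v z = fsmul f (D.comm u v z) := by
  ext x; simp [comm, second_fsmul_left, second_fsmul_middle, smul_sub]

theorem comm_fsmul_middle (f : Fun I M) (u v z : Sec I F E) :
    D.comm u (fsmul f v) z = fsmul f (D.comm u v z) := by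
  ext x; simp [comm, second_fsmul_left, second_fsmul_middle, smul_sub]

theorem comm_add_left (u u' v z : Sec I F E) :
    D.comm (u + u') v z = D.comm u v z + D.comm u' v z := by
  simp only [comm, second_add_left, second_add_middle]; abel

theorem comm_add_middle (u v v' z : Sec I F E) :
    D.comm u (v + v') z = D.comm u v z + D.comm u v' z := by
  simp only [comm, second_add_left, second_add_middle]; abel

theorem comm_add_right (u v z z' : Sec I F E) :
    D.comm u v (z + z') = D.comm u v z + D.comm u v z' := by
  simp only [comm, second_add_right]; abel

/-- The second covariant derivatives of `f` do not commute: their commutator is the derivative along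
`[u, v] - D_u v + D_v u`. This is the only failure of `comm` to be tensorial. -/
theorem comm_fsmul_right (f : Fun I M) (u v z : Sec I F E) :
    D.comm u v (fsmul f z) = fsmul f (D.comm u v z) + fsmul (C.advF (D.curl u v) f) z := by
  ext x
  simp only [comm, second, D_fsmul, map_add, ContMDiffSection.coe_add, ContMDiffSection.coe_sub,
    Pi.add_apply, Pi.sub_apply, fsmul_apply, advF_apply, curl, adv_add_left, adv_sub_left,
    adv_bracket]
  module

/-- The curvature `D_x D_y z - D_y D_x z - D_{[x,y]} z`. -/
def curv (x y z : Sec I F E) : Sec I F E :=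
  D.D x (D.D y z) - D.D y (D.D x z) - D.D (C.bracket x y) z

theorem curv_eq (x y z : Sec I F E) : D.curv x y z = D.comm x y z - D.D (D.curl x y) z := by
  simp only [curv, comm, second, curl, map_add, map_sub, LinearMap.add_apply, LinearMap.sub_apply]
  abel

/-- Subtracting the derivative along the curl removes exactly the defect found in
`comm_fsmul_right`. The operator remains non-tensorial in `x` and `y`. -/
theorem curv_fsmul_left (f : Fun I M) (x y z : Sec I F E) :
    D.curv x y (fsmul f z) = fsmul f (D.curv x y z) := by
  simp only [curv_eq, comm_fsmul_right, D_fsmul]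
  ext q
  simp [smul_sub]

-- Without torsion `⟨D_e x, y⟩` is the pairing of `e` with `curl x y`, so the quadratic term
-- contracts to a derivative of `z` along `curl x y`. It turns the first commutator into the
-- curvature formed with the bracket.
variable {D} in
theorem riemann_eq (hD : ∀ u v w x, D.torsion u v w x = 0) (w z x y : Sec I F E) (p : M) :
    D.riemann w z x y p = 1 / 2 * (C.ip (D.curv x y z) w p + C.ip (D.comm z w x) y p) := by
  have h : C.contr p (fun e e' => C.ip (D.D e x) y p * C.ip (D.D e' z) w p) =
      C.ip (D.D (D.curl x y) z) w p := by
    rw [← contr_ip (D.curl x y) (D.tensAt_ip_D z w p)]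
    exact congrArg _ (funext fun e => funext fun e' => by rw [ip_curl hD])
  rw [riemann, h, curv_eq, ip_sub_left]
  ring


/-! ### Change of the connection -/

/-- The difference `A_u v = D'_u v - D_u v` of two connections. -/
def diff (D D' : Connection C) : Sec I F E →ₗ[ℝ] Sec I F E →ₗ[ℝ] Sec I F E := D'.D - D.D

theorem diff_apply (D D' : Connection C) (u v : Sec I F E) :
    D.diff D' u v = D'.D u v - D.D u v := rfl

theorem D_eq_add_diff (D D' : Connection C) (u v : Sec I F E) :
    D'.D u v = D.D u v + D.diff D' u v := by rw [diff_apply]; abel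

theorem diff_fsmul_left (D D' : Connection C) (f : Fun I M) (u v : Sec I F E) :
    D.diff D' (fsmul f u) v = fsmul f (D.diff D' u v) := by
  ext x; simp [diff_apply, D.fsmul_left, D'.fsmul_left, smul_sub]

theorem diff_fsmul_right (D D' : Connection C) (f : Fun I M) (u v : Sec I F E) :
    D.diff D' u (fsmul f v) = fsmul f (D.diff D' u v) := by
  ext x; simp [diff_apply, D_fsmul, smul_sub]

theorem ip_diff_antisymm (D D' : Connection C) (u v w : Sec I F E) (x : M) :
    C.ip (D.diff D' u v) w x = -C.ip v (D.diff D' u w) x := by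
  have h := D.adv_ip u v w x
  have h' := D'.adv_ip u v w x
  simp only [diff_apply, ip_sub_left, ip_sub_right]
  linarith

/-- The bracket is common to the two torsions and drops out of their difference. -/
theorem ip_diff_cyclic {D D' : Connection C} (hD : ∀ u v w x, D.torsion u v w x = 0)
    (hD' : ∀ u v w x, D'.torsion u v w x = 0) (u v w : Sec I F E) (x : M) :
    C.ip (D.diff D' u v) w x - C.ip (D.diff D' v u) w x = -C.ip (D.diff D' w u) v x := by
  have h := hD u v w x
  have h' := hD' u v w x
  simp only [torsion, ip_sub_left] at h h'
  simp only [diff_apply, ip_sub_left]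
  linarith

/-- The covariant derivative `(D_z A)_u v` of a vector-valued bilinear operation. -/
def cov (A : Sec I F E →ₗ[ℝ] Sec I F E →ₗ[ℝ] Sec I F E) (z u v : Sec I F E) : Sec I F E :=
  D.D z (A u v) - A (D.D z u) v - A u (D.D z v)

/-- Writing the bracket as `curl x y + D_x y - D_y x` turns the terms linear in the difference into
covariant derivatives, apart from one term along the curl. -/
theorem curv_change (D D' : Connection C) (x y z : Sec I F E) :
    D'.curv x y z = D.curv x y z + D.cov (D.diff D') x y z - D.cov (D.diff D') y x z
      + D.diff D' x (D.diff D' y z) - D.diff D' y (D.diff D' x z)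
      - D.diff D' (D.curl x y) z := by
  simp only [curv, D_eq_add_diff D D', cov, curl, map_add, map_sub, LinearMap.add_apply,
    LinearMap.sub_apply]
  abel

theorem comm_change (D D' : Connection C) (z w x : Sec I F E) :
    D'.comm z w x = D.comm z w x + D.cov (D.diff D') z w x - D.cov (D.diff D') w z x
      + D.diff D' z (D.diff D' w x) - D.diff D' w (D.diff D' z x)
      - D.D (D.diff D' z w - D.diff D' w z) x
      - D.diff D' (D.diff D' z w - D.diff D' w z) x := by
  simp only [comm, second, D_eq_add_diff D D', cov, map_add, map_sub, LinearMap.add_apply,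
    LinearMap.sub_apply]
  abel

/-- The change of the Riemann tensor when a torsion-free connection is replaced by another one. -/
theorem riemann_change {D D' : Connection C} (hD : ∀ u v w x, D.torsion u v w x = 0)
    (hD' : ∀ u v w x, D'.torsion u v w x = 0) (w z x y : Sec I F E) (p : M) :
    D'.riemann w z x y p = D.riemann w z x y p + 1 / 2 *
      (C.ip (D.cov (D.diff D') x y z - D.cov (D.diff D') y x z
        + D.diff D' x (D.diff D' y z) - D.diff D' y (D.diff D' x z)) w p
      + C.ip (D.cov (D.diff D') z w x - D.cov (D.diff D') w z x
        + D.diff D' z (D.diff D' w x) - D.diff D' w (D.diff D' z x)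
        - D.diff D' (D.diff D' z w - D.diff D' w z) x) y p) := by
  rw [riemann_eq hD, riemann_eq hD', curv_change D D', comm_change D D']
  -- The one remaining derivative of a section, coming from `comm_change`, cancels against the curl
  -- term of `curv_change`. This uses the cyclic identity for the difference together with the
  -- vanishing of the torsion.
  have h1 : C.ip (D.D (D.diff D' z w - D.diff D' w z) x) y p =
      -C.ip (D.diff D' (D.curl x y) z) w p := by
    rw [← ip_curl hD, C.ip_symm, ip_sub_left, ip_diff_cyclic hD hD']
  simp only [ip_add_left, ip_sub_left, h1]
  ring

end Connection

end CourantGeometry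

end

noncomputable section

namespace CourantGeometry

variable {EM : Type*} [NormedAddCommGroup EM] [NormedSpace ℝ EM] [FiniteDimensional ℝ EM]
  {H : Type*} [TopologicalSpace H] {I : ModelWithCorners ℝ EM H}
  {M : Type*} [TopologicalSpace M] [ChartedSpace H M] [IsManifold I ∞ M] [T2Space M]
  {F : Type*} [NormedAddCommGroup F] [NormedSpace ℝ F] [FiniteDimensional ℝ F]
  {E : M → Type*} [TopologicalSpace (Bundle.TotalSpace F E)]
  [∀ x, TopologicalSpace (E x)] [FiberBundle F E]
  [∀ x, AddCommGroup (E x)] [∀ x, Module ℝ (E x)] [VectorBundle ℝ F E]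
  [ContMDiffVectorBundle ∞ F E I]

namespace CourantAlgebroid
variable {C : CourantAlgebroid I F E}

/-! ### Linearity of contractions of sections. -/

theorem contr_congr {p : M} {T T' : Sec I F E → Sec I F E → ℝ} (h : ∀ e e', T e e' = T' e e') :
    C.contr p T = C.contr p T' :=
  Finset.sum_congr rfl fun _ _ => h _ _

theorem contr_add {p : M} (T T' : Sec I F E → Sec I F E → ℝ) :
    C.contr p (fun e e' => T e e' + T' e e') = C.contr p T + C.contr p T' :=
  Finset.sum_add_distrib

theorem contr_sub {p : M} (T T' : Sec I F E → Sec I F E → ℝ) :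
    C.contr p (fun e e' => T e e' - T' e e') = C.contr p T - C.contr p T' :=
  Finset.sum_sub_distrib ..

theorem contr_mul_left {p : M} (c : ℝ) (T : Sec I F E → Sec I F E → ℝ) :
    C.contr p (fun e e' => c * T e e') = c * C.contr p T :=
  (Finset.mul_sum ..).symm

theorem tensAt_ip_left (w : Sec I F E) (p : M) : TensAt p fun u => C.ip u w p :=
  ⟨fun u v => ip_add_left u v w p, fun f u => ip_fsmul_left f u w p⟩

theorem tensAt_ip_right (u : Sec I F E) (p : M) : TensAt p fun w => C.ip u w p :=
  ⟨fun v w => ip_add_right u v w p, fun f w => ip_fsmul_right f u w p⟩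

/-! ### Local dual frames -/

open Filter Topology in
/-- A smooth function that coincides with `1 / f` near a point where `f` does not vanish. -/
theorem exists_local_inv {f : M → ℝ} (hf : ContMDiff I 𝓘(ℝ, ℝ) ∞ f) {p : M} (hp : f p ≠ 0) :
    ∃ g : Fun I M, ∀ᶠ q in 𝓝 p, g q * f q = 1 := by
  have hev : {q | f q ≠ 0} ∈ 𝓝 p := hf.continuous.continuousAt.eventually_ne hp
  obtain ⟨b, -, hb⟩ := (SmoothBumpFunction.nhds_basis_tsupport (I := I) p).mem_iff.1 hev
  refine ⟨⟨fun q => b q * (f q)⁻¹, ?_⟩, ?_⟩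
  · refine contMDiff_of_tsupport fun q hq => ?_
    have hq' : q ∈ tsupport b := closure_mono (by
      intro y hy
      simp only [Function.mem_support] at hy ⊢
      exact left_ne_zero_of_mul hy) hq
    exact b.contMDiff.contMDiffAt.mul ((hf q).inv₀ (hb hq'))
  · filter_upwards [b.eventuallyEq_one, hev] with q h1 h2
    change b q * (f q)⁻¹ * f q = 1
    rw [h1]
    simp [inv_mul_cancel₀ h2]

open Filter Topology in
variable (C) in
/-- Sections that form dual frames of `E` over a neighbourhood of the point `p`. -/
theorem exists_dual_frames (p : M) : ∃ e f : Fin (Module.finrank ℝ F) → Sec I F E,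
    ∀ᶠ q in 𝓝 p, ∀ a : E q, ∑ i, C.pairing q (e i q) a • f i q = a := by
  obtain ⟨g, hg⟩ := exists_local_inv (contMDiff_det (C.contMDiff_gram p)) (C.det_gram_ne_zero p)
  let c : Fin (Module.finrank ℝ F) → Fin (Module.finrank ℝ F) → Fun I M := fun i j =>
    ⟨fun q => g q * (C.gram p q).adjugate i j, g.contMDiff.mul (C.contMDiff_adjugate_gram p i j)⟩
  refine ⟨C.frame p, fun j => ∑ i, fsmul (c i j) (C.frame p i), ?_⟩
  filter_upwards [hg] with q hq a
  have h0 : (C.gram p q).det ≠ 0 := right_ne_zero_of_mul_eq_one hq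
  have h := congrArg (g q • ·) (C.gram_expand p q h0 a)
  simp only [smul_smul, hq, one_smul, Finset.smul_sum] at h
  conv_rhs => rw [h, Finset.sum_comm]
  simp only [sec_sum_apply, fsmul_apply, Finset.smul_sum, smul_smul]
  refine Finset.sum_congr rfl fun j _ => Finset.sum_congr rfl fun i _ => ?_
  change (_ * (g q * _)) • _ = _
  congr 1
  ring

/-- A smooth family of tensors with two indices. -/
structure SmoothTensor (T : Sec I F E → Sec I F E → M → ℝ) : Prop where
  smooth : ∀ u v, ContMDiff I 𝓘(ℝ, ℝ) ∞ (T u v)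
  left : ∀ v q, TensAt q fun u => T u v q
  right : ∀ u q, TensAt q fun v => T u v q

/-- The frame in `contr` is chosen separately at each point. Tensoriality allows replacing it by one
smooth pair of dual frames near a point, so that contractions can be differentiated. -/
theorem contr_eq_sum {p : M} {T : Sec I F E → Sec I F E → ℝ} (h₁ : ∀ v, TensAt p fun u => T u v)
    (h₂ : ∀ u, TensAt p fun v => T u v) {ι : Type*} [Fintype ι] {e f : ι → Sec I F E}
    (h : ∀ a : E p, ∑ i, C.pairing p (e i p) a • f i p = a) :
    C.contr p T = ∑ i, T (e i) (f i) := by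
  obtain ⟨ℓ, hℓ⟩ := exists_tensor₂ C h₁ h₂
  simp only [contr_congr (C := C) hℓ]
  rw [C.contr_eq_trace fun x y => ℓ x y,
    trace_eq_sum ⟨by simp, by simp, by simp, by simp⟩ h]
  simp [hℓ]

/-- The contraction of a smooth tensor is smooth. -/
theorem SmoothTensor.contMDiff_contr {T : Sec I F E → Sec I F E → M → ℝ} (hT : SmoothTensor T) :
    ContMDiff I 𝓘(ℝ, ℝ) ∞ fun q => C.contr q fun e e' => T e e' q := by
  intro p
  obtain ⟨e, f, hef⟩ := C.exists_dual_frames p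
  have hs : ContMDiff I 𝓘(ℝ, ℝ) ∞ fun q => ∑ i, T (e i) (f i) q :=
    contMDiff_finsetSum fun i _ => hT.smooth _ _
  refine (hs p).congr_of_eventuallyEq ?_
  filter_upwards [hef] with q hq
  exact contr_eq_sum (fun v => hT.left v q) (fun u => hT.right u q) hq

end CourantAlgebroid

namespace Connection
open CourantAlgebroid
variable {C : CourantAlgebroid I F E} (D : Connection C)

/-- The covariant derivative commutes with contractions. -/
theorem adv_contr {T : Sec I F E → Sec I F E → M → ℝ} (hT : SmoothTensor T) (z : Sec I F E)
    (p : M) :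
    C.adv z (fun q => C.contr q fun e e' => T e e' q) p =
      C.contr p fun e e' => C.adv z (T e e') p - T (D.D z e) e' p - T e (D.D z e') p := by
  obtain ⟨e, f, hef⟩ := C.exists_dual_frames p
  have h1 : C.adv z (fun q => C.contr q fun e e' => T e e' q) p =
      ∑ i, C.adv z (T (e i) (f i)) p := by
    rw [← adv_sum z _ fun i _ => (hT.smooth _ _).mdiffAt p]
    refine adv_congr_fun ?_ z
    filter_upwards [hef] with q hq
    exact contr_eq_sum (fun v => hT.left v q) (fun u => hT.right u q) hq
  have hl : ∀ (g : Fun I M) u v, T (fsmul g u) v = fun q => g q * T u v q := fun g u v =>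
    funext fun q => (hT.left v q).fsmul g u
  have hr : ∀ (g : Fun I M) u v, T u (fsmul g v) = fun q => g q * T u v q := fun g u v =>
    funext fun q => (hT.right u q).fsmul g v
  have hl' : ∀ u u' v, T (u + u') v = fun q => T u v q + T u' v q := fun u u' v =>
    funext fun q => (hT.left v q).add u u'
  have hr' : ∀ u v v', T u (v + v') = fun q => T u v q + T u v' q := fun u v v' =>
    funext fun q => (hT.right u q).add v v'
  rw [h1, contr_eq_sum (e := e) (f := f) ?_ ?_ hef.self_of_nhds]
  · simp only [Finset.sum_sub_distrib]
    -- The remaining claim is that the inverse pairing `∑ e_i ⊗ f_i` is covariantly constant.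
    suffices H : ∑ i, (T (D.D z (e i)) (f i) p + T (e i) (D.D z (f i)) p) = 0 by
      rw [Finset.sum_add_distrib] at H
      linarith
    obtain ⟨ℓ, hℓ⟩ := exists_tensor₂ C (fun v => hT.left v p) (fun u => hT.right u p)
    -- Obtained by differentiating `⟨w, w'⟩ = ∑ ⟨e_i, w⟩⟨f_i, w'⟩`, valid near `p`, and subtracting
    -- the same expansion of the metricity identity.
    have hz : ∀ w w' : Sec I F E, ∑ i, (C.ip w (D.D z (e i)) p * C.ip w' (f i) p +
        C.ip w (e i) p * C.ip w' (D.D z (f i)) p) = 0 := by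
      intro w w'
      have hww : C.ip w w' =ᶠ[nhds p] fun q => ∑ i, C.ip (e i) w q * C.ip (f i) w' q := by
        filter_upwards [hef] with q hq
        conv_lhs => rw [ip, ← hq (w q)]
        simp [ip]
      have h2 := adv_congr_fun (C := C) hww z
      have hm : ∀ a b : Sec I F E, MDifferentiableAt I 𝓘(ℝ, ℝ) (C.ip a b) p := fun a b =>
        (contMDiff_ip a b).mdiffAt p
      rw [adv_sum z _ (f := fun i q => C.ip (e i) w q * C.ip (f i) w' q)
        fun i _ => (hm _ _).mul (hm _ _), D.adv_ip] at h2
      simp only [adv_mul z (hm _ _) (hm _ _), D.adv_ip] at h2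
      have hexp : ∀ a b : Sec I F E, C.ip a b p = ∑ i, C.ip (e i) a p * C.ip (f i) b p := by
        intro a b
        conv_lhs => rw [ip, ← hef.self_of_nhds (a p)]
        simp [ip]
      rw [hexp (D.D z w), hexp w (D.D z w'), ← sub_eq_zero, ← Finset.sum_add_distrib,
        ← Finset.sum_sub_distrib] at h2
      rw [← neg_eq_zero, ← h2, ← Finset.sum_neg_distrib]
      refine Finset.sum_congr rfl fun i _ => ?_
      rw [C.ip_symm w (D.D z (e i)), C.ip_symm w' (f i), C.ip_symm w (e i),
        C.ip_symm w' (D.D z (f i))]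
      ring
    have hexp : ∀ a b : E p, ℓ a b = ∑ j, ∑ k, C.pairing p (e j p) a * C.pairing p (e k p) b *
        ℓ (f j p) (f k p) := by
      intro a b
      conv_lhs => rw [← hef.self_of_nhds a, ← hef.self_of_nhds b]
      simp only [map_sum, map_smul, LinearMap.sum_apply, LinearMap.smul_apply, smul_eq_mul,
        Finset.mul_sum]
      rw [Finset.sum_comm]
      refine Finset.sum_congr rfl fun j _ => Finset.sum_congr rfl fun k _ => by ring
    simp only [hℓ]
    calc ∑ i, (ℓ (D.D z (e i) p) (f i p) + ℓ (e i p) (D.D z (f i) p))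
        = ∑ i, ∑ j, ∑ k, (C.ip (e j) (D.D z (e i)) p * C.ip (e k) (f i) p +
            C.ip (e j) (e i) p * C.ip (e k) (D.D z (f i)) p) * ℓ (f j p) (f k p) := by
          refine Finset.sum_congr rfl fun i _ => ?_
          rw [hexp (D.D z (e i) p), hexp (e i p)]
          simp only [← Finset.sum_add_distrib, ip]
          refine Finset.sum_congr rfl fun j _ => Finset.sum_congr rfl fun k _ => by ring
      _ = 0 := by
          rw [Finset.sum_comm]
          refine Finset.sum_eq_zero fun j _ => ?_
          rw [Finset.sum_comm]
          refine Finset.sum_eq_zero fun k _ => ?_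
          rw [← Finset.sum_mul, hz, zero_mul]
  · intro v
    constructor
    · intro u u'
      simp only [map_add, hl', adv_add z ((hT.smooth _ _).mdiffAt p) ((hT.smooth _ _).mdiffAt p)]
      ring
    · intro g u
      simp only [D_fsmul, hl', hl, adv_mul z (g.contMDiff.mdiffAt p) ((hT.smooth _ _).mdiffAt p),
        advF_apply, smul_eq_mul]
      ring
  · intro u
    constructor
    · intro v v'
      simp only [map_add, hr', adv_add z ((hT.smooth _ _).mdiffAt p) ((hT.smooth _ _).mdiffAt p)]
      ring
    · intro g v
      simp only [D_fsmul, hr', hr, adv_mul z (g.contMDiff.mdiffAt p) ((hT.smooth _ _).mdiffAt p),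
        advF_apply, smul_eq_mul]
      ring

end Connection

end CourantGeometry

end

noncomputable section

namespace CourantGeometry

variable {EM : Type*} [NormedAddCommGroup EM] [NormedSpace ℝ EM] [FiniteDimensional ℝ EM]
  {H : Type*} [TopologicalSpace H] {I : ModelWithCorners ℝ EM H}
  {M : Type*} [TopologicalSpace M] [ChartedSpace H M] [IsManifold I ∞ M] [T2Space M]
  {F : Type*} [NormedAddCommGroup F] [NormedSpace ℝ F] [FiniteDimensional ℝ F]
  {E : M → Type*} [TopologicalSpace (Bundle.TotalSpace F E)]
  [∀ x, TopologicalSpace (E x)] [FiberBundle F E]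
  [∀ x, AddCommGroup (E x)] [∀ x, Module ℝ (E x)] [VectorBundle ℝ F E]
  [ContMDiffVectorBundle ∞ F E I]

/-! ### Algebra of the change of the Ricci tensor in a fibre -/

namespace CourantAlgebroid
variable {C : CourantAlgebroid I F E} {p : M}

theorem trace_pairing_mul (φ : E p →ₗ[ℝ] ℝ) (a : E p) :
    C.trace p (fun x y => C.pairing p a x * φ y) = φ a := by
  rw [← C.trace_pairing_left φ a]
  exact trace_congr fun x y => by rw [(C.pairing_symm p).eq]

theorem trace_pairing_mul' (φ : E p →ₗ[ℝ] ℝ) (a : E p) :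
    C.trace p (fun x y => C.pairing p a y * φ x) = φ a := by
  rw [← C.trace_pairing_right φ a]
  exact trace_congr fun x y => by rw [(C.pairing_symm p).eq]

variable (C) in
/-- Twice the change of the Ricci tensor, evaluated on `v` and `u`, in terms of the values `a` and
`c` of the difference of two connections and of its covariant derivative. -/
def ricciVar (a : E p →ₗ[ℝ] E p →ₗ[ℝ] E p) (c : E p →ₗ[ℝ] E p →ₗ[ℝ] E p →ₗ[ℝ] E p) (v u : E p) :
    ℝ :=
  C.trace p fun x y =>
    C.pairing p (c x u v - c u x v + a x (a u v) - a u (a x v)) y +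
    C.pairing p (c v y x - c y v x + a v (a y x) - a y (a v x) - a (a v y - a y v) x) u

variable (C) in
/-- The contraction `c_z(x, w)_x` of the covariant derivative of a difference tensor. -/
def covTrace (c : E p →ₗ[ℝ] E p →ₗ[ℝ] E p →ₗ[ℝ] E p) (z w : E p) : ℝ :=
  C.trace p fun x y => C.pairing p (c z x w) y

variable (C) in
/-- The contraction `a(x, w)_x` of a difference tensor. -/
def diffTrace (a : E p →ₗ[ℝ] E p →ₗ[ℝ] E p) : E p →ₗ[ℝ] ℝ where
  toFun w := C.trace p fun x y => C.pairing p (a x w) y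
  map_add' w w' := by simp [trace, Finset.sum_add_distrib]
  map_smul' r w := by simp [trace, Finset.mul_sum]

theorem diffTrace_apply (a : E p →ₗ[ℝ] E p →ₗ[ℝ] E p) (w : E p) :
    C.diffTrace a w = C.trace p fun x y => C.pairing p (a x w) y := rfl

theorem bilin_covTrace (c : E p →ₗ[ℝ] E p →ₗ[ℝ] E p →ₗ[ℝ] E p) : Bilin (C.covTrace c) := by
  constructor <;> intros <;> simp [covTrace, trace, Finset.sum_add_distrib, Finset.mul_sum]

/-- The hypotheses on a difference of two Levi-Civita connections of the same metric, in a fibre. -/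
structure Pure (C : CourantAlgebroid I F E) (g : E p →ₗ[ℝ] E p) (a : E p →ₗ[ℝ] E p →ₗ[ℝ] E p)
    (c : E p →ₗ[ℝ] E p →ₗ[ℝ] E p →ₗ[ℝ] E p) : Prop where
  invol : ∀ x, g (g x) = x
  adj : ∀ x y, C.pairing p (g x) y = C.pairing p x (g y)
  a_left : ∀ x y, a (g x) y = g (a x y)
  a_right : ∀ x y, a x (g y) = g (a x y)
  a_anti : ∀ x y z, C.pairing p (a x y) z = -C.pairing p y (a x z)
  a_cyc : ∀ x y z, C.pairing p (a x y) z - C.pairing p (a y x) z = -C.pairing p (a z x) y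
  c_left : ∀ w x y, c w (g x) y = g (c w x y)
  c_right : ∀ w x y, c w x (g y) = g (c w x y)
  c_anti : ∀ w x y z, C.pairing p (c w x y) z = -C.pairing p y (c w x z)

namespace Pure
variable {g : E p →ₗ[ℝ] E p} {a : E p →ₗ[ℝ] E p →ₗ[ℝ] E p}
  {c : E p →ₗ[ℝ] E p →ₗ[ℝ] E p →ₗ[ℝ] E p}

/-- The tensors commute with `g` in every slot except the derivative slot of `c`. Conjugating by `g`
therefore fixes all quadratic terms and all linear terms in which neither `u` nor `v` is the
direction of differentiation; what survives is a trace of `c` by antisymmetry. -/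
theorem ricciVar_sub (h : Pure C g a c) (v u : E p) :
    C.ricciVar a c v u - C.ricciVar a c (g v) (g u) =
      -C.covTrace c u v - C.covTrace c v u + C.covTrace c (g u) (g v)
        + C.covTrace c (g v) (g u) := by
  have hs := fun x y => (C.pairing_symm p).eq x y
  have hg : ∀ x y, C.pairing p (g x) (g y) = C.pairing p x y := fun x y => by
    rw [h.adj, h.invol]
  have hcomm : ∀ v u, C.trace p (fun x y => C.pairing p (c v y u) x) = C.covTrace c v u := by
    intro v u
    rw [covTrace, trace_comm]
    constructor <;> intros <;> simp
  rw [ricciVar, ricciVar, ← trace_sub]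
  have : ∀ x y : E p,
      C.pairing p (c x u v - c u x v + a x (a u v) - a u (a x v)) y +
      C.pairing p (c v y x - c y v x + a v (a y x) - a y (a v x) - a (a v y - a y v) x) u -
      (C.pairing p (c x (g u) (g v) - c (g u) x (g v) + a x (a (g u) (g v))
        - a (g u) (a x (g v))) y +
      C.pairing p (c (g v) y x - c y (g v) x + a (g v) (a y x) - a y (a (g v) x)
        - a (a (g v) y - a y (g v)) x) (g u)) =
      -C.pairing p (c u x v) y - C.pairing p (c v y u) x + C.pairing p (c (g u) x (g v)) y +
        C.pairing p (c (g v) y (g u)) x := by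
    intro x y
    have e1 : C.pairing p (c v y x) u = -C.pairing p (c v y u) x := by rw [h.c_anti, hs]
    have e2 : C.pairing p (c (g v) y x) (g u) = -C.pairing p (c (g v) y (g u)) x := by
      rw [h.c_anti, hs]
    simp only [h.c_left, h.c_right, h.a_left, h.a_right, h.invol, map_add, map_sub,
      LinearMap.add_apply, LinearMap.sub_apply, hg] at e2 ⊢
    linarith
  rw [trace_congr this, trace_add, trace_add, trace_sub, trace_neg, hcomm, hcomm]
  rfl

/-- The cyclic identity splits one factor `a` into two terms. Each of them contracts with the other
factor to the expression on the right, the second after inserting a pair of dual bases. -/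
theorem trace_quadratic (h : Pure C g a c) :
    C.trace p (fun x y => C.trace p fun z w => C.pairing p (g (a x z)) (a y w)) =
      2 * C.trace p fun x y => C.trace p fun z w => C.pairing p (g (a x z)) (a w y) := by
  have hs := fun x y => (C.pairing_symm p).eq x y
  have h1 : ∀ x z y w, C.pairing p (g (a x z)) (a y w) =
      C.pairing p (g (a z x)) (a y w) - C.pairing p (a (g (a y w)) x) z := by
    intro x z y w
    have := h.a_cyc x z (g (a y w))
    rw [h.adj, h.adj]
    linarith
  have h2 : ∀ x y z w, C.pairing p (a (g (a y w)) x) z =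
      -C.trace p fun i j => C.pairing p (a y i) w * C.pairing p (g (a j x)) z := by
    intro x y z w
    let φ : E p →ₗ[ℝ] ℝ := ((C.pairing p).flip z).comp ((a.flip x).comp g)
    have hφ : ∀ b, φ b = C.pairing p (g (a b x)) z := fun b => by
      simp [φ, h.a_left]
    have h3 := C.trace_pairing_left φ (a y w)
    rw [← trace_neg]
    refine (show _ = φ (a y w) from rfl).trans (h3.symm.trans (trace_congr fun i j => ?_))
    rw [hφ, h.a_anti y i w]
    ring
  have h3 : ∀ x y i j, C.trace p (fun z w => C.pairing p (a y i) w * C.pairing p (g (a j x)) z) =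
      C.pairing p (g (a j x)) (a y i) := by
    intro x y i j
    have := C.trace_pairing_mul' (C.pairing p (g (a j x))) (a y i)
    exact this
  rw [trace_congr fun x y => trace_congr fun z w => h1 x z y w]
  simp only [h2, trace_sub, trace_neg]
  have e1 : C.trace p (fun x y => C.trace p fun z w => C.pairing p (g (a z x)) (a y w)) =
      C.trace p fun x y => C.trace p fun z w => C.pairing p (g (a x z)) (a w y) := by
    rw [trace_trace]
  have e2 : C.trace p (fun x y => C.trace p fun z w => C.trace p fun i j =>
      C.pairing p (a y i) w * C.pairing p (g (a j x)) z) =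
      C.trace p fun x y => C.trace p fun z w => C.pairing p (g (a x z)) (a w y) := by
    have : ∀ x y : E p, C.trace p (fun z w => C.trace p fun i j =>
        C.pairing p (a y i) w * C.pairing p (g (a j x)) z) =
        C.trace p fun i j => C.pairing p (g (a i x)) (a y j) := by
      intro x y
      rw [trace_trace]
      simp only [h3]
      rw [trace_comm]
      constructor <;> intros <;> simp
    simp only [this]
    rw [trace_trace]
  rw [e1, e2]
  ring

/-- Each of the four linear terms contributes one copy of the contracted `covTrace`, and two
quadratic terms give products of traces. The other three are full contractions of `a` with itself,
and they cancel by `trace_quadratic`. -/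
theorem trace_ricciVar (h : Pure C g a c) :
    C.trace p (fun z w => C.ricciVar a c (g z) w) =
      -4 * C.trace p (fun x y => C.covTrace c x (g y))
        - 2 * C.trace p fun x y => C.diffTrace a x * C.diffTrace a (g y) := by
  have hs := fun x y => (C.pairing_symm p).eq x y
  have h1 : C.trace p (fun z w => C.trace p fun x y => C.pairing p (c x w (g z)) y) =
      -C.trace p fun x y => C.covTrace c x (g y) := by
    rw [trace_trace, ← trace_neg]
    refine trace_congr fun x y => ?_
    rw [covTrace, trace_comm, ← trace_neg]
    · exact trace_congr fun z w => by
        rw [h.c_right x z w, h.adj, h.c_anti, hs]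
    · constructor <;> intros <;> simp
  have h2 : C.trace p (fun z w => C.trace p fun x y => C.pairing p (c w x (g z)) y) =
      C.trace p fun x y => C.covTrace c x (g y) := by
    have hb := bilin_covTrace (C := C) c
    refine trace_comm (b := fun z w => C.covTrace c w (g z)) ⟨?_, ?_, ?_, ?_⟩ <;>
      intros <;> simp [hb.add_left, hb.add_right, hb.smul_left, hb.smul_right]
  have h3 : C.trace p (fun z w => C.trace p fun x y => C.pairing p (c (g z) y x) w) =
      -C.trace p fun x y => C.covTrace c x (g y) := by
    have hb := bilin_covTrace (C := C) c
    rw [← trace_move (b := C.covTrace c) hb h.adj, ← trace_neg]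
    refine trace_congr fun z w => ?_
    rw [covTrace, trace_comm, ← trace_neg]
    · exact trace_congr fun x y => by rw [h.c_anti, hs]
    · constructor <;> intros <;> simp
  have h4 : C.trace p (fun z w => C.trace p fun x y => C.pairing p (c y (g z) x) w) =
      C.trace p fun x y => C.covTrace c x (g y) := by
    have hb := bilin_covTrace (C := C) c
    rw [trace_trace, trace_comm (b := fun x y => C.covTrace c x (g y))]
    · refine trace_congr fun x y => trace_congr fun z w => ?_
      rw [h.c_left, h.c_right]
    · refine ⟨?_, ?_, ?_, ?_⟩ <;>
        intros <;> simp [hb.add_left, hb.add_right, hb.smul_left, hb.smul_right]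
  have h5 : C.trace p (fun z w => C.diffTrace a (g (a w z))) =
      -C.trace p fun x y => C.diffTrace a x * C.diffTrace a (g y) := by
    have e : ∀ z w, C.diffTrace a (g (a w z)) =
        -C.trace p fun x y => C.pairing p (a w x) z * C.diffTrace a (g y) := by
      intro z w
      have := C.trace_pairing_left ((C.diffTrace a).comp g) (a w z)
      rw [← trace_neg]
      refine (show _ = ((C.diffTrace a).comp g) (a w z) from rfl).trans
        (this.symm.trans (trace_congr fun x y => ?_))
      rw [h.a_anti w x z]
      simp
    simp only [e, trace_neg]
    rw [trace_trace]
    congr 1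
    refine trace_congr fun x y => ?_
    rw [trace_comm]
    · simp only [mul_comm _ (C.diffTrace a (g y)), trace_mul_left]
      rfl
    · constructor <;> intros <;> simp <;> ring
  have h5' : C.trace p (fun z w => C.trace p fun x y => C.pairing p (a x (a w (g z))) y) =
      -C.trace p fun x y => C.diffTrace a x * C.diffTrace a (g y) := by
    rw [← h5]
    exact trace_congr fun z w => by rw [h.a_right]; rfl
  have h7 : C.trace p (fun z w => C.trace p fun x y => C.pairing p (a (g z) (a y x)) w) =
      -C.trace p fun x y => C.diffTrace a x * C.diffTrace a (g y) := by
    rw [← h5, trace_trace]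
    refine trace_congr fun x y => ?_
    rw [diffTrace_apply]
    exact trace_congr fun z w => by rw [h.a_left, h.a_right]
  have h6 : C.trace p (fun z w => C.trace p fun x y => C.pairing p (a w (a x (g z))) y) =
      -C.trace p fun x y => C.trace p fun z w => C.pairing p (g (a x z)) (a w y) := by
    rw [trace_trace, ← trace_neg]
    refine trace_congr fun x y => ?_
    rw [← trace_neg]
    exact trace_congr fun z w => by rw [h.a_anti, h.a_right]
  have h8 : C.trace p (fun z w => C.trace p fun x y => C.pairing p (a y (a (g z) x)) w) =
      -C.trace p fun x y => C.trace p fun z w => C.pairing p (g (a x z)) (a w y) := by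
    rw [← trace_neg]
    refine trace_congr fun x y => ?_
    rw [← trace_neg]
    exact trace_congr fun z w => by rw [h.a_anti, h.a_left]
  have h9 : C.trace p (fun z w => C.trace p fun x y =>
      C.pairing p (a (a (g z) y - a y (g z)) x) w) =
      C.trace p fun x y => C.trace p fun z w => C.pairing p (g (a x z)) (a y w) := by
    -- The cyclic identity replaces the antisymmetrised `a` by a single one, at the price of an
    -- inserted dual pair.
    have e1 : ∀ z w x y, C.pairing p (a (a (g z) y - a y (g z)) x) w =
        -C.trace p fun i j => C.pairing p (a i (g z)) y * C.pairing p (a j x) w := by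
      intro z w x y
      let φ : E p →ₗ[ℝ] ℝ := ((C.pairing p).flip w).comp (a.flip x)
      have h3 := C.trace_pairing_mul φ (a (g z) y - a y (g z))
      rw [← trace_neg]
      refine (show _ = φ _ from rfl).trans (h3.symm.trans (trace_congr fun i j => ?_))
      have h10 := h.a_cyc (g z) y i
      rw [map_sub, LinearMap.sub_apply, h10]
      simp [φ]
    have e2 : ∀ z w, C.trace p (fun x y => C.trace p fun i j =>
        C.pairing p (a i (g z)) y * C.pairing p (a j x) w) =
        -C.trace p fun i j => C.pairing p (g (a i z)) (a j w) := by
      intro z w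
      rw [trace_trace, ← trace_neg]
      refine trace_congr fun i j => ?_
      let φ : E p →ₗ[ℝ] ℝ := ((C.pairing p).flip w).comp (a j)
      refine (C.trace_pairing_mul' φ (a i (g z))).trans ?_
      change C.pairing p (a j (a i (g z))) w = _
      rw [h.a_anti, h.a_right]
    simp only [e1, trace_neg, e2, neg_neg]
    rw [trace_trace]
  have hq := h.trace_quadratic
  simp only [ricciVar, map_add, map_sub, LinearMap.add_apply, LinearMap.sub_apply, trace_add,
    trace_sub] at h9 ⊢
  rw [h1, h2, h3, h4, h5', h6, h7, h8, h9, hq]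
  ring

end Pure

end CourantAlgebroid

end CourantGeometry

end

noncomputable section

namespace CourantGeometry

variable {EM : Type*} [NormedAddCommGroup EM] [NormedSpace ℝ EM] [FiniteDimensional ℝ EM]
  {H : Type*} [TopologicalSpace H] {I : ModelWithCorners ℝ EM H}
  {M : Type*} [TopologicalSpace M] [ChartedSpace H M] [IsManifold I ∞ M] [T2Space M]
  {F : Type*} [NormedAddCommGroup F] [NormedSpace ℝ F] [FiniteDimensional ℝ F]
  {E : M → Type*} [TopologicalSpace (Bundle.TotalSpace F E)]
  [∀ x, TopologicalSpace (E x)] [FiberBundle F E]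
  [∀ x, AddCommGroup (E x)] [∀ x, Module ℝ (E x)] [VectorBundle ℝ F E]
  [ContMDiffVectorBundle ∞ F E I]

/-! ### Algebra of the variation of the metric in a fibre -/

namespace CourantAlgebroid
variable {C : CourantAlgebroid I F E} {p : M}

variable (C) in
/-- The difference of connections determined by the derivative `X` of a metric `g` and having no
component along which it could be changed without changing the metric. -/
def lam (g : E p →ₗ[ℝ] E p) (X : E p →ₗ[ℝ] E p →ₗ[ℝ] E p) (u v w : E p) : ℝ :=
  1 / 2 * C.pairing p (X u v) (g w) +
    1 / 4 * (C.pairing p (X v (g w)) u + C.pairing p (X (g v) w) u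
      - C.pairing p (X w (g v)) u - C.pairing p (X (g w) v) u)

/-- A symmetric tensor with values in the endomorphisms anticommuting with `g`. -/
structure AntiComm (C : CourantAlgebroid I F E) (g : E p →ₗ[ℝ] E p)
    (X : E p →ₗ[ℝ] E p →ₗ[ℝ] E p) : Prop where
  invol : ∀ x, g (g x) = x
  adj : ∀ x y, C.pairing p (g x) y = C.pairing p x (g y)
  symm : ∀ u v w, C.pairing p (X u v) w = C.pairing p (X u w) v
  anti : ∀ u v, X u (g v) = -g (X u v)

namespace AntiComm
variable {g : E p →ₗ[ℝ] E p} {X : E p →ₗ[ℝ] E p →ₗ[ℝ] E p}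

theorem move (h : AntiComm C g X) (u v w : E p) :
    C.pairing p (X u v) (g w) = -C.pairing p (X u (g v)) w := by
  rw [h.anti, map_neg, LinearMap.neg_apply, neg_neg, h.adj]

/-- For `X = D g` this is what makes the deformed connection preserve the pairing. -/
theorem lam_anti (h : AntiComm C g X) (u v w : E p) :
    C.lam g X u v w = -C.lam g X u w v := by
  have h1 := h.move u v w
  have h2 := h.symm u (g v) w
  simp only [lam]
  linarith

/-- The algebraic form of unchanged torsion. -/
theorem lam_cyc (h : AntiComm C g X) (u v w : E p) :
    C.lam g X u v w - C.lam g X v u w = -C.lam g X w u v := by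
  have e1 := h.move u v w
  have e2 := h.move v u w
  have e3 := h.move w u v
  have e4 := h.symm u (g v) w
  have e5 := h.symm v (g u) w
  have e6 := h.symm w (g u) v
  have e7 := h.symm v (g w) u
  have e8 := h.symm u (g w) v
  have e9 := h.symm w (g v) u
  have e10 := h.symm (g v) w u
  have e11 := h.symm (g u) w v
  have e12 := h.symm (g w) v u
  simp only [lam]
  linarith

/-- Says `[λ_u, g] = -X_u`: for `X = D g` the deformation exactly cancels the covariant derivative
of `g`. -/
theorem lam_comm (h : AntiComm C g X) (u v w : E p) :
    C.lam g X u (g v) w - C.lam g X u v (g w) = -C.pairing p (X u v) w := by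
  have e1 := h.move u v w
  simp only [lam, h.invol]
  rw [h.move u (g v) w, h.invol]
  linarith

/-- An endomorphism anticommuting with the involution `g` exchanges its eigenspaces and so has no
trace; the same applies after composition with `g`. -/
theorem trace_left (h : AntiComm C g X) (w : E p) :
    C.trace p (fun x y => C.pairing p (X w x) y) = 0 := by
  have h1 : C.trace p (fun x y => C.pairing p (X w (g x)) y) =
      C.trace p fun x y => C.pairing p (X w x) (g y) :=
    trace_move (b := fun x y => C.pairing p (X w x) y)
      (by constructor <;> intros <;> simp) h.adj
  have h2 : C.trace p (fun x y => C.pairing p (X w (g x)) (g y)) =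
      C.trace p fun x y => C.pairing p (X w x) (g (g y)) :=
    trace_move (b := fun x y => C.pairing p (X w x) (g y))
      (by constructor <;> intros <;> simp) h.adj
  simp only [h.move, h.invol, trace_neg] at h2
  linarith

theorem trace_left_conj (h : AntiComm C g X) (w : E p) :
    C.trace p (fun x y => C.pairing p (X w (g x)) y) = 0 := by
  have h1 : C.trace p (fun x y => C.pairing p (X w (g x)) y) =
      C.trace p fun x y => C.pairing p (X w x) (g y) :=
    trace_move (b := fun x y => C.pairing p (X w x) y)
      (by constructor <;> intros <;> simp) h.adj
  simp only [h.move, trace_neg] at h1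
  linarith

theorem trace_conj (h : AntiComm C g X) (w : E p) :
    C.trace p (fun x y => C.pairing p (X (g x) w) y) =
      -C.trace p fun x y => C.pairing p (X x (g w)) y := by
  have h1 : C.trace p (fun x y => C.pairing p (X (g x) w) y) =
      C.trace p fun x y => C.pairing p (X x w) (g y) :=
    trace_move (b := fun x y => C.pairing p (X x w) y)
      (by constructor <;> intros <;> simp) h.adj
  simpa only [h.move, trace_neg] using h1

theorem trace_symm (h : AntiComm C g X) (w : E p) :
    C.trace p (fun x y => C.pairing p (X x y) w) = C.trace p fun x y => C.pairing p (X x w) y :=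
  trace_congr fun x y => h.symm x y w

theorem trace_flip (w : E p) :
    C.trace p (fun x y => C.pairing p (X y w) x) = C.trace p fun x y => C.pairing p (X x w) y :=
  (trace_comm (by constructor <;> intros <;> simp)).symm

/-- The change of divergence caused by the deformation. Terms with the endomorphism itself traced
vanish, and the others are all equal up to sign to the divergence of `X` at `g w`. -/
theorem trace_lam (h : AntiComm C g X) (w : E p) :
    C.trace p (fun x y => C.lam g X x w y) =
      -1 / 2 * C.trace p fun x y => C.pairing p (X x (g w)) y := by
  have e1 : C.trace p (fun x y => C.pairing p (X w (g y)) x) = 0 := by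
    rw [trace_comm, h.trace_left_conj]
    constructor <;> intros <;> simp
  have e2 : C.trace p (fun x y => C.pairing p (X (g w) y) x) = 0 := by
    rw [trace_comm, h.trace_left]
    constructor <;> intros <;> simp
  have e3 := trace_flip (C := C) (X := X) (g w)
  have e4 : C.trace p (fun x y => C.pairing p (X (g y) w) x) =
      -C.trace p fun x y => C.pairing p (X x (g w)) y := by
    rw [trace_comm, h.trace_conj]
    constructor <;> intros <;> simp
  simp only [lam, trace_add, trace_sub, trace_mul_left, h.move, trace_neg, e1, e2, e3, e4]
  ring

theorem trace_lam_conj (h : AntiComm C g X) (w : E p) :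
    C.trace p (fun x y => C.lam g X x (g y) w) =
      -1 / 2 * C.trace p fun x y => C.pairing p (X x w) y := by
  have e1 : C.trace p (fun x y => C.pairing p (X x (g y)) (g w)) =
      -C.trace p fun x y => C.pairing p (X x w) y := by
    simp only [h.move, h.invol, trace_neg, h.trace_symm]
  have e2 : C.trace p (fun x y => C.pairing p (X (g y) (g w)) x) =
      -C.trace p fun x y => C.pairing p (X x w) y := by
    rw [trace_comm, h.trace_conj, h.invol]
    constructor <;> intros <;> simp
  have e3 := trace_flip (C := C) (X := X) w
  have e4 : C.trace p (fun x y => C.pairing p (X w y) x) = 0 := by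
    rw [trace_comm, h.trace_left]
    constructor <;> intros <;> simp
  have e5 : C.trace p (fun x y => C.pairing p (X (g w) (g y)) x) = 0 := by
    rw [trace_comm, h.trace_left_conj]
    constructor <;> intros <;> simp
  simp only [lam, trace_add, trace_sub, trace_mul_left, h.invol, e1, e2, e3, e4, e5]
  ring

end AntiComm

/-! ### Contractions of the second covariant derivative of the metric. -/

section SecondOrder
variable {g : E p →ₗ[ℝ] E p} {Z : E p →ₗ[ℝ] E p →ₗ[ℝ] E p →ₗ[ℝ] E p}

/-- With `Z` the values of `DDχ`, the left side is the part of the derivative of `Rc` in which the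
contracted index is the outer derivative. Terms with both derivative slots contracted give the
Laplacian or cancel; the mixed ones later go into the Lie derivative and `𝒜`. -/
theorem trace_lam_second (h : ∀ x, AntiComm C g (Z x)) (u v : E p) :
    C.trace p (fun x y => C.lam g (Z x) u v y) + C.trace p (fun x y => C.lam g (Z x) v u y)
      - C.trace p (fun x y => C.lam g (Z x) (g u) (g v) y)
      - C.trace p (fun x y => C.lam g (Z x) (g v) (g u) y) =
    -C.trace p (fun x y => C.pairing p v (Z (g x) y u))
      - C.trace p (fun x y => C.pairing p (Z x u (g v)) y)
      - C.trace p (fun x y => C.pairing p (Z x v (g u)) y)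
      + C.trace p (fun x y => C.pairing p (Z x (g v) u) y)
      + C.trace p (fun x y => C.pairing p (Z x (g u) v) y) := by
  have hs := fun x y => (C.pairing_symm p).eq x y
  -- These two properties concern `g` alone, so any index will do.
  have adj := (h 0).adj
  have invol := (h 0).invol
  have hL : C.trace p (fun x y => C.pairing p v (Z (g x) y u)) =
      C.trace p fun x y => C.pairing p (Z x (g y) u) v := by
    rw [← trace_move (b := fun x y => C.pairing p (Z x y u) v)
      (by constructor <;> intros <;> simp) adj]
    exact trace_congr fun x y => hs _ _
  have hL1 : C.trace p (fun x y => C.pairing p (Z x (g y) v) u) =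
      C.trace p fun x y => C.pairing p (Z x (g y) u) v :=
    trace_congr fun x y => (h x).symm _ _ _
  have hL2 : C.trace p (fun x y => C.pairing p (Z x (g y) (g u)) (g v)) =
      -C.trace p fun x y => C.pairing p (Z x (g y) u) v := by
    simp only [(h _).move, invol, trace_neg]
  have hL3 : C.trace p (fun x y => C.pairing p (Z x (g y) (g v)) (g u)) =
      -C.trace p fun x y => C.pairing p (Z x (g y) u) v := by
    simp only [(h _).move, invol, trace_neg, hL1]
  have hP : C.trace p (fun x y => C.pairing p (Z x y (g u)) v) =
      -C.trace p fun x y => C.pairing p (Z x y (g v)) u := by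
    rw [← trace_neg]
    exact trace_congr fun x y => by rw [(h x).symm, (h x).move]
  have hP1 : C.trace p (fun x y => C.pairing p (Z x y u) (g v)) =
      C.trace p fun x y => C.pairing p (Z x y (g v)) u :=
    trace_congr fun x y => (h x).symm _ _ _
  have hP2 : C.trace p (fun x y => C.pairing p (Z x y v) (g u)) =
      -C.trace p fun x y => C.pairing p (Z x y (g v)) u := by
    rw [← trace_neg]
    exact trace_congr fun x y => (h x).move _ _ _
  have hM : ∀ a b, C.trace p (fun x y => C.pairing p (Z x a (g y)) b) =
      -C.trace p fun x y => C.pairing p (Z x a (g b)) y := by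
    intro a b
    rw [← trace_neg]
    exact trace_congr fun x y => by rw [(h x).symm, (h x).move]
  have hM' : ∀ a b, C.trace p (fun x y => C.pairing p (Z x a b) (g y)) =
      -C.trace p fun x y => C.pairing p (Z x a (g b)) y := by
    intro a b
    rw [← trace_neg]
    exact trace_congr fun x y => (h x).move _ _ _
  have hM'' : ∀ a b, C.trace p (fun x y => C.pairing p (Z x a y) b) =
      C.trace p fun x y => C.pairing p (Z x a b) y := fun a b =>
    trace_congr fun x y => (h x).symm _ _ _
  simp only [lam, trace_add, trace_sub, trace_mul_left, invol, hL, hL1, hL2, hL3, hP, hP1, hP2,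
    hM, hM', hM'']
  ring

end SecondOrder

end CourantAlgebroid

end CourantGeometry

end

noncomputable section

namespace CourantGeometry

variable {EM : Type*} [NormedAddCommGroup EM] [NormedSpace ℝ EM] [FiniteDimensional ℝ EM]
  {H : Type*} [TopologicalSpace H] {I : ModelWithCorners ℝ EM H}
  {M : Type*} [TopologicalSpace M] [ChartedSpace H M] [IsManifold I ∞ M] [T2Space M]
  {F : Type*} [NormedAddCommGroup F] [NormedSpace ℝ F] [FiniteDimensional ℝ F]
  {E : M → Type*} [TopologicalSpace (Bundle.TotalSpace F E)]
  [∀ x, TopologicalSpace (E x)] [FiberBundle F E]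
  [∀ x, AddCommGroup (E x)] [∀ x, Module ℝ (E x)] [VectorBundle ℝ F E]
  [ContMDiffVectorBundle ∞ F E I]

/-! ### Change of the Ricci tensor under a change of the connection -/

namespace Connection
open CourantAlgebroid
variable {C : CourantAlgebroid I F E}

/-- A vector-valued bilinear operation on sections that is `C^∞(M)`-bilinear. -/
structure IsTensorial (A : Sec I F E →ₗ[ℝ] Sec I F E →ₗ[ℝ] Sec I F E) : Prop where
  left : ∀ (f : Fun I M) u v, A (fsmul f u) v = fsmul f (A u v)
  right : ∀ (f : Fun I M) u v, A u (fsmul f v) = fsmul f (A u v)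

theorem isTensorial_diff (D D' : Connection C) : IsTensorial (D.diff D') :=
  ⟨D.diff_fsmul_left D', D.diff_fsmul_right D'⟩

theorem IsTensorial.exists_fiber (C : CourantAlgebroid I F E)
    {A : Sec I F E →ₗ[ℝ] Sec I F E →ₗ[ℝ] Sec I F E} (hA : IsTensorial A) (p : M) :
    ∃ a : E p →ₗ[ℝ] E p →ₗ[ℝ] E p, ∀ u v : Sec I F E, A u v p = a (u p) (v p) :=
  exists_tensor₂ C (fun v => ⟨fun u u' => by simp, fun f u => by simp [hA.left]⟩)
    fun u => ⟨fun v v' => by simp, fun f v => by simp [hA.right]⟩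

theorem IsTensorial.exists_fiber_cov (D : Connection C)
    {A : Sec I F E →ₗ[ℝ] Sec I F E →ₗ[ℝ] Sec I F E} (hA : IsTensorial A) (p : M) :
    ∃ c : E p →ₗ[ℝ] E p →ₗ[ℝ] E p →ₗ[ℝ] E p,
      ∀ z u v : Sec I F E, D.cov A z u v p = c (z p) (u p) (v p) := by
  refine exists_tensor₃ C (fun u v => ⟨fun z z' => ?_, fun f z => ?_⟩)
    (fun z v => ⟨fun u u' => ?_, fun f u => ?_⟩) fun z u => ⟨fun v v' => ?_, fun f v => ?_⟩
  · simp only [cov, map_add, LinearMap.add_apply, ContMDiffSection.coe_add,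
      ContMDiffSection.coe_sub, Pi.add_apply, Pi.sub_apply]; abel
  · simp [cov, D.fsmul_left, hA.left, hA.right, smul_sub]
  · simp only [cov, map_add, LinearMap.add_apply, ContMDiffSection.coe_add,
      ContMDiffSection.coe_sub, Pi.add_apply, Pi.sub_apply]; abel
  · simp only [cov, D_fsmul, hA.left, map_add, LinearMap.add_apply, ContMDiffSection.coe_add,
      ContMDiffSection.coe_sub, Pi.add_apply, Pi.sub_apply, fsmul_apply]; module
  · simp only [cov, map_add, ContMDiffSection.coe_add,
      ContMDiffSection.coe_sub, Pi.add_apply, Pi.sub_apply]; abel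
  · simp only [cov, D_fsmul, hA.right, map_add, ContMDiffSection.coe_add,
      ContMDiffSection.coe_sub, Pi.add_apply, Pi.sub_apply, fsmul_apply]; module

theorem ip_cov (D : Connection C) (A : Sec I F E →ₗ[ℝ] Sec I F E →ₗ[ℝ] Sec I F E)
    (z u v w : Sec I F E) (p : M) :
    C.ip (D.cov A z u v) w p = C.adv z (C.ip (A u v) w) p - C.ip (A u v) (D.D z w) p
      - C.ip (A (D.D z u) v) w p - C.ip (A u (D.D z v)) w p := by
  rw [cov, D.adv_ip]
  simp only [ip_sub_left]
  ring

theorem fullRicci_change' {D D' : Connection C} (hD : ∀ u v w x, D.torsion u v w x = 0)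
    (hD' : ∀ u v w x, D'.torsion u v w x = 0) (v u : Sec I F E) (p : M) :
    D'.fullRicci v u p = D.fullRicci v u p + 1 / 2 * C.contr p fun e e' =>
      (C.ip (D.cov (D.diff D') e u v - D.cov (D.diff D') u e v
        + D.diff D' e (D.diff D' u v) - D.diff D' u (D.diff D' e v)) e' p
      + C.ip (D.cov (D.diff D') v e' e - D.cov (D.diff D') e' v e
        + D.diff D' v (D.diff D' e' e) - D.diff D' e' (D.diff D' v e)
        - D.diff D' (D.diff D' v e' - D.diff D' e' v) e) u p) := by
  simp only [fullRicci, riemann_change hD hD']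
  rw [contr_add, contr_mul_left]

theorem fullRicci_change {D D' : Connection C} (hD : ∀ u v w x, D.torsion u v w x = 0)
    (hD' : ∀ u v w x, D'.torsion u v w x = 0) {p : M} {a : E p →ₗ[ℝ] E p →ₗ[ℝ] E p}
    {c : E p →ₗ[ℝ] E p →ₗ[ℝ] E p →ₗ[ℝ] E p}
    (ha : ∀ u v : Sec I F E, D.diff D' u v p = a (u p) (v p))
    (hc : ∀ z u v : Sec I F E, D.cov (D.diff D') z u v p = c (z p) (u p) (v p))
    (v u : Sec I F E) :
    D'.fullRicci v u p = D.fullRicci v u p + 1 / 2 * C.ricciVar a c (v p) (u p) := by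
  rw [fullRicci_change' hD hD', ricciVar, ← C.contr_eq_trace]
  refine congrArg (fun t => D.fullRicci v u p + 1 / 2 * t) (contr_congr fun e e' => ?_)
  simp [ip, ha, hc]

theorem diff_onSec_right {G : PseudoMetric C} {D D' : Connection C} (hD : D.IsLeviCivita G)
    (hD' : D'.IsLeviCivita G) (u v : Sec I F E) :
    D.diff D' u (G.onSec v) = G.onSec (D.diff D' u v) := by
  simp only [diff_apply, hD.compatible, hD'.compatible, map_sub]

theorem ip_onSec (G : PseudoMetric C) (u v : Sec I F E) (x : M) :
    C.ip (G.onSec u) v x = C.ip u (G.onSec v) x := G.selfAdjoint x _ _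

theorem onSec_onSec (G : PseudoMetric C) (u : Sec I F E) : G.onSec (G.onSec u) = u := by
  ext x; exact G.involutive x _

/-- Let `f` measure the failure of `G` to pass from the first slot to the last. The cyclic identity
makes `f` cyclically invariant, so `G` may be moved between slots without a sign, while `G² = 1`
forces a sign when it leaves the first slot. Hence `f = 0`. -/
theorem diff_onSec_left {G : PseudoMetric C} {D D' : Connection C} (hD : D.IsLeviCivita G)
    (hD' : D'.IsLeviCivita G) (u v : Sec I F E) :
    D.diff D' (G.onSec u) v = G.onSec (D.diff D' u v) := by
  refine C.eq_of_ip fun w x => ?_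
  let f : Sec I F E → Sec I F E → Sec I F E → ℝ := fun u v w =>
    C.ip (D.diff D' (G.onSec u) v) w x - C.ip (D.diff D' u v) (G.onSec w) x
  have hr := diff_onSec_right hD hD'
  have hcyc := ip_diff_cyclic hD.torsion_eq_zero hD'.torsion_eq_zero
  have h1 : ∀ u v w, f u v w = f w u v := by
    intro u v w
    have e1 := hcyc (G.onSec u) v w x
    have e2 := hcyc u v (G.onSec w) x
    rw [hr, ip_onSec, hr, ip_onSec] at e1
    simp only [f]
    linarith
  have h2 : ∀ u v w, f u (G.onSec v) w = f u v (G.onSec w) := by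
    intro u v w
    simp only [f, hr, ip_onSec]
  have h3 : ∀ u v w, f (G.onSec u) v w = -f u v (G.onSec w) := by
    intro u v w
    simp only [f, onSec_onSec]
    ring
  have h4 : ∀ u v w, f u v (G.onSec w) = 0 := by
    intro u v w
    have e1 := h3 u v w
    rw [h1, h2, ← h1, h2] at e1
    linarith
  have h5 := h4 u v (G.onSec w)
  simp only [f, onSec_onSec] at h5
  rw [ip_onSec]
  linarith

/-- The covariant derivative inherits the symmetries of the difference tensor because `D` preserves
both `G` and the pairing. -/
theorem pure_of_isLeviCivita {G : PseudoMetric C} {D D' : Connection C} (hD : D.IsLeviCivita G)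
    (hD' : D'.IsLeviCivita G) {p : M} {a : E p →ₗ[ℝ] E p →ₗ[ℝ] E p}
    {c : E p →ₗ[ℝ] E p →ₗ[ℝ] E p →ₗ[ℝ] E p}
    (ha : ∀ u v : Sec I F E, D.diff D' u v p = a (u p) (v p))
    (hc : ∀ z u v : Sec I F E, D.cov (D.diff D') z u v p = c (z p) (u p) (v p)) :
    Pure C (G.toFun p) a c := by
  have hl := diff_onSec_left hD hD'
  have hr := diff_onSec_right hD hD'
  have ha' : ∀ x y, a x y = D.diff D' (secLift C p x) (secLift C p y) p := fun x y => by
    rw [ha]; simp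
  have hc' : ∀ z x y, c z x y =
      D.cov (D.diff D') (secLift C p z) (secLift C p x) (secLift C p y) p := fun z x y => by
    rw [hc]; simp
  constructor
  · exact G.involutive p
  · exact G.selfAdjoint p
  · intro x y
    have := congrArg (fun s : Sec I F E => s p) (hl (secLift C p x) (secLift C p y))
    simpa [ha] using this
  · intro x y
    have := congrArg (fun s : Sec I F E => s p) (hr (secLift C p x) (secLift C p y))
    simpa [ha] using this
  · intro x y z
    have := D.ip_diff_antisymm D' (secLift C p x) (secLift C p y) (secLift C p z) p
    simpa [ha, ip] using this
  · intro x y z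
    have := ip_diff_cyclic hD.torsion_eq_zero hD'.torsion_eq_zero (secLift C p x) (secLift C p y)
      (secLift C p z) p
    simpa [ha, ip] using this
  · intro w x y
    have : D.cov (D.diff D') (secLift C p w) (G.onSec (secLift C p x)) (secLift C p y) =
        G.onSec (D.cov (D.diff D') (secLift C p w) (secLift C p x) (secLift C p y)) := by
      simp only [cov, hl, hD.compatible, map_sub]
    simpa [hc] using congrArg (fun s : Sec I F E => s p) this
  · intro w x y
    have : D.cov (D.diff D') (secLift C p w) (secLift C p x) (G.onSec (secLift C p y)) =
        G.onSec (D.cov (D.diff D') (secLift C p w) (secLift C p x) (secLift C p y)) := by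
      simp only [cov, hr, hD.compatible, map_sub]
    simpa [hc] using congrArg (fun s : Sec I F E => s p) this
  · intro w x y z
    have e1 := D.ip_cov (D.diff D') (secLift C p w) (secLift C p x) (secLift C p y)
      (secLift C p z) p
    have e2 := D.ip_cov (D.diff D') (secLift C p w) (secLift C p x) (secLift C p z)
      (secLift C p y) p
    have e3 : C.ip (D.diff D' (secLift C p x) (secLift C p y)) (secLift C p z) =
        fun q => -C.ip (D.diff D' (secLift C p x) (secLift C p z)) (secLift C p y) q := by
      funext q
      rw [D.ip_diff_antisymm D', C.ip_symm]
    rw [e3, adv_neg] at e1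
    rw [D.ip_diff_antisymm D' _ _ (D.D _ _), D.ip_diff_antisymm D' (D.D _ _),
      D.ip_diff_antisymm D' _ (D.D _ _)] at e1
    rw [C.ip_symm _ (D.D _ _), C.ip_symm _ (secLift C p y)] at e2
    rw [C.ip_symm _ (D.diff D' _ (D.D _ _))] at e1
    have e4 := C.ip_symm (secLift C p y)
      (D.diff D' (secLift C p x) ((D.D (secLift C p w)) (secLift C p z))) p
    have e5 := C.ip_symm (secLift C p y)
      (D.diff D' (D.D (secLift C p w) (secLift C p x)) (secLift C p z)) p
    have e6 : C.ip (D.cov (D.diff D') (secLift C p w) (secLift C p x) (secLift C p y))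
        (secLift C p z) p =
        -C.ip (secLift C p y) (D.cov (D.diff D') (secLift C p w) (secLift C p x)
          (secLift C p z)) p := by
      linarith
    simpa [hc, ip] using e6

/-- The contraction of the covariant derivative of the difference of two connections is the
covariant derivative of the difference of the divergences. -/
theorem covTrace_eq {D D' : Connection C} {p : M} {c : E p →ₗ[ℝ] E p →ₗ[ℝ] E p →ₗ[ℝ] E p}
    (hc : ∀ z u v : Sec I F E, D.cov (D.diff D') z u v p = c (z p) (u p) (v p))
    (z w : Sec I F E) :
    C.covTrace c (z p) (w p) =
      C.adv z (fun q => D'.divergence w q - D.divergence w q) p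
        - (D'.divergence (D.D z w) p - D.divergence (D.D z w) p) := by
  have hdiv : ∀ w q, D'.divergence w q - D.divergence w q =
      C.contr q fun e e' => C.ip (D.diff D' e w) e' q := by
    intro w q
    simp only [divergence, diff_apply, ip_sub_left, contr_sub]
  have hT : SmoothTensor fun e e' q => C.ip (D.diff D' e w) e' q :=
    ⟨fun u v => contMDiff_ip _ _,
      fun v q => ⟨fun u u' => by simp, fun f u => by simp [diff_fsmul_left]⟩,
      fun u q => tensAt_ip_right _ _⟩
  simp only [hdiv]
  rw [D.adv_contr hT, ← contr_sub, covTrace,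
    ← C.contr_eq_trace fun x y => C.pairing p (c (z p) x (w p)) y]
  refine contr_congr fun e e' => ?_
  have := D.ip_cov (D.diff D') z e w e' p
  rw [ip, hc] at this
  rw [this]
  ring

theorem diffTrace_eq {D D' : Connection C} {p : M} {a : E p →ₗ[ℝ] E p →ₗ[ℝ] E p}
    (ha : ∀ u v : Sec I F E, D.diff D' u v p = a (u p) (v p)) (w : Sec I F E) :
    C.diffTrace a (w p) = D'.divergence w p - D.divergence w p := by
  rw [diffTrace_apply, ← C.contr_eq_trace fun x y => C.pairing p (a x (w p)) y]
  simp only [divergence, ← contr_sub]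
  refine contr_congr fun e e' => ?_
  rw [← ip_sub_left, ← diff_apply, ip, ha]

/-- The covariant derivative of the difference of the divergences of two connections. -/
def divDiff (D D' : Connection C) (z w : Sec I F E) (p : M) : ℝ :=
  C.adv z (fun q => D'.divergence w q - D.divergence w q) p
    - (D'.divergence (D.D z w) p - D.divergence (D.D z w) p)

/-- Among Levi-Civita connections of one metric, `Rc` depends only on the divergence: `ricciVar_sub`
leaves only traces of the differentiated difference tensor. -/
theorem ricci_eq_of_isLeviCivita {G : PseudoMetric C} {D D' : Connection C}
    (hD : D.IsLeviCivita G) (hD' : D'.IsLeviCivita G) (v u : Sec I F E) (p : M) :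
    D'.ricci G v u p = D.ricci G v u p + 1 / 2 * (-D.divDiff D' u v p - D.divDiff D' v u p
      + D.divDiff D' (G.onSec u) (G.onSec v) p + D.divDiff D' (G.onSec v) (G.onSec u) p) := by
  obtain ⟨a, ha⟩ := (isTensorial_diff D D').exists_fiber C p
  obtain ⟨c, hc⟩ := (isTensorial_diff D D').exists_fiber_cov D p
  have h := (pure_of_isLeviCivita hD hD' ha hc).ricciVar_sub (v p) (u p)
  have hch := fullRicci_change hD.torsion_eq_zero hD'.torsion_eq_zero ha hc
  simp only [ricci, hch, divDiff, ← covTrace_eq hc, BundleEnd.onSec_apply]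
  linarith

/-- Here a term quadratic in the difference of the divergences survives. It is harmless for the
first variation, since the difference will vanish at the base parameter. -/
theorem scalar_eq_of_isLeviCivita {G : PseudoMetric C} {D D' : Connection C}
    (hD : D.IsLeviCivita G) (hD' : D'.IsLeviCivita G) (p : M) :
    D'.scalar G p = D.scalar G p - 2 * C.contr p (fun e e' => D.divDiff D' e (G.onSec e') p)
      - C.contr p fun e e' => (D'.divergence e p - D.divergence e p) *
        (D'.divergence (G.onSec e') p - D.divergence (G.onSec e') p) := by
  obtain ⟨a, ha⟩ := (isTensorial_diff D D').exists_fiber C p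
  obtain ⟨c, hc⟩ := (isTensorial_diff D D').exists_fiber_cov D p
  have h := (pure_of_isLeviCivita hD hD' ha hc).trace_ricciVar
  have hch := fullRicci_change hD.torsion_eq_zero hD'.torsion_eq_zero ha hc
  have hdd : ∀ z w : Sec I F E, D.divDiff D' z w p = C.covTrace c (z p) (w p) := fun z w =>
    (covTrace_eq hc z w).symm
  simp only [scalar, hch, contr_add, contr_mul_left, hdd, ← diffTrace_eq ha,
    BundleEnd.onSec_apply]
  rw [C.contr_eq_trace fun x y => C.ricciVar a c (G.toFun p x) y,
    C.contr_eq_trace fun x y => C.covTrace c x (G.toFun p y),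
    C.contr_eq_trace fun x y => C.diffTrace a x * C.diffTrace a (G.toFun p y), h]
  ring

end Connection

end CourantGeometry

end

noncomputable section

namespace CourantGeometry

variable {EM : Type*} [NormedAddCommGroup EM] [NormedSpace ℝ EM] [FiniteDimensional ℝ EM]
  {H : Type*} [TopologicalSpace H] {I : ModelWithCorners ℝ EM H}
  {M : Type*} [TopologicalSpace M] [ChartedSpace H M] [IsManifold I ∞ M] [T2Space M]
  {F : Type*} [NormedAddCommGroup F] [NormedSpace ℝ F] [FiniteDimensional ℝ F]
  {E : M → Type*} [TopologicalSpace (Bundle.TotalSpace F E)]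
  [∀ x, TopologicalSpace (E x)] [FiberBundle F E]
  [∀ x, AddCommGroup (E x)] [∀ x, Module ℝ (E x)] [VectorBundle ℝ F E]
  [ContMDiffVectorBundle ∞ F E I]

/-! ### Deformation of a connection to a Levi-Civita connection of another metric -/

namespace Connection
open CourantAlgebroid
variable {C : CourantAlgebroid I F E}

theorem onSec_fsmul (T : BundleEnd I F E) (f : Fun I M) (u : Sec I F E) :
    T.onSec (fsmul f u) = fsmul f (T.onSec u) := by ext; simp

theorem isTensorial_covEndBilin (D : Connection C) (T : BundleEnd I F E) :
    IsTensorial (D.covEndBilin T.onSec) :=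
  ⟨fun f u v => by ext; simp [covEndBilin, covEnd, D.fsmul_left, smul_sub],
    fun f u v => by
      ext
      simp only [covEndBilin, covEnd, LinearMap.mk₂_apply, LinearMap.sub_apply,
        LinearMap.comp_apply, onSec_fsmul, D_fsmul, map_add, ContMDiffSection.coe_sub,
        ContMDiffSection.coe_add, Pi.sub_apply, Pi.add_apply, fsmul_apply, smul_sub]
      abel⟩

@[simp] theorem covEndBilin_apply (D : Connection C) (T : Sec I F E →ₗ[ℝ] Sec I F E)
    (u v : Sec I F E) : D.covEndBilin T u v = D.covEnd u T v := rfl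

theorem covEnd_apply (D : Connection C) (T : Sec I F E →ₗ[ℝ] Sec I F E)
    (u v : Sec I F E) : D.covEnd u T v = D.D u (T v) - T (D.D u v) := rfl

theorem ip_covEnd_symm (D : Connection C) {T : BundleEnd I F E}
    (hT : ∀ u v x, C.ip (T.onSec u) v x = C.ip u (T.onSec v) x) (u v w : Sec I F E) (x : M) :
    C.ip (D.covEnd u T.onSec v) w x = C.ip (D.covEnd u T.onSec w) v x := by
  have h1 := D.adv_ip u (T.onSec v) w x
  have h2 := D.adv_ip u v (T.onSec w) x
  have h3 : C.ip (T.onSec v) w = C.ip v (T.onSec w) := funext fun x => hT v w x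
  rw [h3, h2] at h1
  simp only [covEnd_apply, ip_sub_left, hT]
  have h4 := hT (D.D u v) w x
  have h5 := hT (D.D u w) v x
  rw [C.ip_symm v] at h1
  rw [C.ip_symm (D.D u w) (T.onSec v)]
  linarith

theorem exists_fiber_covEnd (D : Connection C) (T : BundleEnd I F E) (p : M) :
    ∃ b : E p →ₗ[ℝ] E p →ₗ[ℝ] E p,
      ∀ u v : Sec I F E, D.covEnd u T.onSec v p = b (u p) (v p) :=
  (D.isTensorial_covEndBilin T).exists_fiber C p

theorem antiComm_of_covEnd (D : Connection C) (G : PseudoMetric C) {T : BundleEnd I F E}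
    (hT : ∀ u v x, C.ip (T.onSec u) v x = C.ip u (T.onSec v) x)
    (hGT : ∀ u v, D.covEnd u T.onSec (G.onSec v) = -G.onSec (D.covEnd u T.onSec v)) {p : M}
    {b : E p →ₗ[ℝ] E p →ₗ[ℝ] E p}
    (hb : ∀ u v : Sec I F E, D.covEnd u T.onSec v p = b (u p) (v p)) :
    AntiComm C (G.toFun p) b := by
  refine ⟨G.involutive p, G.selfAdjoint p, fun u v w => ?_, fun u v => ?_⟩
  · have := D.ip_covEnd_symm hT (secLift C p u) (secLift C p v) (secLift C p w) p
    simpa [ip, hb] using this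
  · have := congrArg (fun s : Sec I F E => s p) (hGT (secLift C p u) (secLift C p v))
    simpa [hb] using this

/-- The covariant derivative of `G² = 1`. Nothing is assumed about `D G`, so this applies to a
metric that `D` does not preserve. -/
theorem covEnd_metric_anti (D : Connection C) (G : PseudoMetric C) (u v : Sec I F E) :
    D.covEnd u G.onSec (G.onSec v) = -G.onSec (D.covEnd u G.onSec v) := by
  simp only [covEnd_apply, onSec_onSec, map_sub]; abel

/-- The section dual to `w ↦ ⟨(D_w T) v, u⟩`, for a self-adjoint endomorphism `T`. -/
def gradEnd (D : Connection C) (T : Sec I F E →ₗ[ℝ] Sec I F E) (v u : Sec I F E) : Sec I F E :=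
  D.curl (T v) u - D.curl v (T u)

/-- Vanishing torsion provides the dual section through `curl`, globally and without a frame. -/
theorem ip_gradEnd {D : Connection C} (hD : ∀ u v w x, D.torsion u v w x = 0) {T : BundleEnd I F E}
    (hT : ∀ u v x, C.ip (T.onSec u) v x = C.ip u (T.onSec v) x) (v u w : Sec I F E) (x : M) :
    C.ip (D.gradEnd T.onSec v u) w x = C.ip (D.covEnd w T.onSec v) u x := by
  simp only [gradEnd, covEnd_apply, ip_sub_left, ip_curl hD, hT]

/-- The difference tensor determined by the derivative of an endomorphism `T`; for `T = G` it
deforms `D` to a Levi-Civita connection of `G`. -/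
def deformTensor (D : Connection C) (G : BundleEnd I F E) (T : Sec I F E →ₗ[ℝ] Sec I F E) :
    Sec I F E →ₗ[ℝ] Sec I F E →ₗ[ℝ] Sec I F E :=
  LinearMap.mk₂ ℝ (fun u v => (1 / 2 : ℝ) • G.onSec (D.covEnd u T v) +
      (1 / 4 : ℝ) • (G.onSec (D.covEnd v T u) + D.covEnd (G.onSec v) T u
        - D.gradEnd T (G.onSec v) u - G.onSec (D.gradEnd T v u)))
    (fun u u' v => by
      simp only [covEnd_apply, gradEnd, curl, map_add, map_sub, LinearMap.add_apply]; module)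
    (fun c u v => by
      simp only [covEnd_apply, gradEnd, curl, map_add, map_sub, map_smul, LinearMap.smul_apply]
      module)
    (fun u v v' => by
      simp only [covEnd_apply, gradEnd, curl, map_add, map_sub, LinearMap.add_apply]; module)
    (fun c u v => by
      simp only [covEnd_apply, gradEnd, curl, map_add, map_sub, map_smul, LinearMap.smul_apply]
      module)

theorem deformTensor_apply (D : Connection C) (G : BundleEnd I F E)
    (T : Sec I F E →ₗ[ℝ] Sec I F E) (u v : Sec I F E) :
    D.deformTensor G T u v = (1 / 2 : ℝ) • G.onSec (D.covEnd u T v) +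
      (1 / 4 : ℝ) • (G.onSec (D.covEnd v T u) + D.covEnd (G.onSec v) T u
        - D.gradEnd T (G.onSec v) u - G.onSec (D.gradEnd T v u)) := rfl

theorem ip_deformTensor {D : Connection C} (hD : ∀ u v w x, D.torsion u v w x = 0)
    (G : PseudoMetric C) {T : BundleEnd I F E}
    (hT : ∀ u v x, C.ip (T.onSec u) v x = C.ip u (T.onSec v) x) (u v w : Sec I F E) (x : M) :
    C.ip (D.deformTensor G.toBundleEnd T.onSec u v) w x =
      1 / 2 * C.ip (D.covEnd u T.onSec v) (G.onSec w) x +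
      1 / 4 * (C.ip (D.covEnd v T.onSec (G.onSec w)) u x
        + C.ip (D.covEnd (G.onSec v) T.onSec w) u x
        - C.ip (D.covEnd w T.onSec (G.onSec v)) u x
        - C.ip (D.covEnd (G.onSec w) T.onSec v) u x) := by
  simp only [deformTensor_apply, ip_add_left, ip_sub_left, ip_smul_left, ip_onSec,
    ip_gradEnd hD hT]
  rw [D.ip_covEnd_symm hT v u, D.ip_covEnd_symm hT (G.onSec v) u]

/-- Reduces pointwise questions about the deformation to the algebra of `lam`. -/
theorem ip_deformTensor_eq_lam {D : Connection C} (hD : ∀ u v w x, D.torsion u v w x = 0)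
    (G : PseudoMetric C) {T : BundleEnd I F E}
    (hT : ∀ u v x, C.ip (T.onSec u) v x = C.ip u (T.onSec v) x) {p : M}
    {b : E p →ₗ[ℝ] E p →ₗ[ℝ] E p}
    (hb : ∀ u v : Sec I F E, D.covEnd u T.onSec v p = b (u p) (v p)) (u v w : Sec I F E) :
    C.ip (D.deformTensor G.toBundleEnd T.onSec u v) w p =
      C.lam (G.toFun p) b (u p) (v p) (w p) := by
  rw [ip_deformTensor hD G hT]
  simp [ip, hb, lam]

theorem isTensorial_deformTensor {D : Connection C} (hD : ∀ u v w x, D.torsion u v w x = 0)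
    (G : PseudoMetric C) {T : BundleEnd I F E}
    (hT : ∀ u v x, C.ip (T.onSec u) v x = C.ip u (T.onSec v) x) :
    IsTensorial (D.deformTensor G.toBundleEnd T.onSec) := by
  constructor <;> intro f u v <;> refine C.eq_of_ip fun w x => ?_ <;>
  · obtain ⟨b, hb⟩ := D.exists_fiber_covEnd T x
    rw [ip_fsmul_left, ip_deformTensor_eq_lam hD G hT hb, ip_deformTensor_eq_lam hD G hT hb]
    simp [lam]
    ring

theorem ip_onSec' (G : PseudoMetric C) (u v : Sec I F E) (x : M) :
    C.ip (G.toBundleEnd.onSec u) v x = C.ip u (G.toBundleEnd.onSec v) x := ip_onSec G u v x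

/-- The Levi-Civita connection of `G` obtained by deforming `D`. -/
def deformed (D : Connection C) (hD : ∀ u v w x, D.torsion u v w x = 0) (G : PseudoMetric C) :
    Connection C where
  D := D.D + D.deformTensor G.toBundleEnd G.onSec
  fsmul_left f u v := by
    have h := (isTensorial_deformTensor hD G (ip_onSec' G)).left f u v
    simp only [LinearMap.add_apply, D.fsmul_left, h]
    ext
    simp
  leibniz f u v x := by
    have h := (isTensorial_deformTensor hD G (ip_onSec' G)).right f u v
    simp only [LinearMap.add_apply, h, ContMDiffSection.coe_add, Pi.add_apply, D.leibniz,
      fsmul_apply]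
    module
  metric u v w x := by
    obtain ⟨b, hb⟩ := D.exists_fiber_covEnd G.toBundleEnd x
    have hA := D.antiComm_of_covEnd G (ip_onSec' G) (D.covEnd_metric_anti G) hb
    have h1 := ip_deformTensor_eq_lam hD G (ip_onSec' G) hb u v w
    have h2 := ip_deformTensor_eq_lam hD G (ip_onSec' G) hb u w v
    have h3 := hA.lam_anti (u x) (v x) (w x)
    have h4 := D.metric u v w x
    rw [C.ip_symm] at h2
    simp only [ip] at h1 h2
    rw [h4]
    simp only [LinearMap.add_apply, ContMDiffSection.coe_add, Pi.add_apply, map_add]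
    linarith

theorem diff_deformed (D : Connection C) (hD : ∀ u v w x, D.torsion u v w x = 0)
    (G : PseudoMetric C) :
    D.diff (D.deformed hD G) = D.deformTensor G.toBundleEnd G.onSec := by
  simp [diff, deformed]

/-- Compatibility is `lam_comm` and the absence of torsion is `lam_cyc`, applied in each fibre to
the values of `D G`. -/
theorem deformed_isLeviCivita (D : Connection C) (hD : ∀ u v w x, D.torsion u v w x = 0)
    (G : PseudoMetric C) : (D.deformed hD G).IsLeviCivita G := by
  constructor
  · intro u v
    refine C.eq_of_ip fun w x => ?_
    obtain ⟨b, hb⟩ := D.exists_fiber_covEnd G.toBundleEnd x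
    have hA := D.antiComm_of_covEnd G (ip_onSec' G) (D.covEnd_metric_anti G) hb
    have h1 := ip_deformTensor_eq_lam hD G (ip_onSec' G) hb u (G.onSec v) w
    have h2 := ip_deformTensor_eq_lam hD G (ip_onSec' G) hb u v (G.onSec w)
    have h3 := hA.lam_comm (u x) (v x) (w x)
    have h4 : C.ip (D.covEnd u G.onSec v) w x = C.pairing x (b (u x) (v x)) (w x) := by
      rw [ip, hb]
    simp only [covEnd_apply, ip_sub_left] at h4
    simp only [deformed, LinearMap.add_apply, map_add, ip_add_left, ip_onSec G] at h4 ⊢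
    simp only [BundleEnd.onSec_apply] at h1 h2
    linarith
  · intro u v w x
    obtain ⟨b, hb⟩ := D.exists_fiber_covEnd G.toBundleEnd x
    have hA := D.antiComm_of_covEnd G (ip_onSec' G) (D.covEnd_metric_anti G) hb
    have h1 := ip_deformTensor_eq_lam hD G (ip_onSec' G) hb u v w
    have h2 := ip_deformTensor_eq_lam hD G (ip_onSec' G) hb v u w
    have h3 := ip_deformTensor_eq_lam hD G (ip_onSec' G) hb w u v
    have h4 := hA.lam_cyc (u x) (v x) (w x)
    have h5 := hD u v w x
    simp only [torsion, ip_sub_left, deformed, LinearMap.add_apply, ip_add_left] at h5 ⊢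
    linarith

theorem adv_add_five (u : Sec I F E) {f₁ f₂ f₃ f₄ f₅ : M → ℝ} {x : M}
    (h₁ : MDifferentiableAt I 𝓘(ℝ, ℝ) f₁ x) (h₂ : MDifferentiableAt I 𝓘(ℝ, ℝ) f₂ x)
    (h₃ : MDifferentiableAt I 𝓘(ℝ, ℝ) f₃ x) (h₄ : MDifferentiableAt I 𝓘(ℝ, ℝ) f₄ x)
    (h₅ : MDifferentiableAt I 𝓘(ℝ, ℝ) f₅ x) :
    C.adv u (fun y => f₁ y + (f₂ y + (f₃ y + (f₄ y + f₅ y)))) x =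
      C.adv u f₁ x + (C.adv u f₂ x + (C.adv u f₃ x + (C.adv u f₄ x + C.adv u f₅ x))) := by
  have h45 : MDifferentiableAt I 𝓘(ℝ, ℝ) (fun y => f₄ y + f₅ y) x := h₄.add h₅
  have h345 : MDifferentiableAt I 𝓘(ℝ, ℝ) (fun y => f₃ y + (f₄ y + f₅ y)) x := h₃.add h45
  rw [adv_add u h₁ (g := fun y => f₂ y + (f₃ y + (f₄ y + f₅ y))) (h₂.add h345),
    adv_add u h₂ h345, adv_add u h₃ h45, adv_add u h₄ h₅]

/-- The covariant derivative of the difference tensor of an endomorphism `T` is the difference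
tensor of the second covariant derivative of `T`, if `D` preserves `G`. -/
theorem ip_cov_deformTensor {D : Connection C} {G : PseudoMetric C} (hD : D.IsLeviCivita G)
    {T : BundleEnd I F E} (hT : ∀ u v x, C.ip (T.onSec u) v x = C.ip u (T.onSec v) x)
    (z u v w : Sec I F E) (p : M) :
    C.ip (D.cov (D.deformTensor G.toBundleEnd T.onSec) z u v) w p =
      1 / 2 * C.ip (D.secondEnd z u T.onSec v) (G.onSec w) p +
      1 / 4 * (C.ip (D.secondEnd z v T.onSec (G.onSec w)) u p
        + C.ip (D.secondEnd z (G.onSec v) T.onSec w) u p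
        - C.ip (D.secondEnd z w T.onSec (G.onSec v)) u p
        - C.ip (D.secondEnd z (G.onSec w) T.onSec v) u p) := by
  have hd := fun u v w => ip_deformTensor hD.torsion_eq_zero G hT u v w p
  have hm : ∀ a b : Sec I F E, MDifferentiableAt I 𝓘(ℝ, ℝ) (C.ip a b) p := fun a b =>
    (contMDiff_ip a b).mdiffAt p
  -- The coefficients are absorbed into the sections, so that each of the five terms is a pairing to
  -- which metricity of `D` applies.
  have hfun : C.ip (D.deformTensor G.toBundleEnd T.onSec u v) w = fun x =>
      C.ip ((1 / 2 : ℝ) • D.covEnd u T.onSec v) (G.onSec w) x +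
      (C.ip ((1 / 4 : ℝ) • D.covEnd v T.onSec (G.onSec w)) u x
        + (C.ip ((1 / 4 : ℝ) • D.covEnd (G.onSec v) T.onSec w) u x
        + (C.ip ((-1 / 4 : ℝ) • D.covEnd w T.onSec (G.onSec v)) u x
        + C.ip ((-1 / 4 : ℝ) • D.covEnd (G.onSec w) T.onSec v) u x))) :=
    funext fun x => by
      rw [ip_deformTensor hD.torsion_eq_zero G hT u v w x]
      simp only [ip_smul_left]
      ring
  have hs : ∀ a b c, C.ip (D.secondEnd z a T.onSec b) c p =
      C.ip (D.D z (D.covEnd a T.onSec b)) c p - C.ip (D.covEnd a T.onSec (D.D z b)) c p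
        - C.ip (D.covEnd (D.D z a) T.onSec b) c p := fun a b c => by
    rw [← ip_sub_left, ← ip_sub_left]; rfl
  rw [ip_cov, hfun, adv_add_five z (hm _ _) (hm _ _) (hm _ _) (hm _ _) (hm _ _)]
  simp only [hd, hs, hD.compatible, D.adv_ip, map_smul, ip_smul_left]
  ring

end Connection

end CourantGeometry

end

noncomputable section

namespace CourantGeometry

variable {EM : Type*} [NormedAddCommGroup EM] [NormedSpace ℝ EM] [FiniteDimensional ℝ EM]
  {H : Type*} [TopologicalSpace H] {I : ModelWithCorners ℝ EM H}
  {M : Type*} [TopologicalSpace M] [ChartedSpace H M] [IsManifold I ∞ M] [T2Space M]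
  {F : Type*} [NormedAddCommGroup F] [NormedSpace ℝ F] [FiniteDimensional ℝ F]
  {E : M → Type*} [TopologicalSpace (Bundle.TotalSpace F E)]
  [∀ x, TopologicalSpace (E x)] [FiberBundle F E]
  [∀ x, AddCommGroup (E x)] [∀ x, Module ℝ (E x)] [VectorBundle ℝ F E]
  [ContMDiffVectorBundle ∞ F E I]

/-! ### Differentiation of one-parameter families -/

open Filter Topology

variable (I) in
/-- The family `φ` is smooth on `J × M` and its derivative at the parameter `s` is `ψ`. -/
structure FunDeriv (J : Set ℝ) (s : ℝ) (φ : ℝ → M → ℝ) (ψ : M → ℝ) : Prop where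
  smooth : ContMDiffOn (𝓘(ℝ, ℝ).prod I) 𝓘(ℝ, ℝ) ∞ (Function.uncurry φ) (J ×ˢ Set.univ)
  deriv : ∀ q, HasDerivAt (fun t => φ t q) (ψ q) s

/-- The family `σ` of sections is smooth on `J × M` and its derivative at the parameter `s` is
`σ'`. -/
def SecDeriv (C : CourantAlgebroid I F E) (J : Set ℝ) (s : ℝ) (σ : ℝ → Sec I F E)
    (σ' : Sec I F E) : Prop :=
  ∀ w, FunDeriv I J s (fun t => C.ip (σ t) w) (C.ip σ' w)

namespace FunDeriv
open CourantAlgebroid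
variable {C : CourantAlgebroid I F E} {J : Set ℝ} {s : ℝ} {φ ψ : ℝ → M → ℝ} {φ' ψ' : M → ℝ}

theorem const {f : M → ℝ} (hf : ContMDiff I 𝓘(ℝ, ℝ) ∞ f) : FunDeriv I J s (fun _ => f) 0 :=
  ⟨(hf.comp contMDiff_snd).contMDiffOn, fun _ => hasDerivAt_const _ _⟩

theorem add (h : FunDeriv I J s φ φ') (k : FunDeriv I J s ψ ψ') :
    FunDeriv I J s (fun t q => φ t q + ψ t q) (fun q => φ' q + ψ' q) :=
  ⟨h.smooth.add k.smooth, fun q => (h.deriv q).add (k.deriv q)⟩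

theorem sub (h : FunDeriv I J s φ φ') (k : FunDeriv I J s ψ ψ') :
    FunDeriv I J s (fun t q => φ t q - ψ t q) (fun q => φ' q - ψ' q) :=
  ⟨h.smooth.sub k.smooth, fun q => (h.deriv q).sub (k.deriv q)⟩

theorem mul (h : FunDeriv I J s φ φ') (k : FunDeriv I J s ψ ψ') :
    FunDeriv I J s (fun t q => φ t q * ψ t q) (fun q => φ' q * ψ s q + φ s q * ψ' q) :=
  ⟨h.smooth.mul k.smooth, fun q => (h.deriv q).mul (k.deriv q)⟩

theorem const_mul (c : ℝ) (h : FunDeriv I J s φ φ') :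
    FunDeriv I J s (fun t q => c * φ t q) (fun q => c * φ' q) :=
  ⟨contMDiffOn_const.mul h.smooth, fun q => (h.deriv q).const_mul c⟩

theorem sum {ι : Type*} (t : Finset ι) {φ : ι → ℝ → M → ℝ} {φ' : ι → M → ℝ}
    (h : ∀ i ∈ t, FunDeriv I J s (φ i) (φ' i)) :
    FunDeriv I J s (fun r q => ∑ i ∈ t, φ i r q) (fun q => ∑ i ∈ t, φ' i q) :=
  ⟨contMDiffOn_finsetSum fun i hi => (h i hi).smooth,
    fun q => HasDerivAt.fun_sum fun i hi => (h i hi).deriv q⟩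

/-- The statement is local on `M`. -/
theorem of_local (h : ∀ p, ∃ ψ ψ', FunDeriv I J s ψ ψ' ∧
    ∀ᶠ q in 𝓝 p, (∀ t, φ t q = ψ t q) ∧ φ' q = ψ' q) : FunDeriv I J s φ φ' := by
  refine ⟨fun z hz => ?_, fun q => ?_⟩
  · obtain ⟨ψ, ψ', hψ, hq⟩ := h z.2
    refine (hψ.smooth z hz).congr_of_eventuallyEq ?_ (hq.self_of_nhds.1 z.1)
    have : Tendsto Prod.snd (𝓝[J ×ˢ Set.univ] z) (𝓝 z.2) :=
      continuous_snd.continuousAt.tendsto.mono_left nhdsWithin_le_nhds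
    filter_upwards [this.eventually hq] with y hy
    exact hy.1 y.1
  · obtain ⟨ψ, ψ', hψ, hq⟩ := h q
    obtain ⟨h1, h2⟩ := hq.self_of_nhds
    simp only [h1, h2]
    exact hψ.deriv q

theorem congr (h : FunDeriv I J s φ φ') (hψ : ∀ t q, ψ t q = φ t q) (hψ' : ∀ q, ψ' q = φ' q) :
    FunDeriv I J s ψ ψ' := by
  obtain rfl : ψ = φ := funext fun t => funext (hψ t)
  obtain rfl : ψ' = φ' := funext hψ'
  exact h

/-- Joint smoothness and openness of `J` allow the parameter derivative to pass through the
derivative along the anchor. -/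
theorem adv [I.Boundaryless] (hJ : IsOpen J) (hs : s ∈ J) (h : FunDeriv I J s φ φ')
    (u : Sec I F E) : FunDeriv I J s (fun t => C.adv u (φ t)) (C.adv u φ') := by
  have hU : IsOpen (J ×ˢ (Set.univ : Set M)) := hJ.prod isOpen_univ
  refine ⟨contMDiffOn_mvfderiv_family hU h.smooth (C.contMDiff_anchor u), fun q => ?_⟩
  refine hasDerivAt_mvfderiv ?_ (.of_forall h.deriv) _
  filter_upwards [hU.mem_nhds (show (s, q) ∈ J ×ˢ Set.univ from ⟨hs, trivial⟩)] with z hz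
  exact h.smooth.contMDiffAt (hU.mem_nhds hz)

/-- The product rule for a family of tensorial operations applied to a family of sections. -/
theorem apply_sec {Φ : ℝ → Sec I F E → M → ℝ} {Φ' : Sec I F E → M → ℝ}
    (hΦ : ∀ t q, TensAt q fun u => Φ t u q) (hΦ' : ∀ q, TensAt q fun u => Φ' u q)
    (h : ∀ u, FunDeriv I J s (fun t => Φ t u) (Φ' u)) {σ : ℝ → Sec I F E} {σ' : Sec I F E}
    (hσ : SecDeriv C J s σ σ') :
    FunDeriv I J s (fun t => Φ t (σ t)) (fun q => Φ' (σ s) q + Φ s σ' q) := by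
  refine of_local fun p => ?_
  obtain ⟨e, f, hef⟩ := C.exists_dual_frames p
  refine ⟨_, _, sum Finset.univ fun i _ => (hσ (e i)).mul (h (f i)), ?_⟩
  filter_upwards [hef] with q hq
  -- In a fixed local dual frame the varying section enters only through scalar coefficients, so the
  -- ordinary product rule applies.
  have key : ∀ {φ : Sec I F E → ℝ}, TensAt q φ → ∀ u, φ u = ∑ i, C.ip u (e i) q * φ (f i) := by
    intro φ hφ u
    obtain ⟨ℓ, hℓ⟩ := hφ.exists_lin C
    simp only [hℓ]
    conv_lhs => rw [← hq (u q), map_sum]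
    refine Finset.sum_congr rfl fun i _ => ?_
    rw [map_smul, C.ip_symm]
    rfl
  refine ⟨fun t => key (hΦ t q) (σ t), ?_⟩
  rw [key (hΦ' q) (σ s), key (hΦ s q) σ', ← Finset.sum_add_distrib]
  exact Finset.sum_congr rfl fun i _ => add_comm _ _

/-- A contraction may be differentiated termwise. -/
theorem contr {T : ℝ → Sec I F E → Sec I F E → M → ℝ} {T' : Sec I F E → Sec I F E → M → ℝ}
    (hl : ∀ t v q, TensAt q fun u => T t u v q) (hr : ∀ t u q, TensAt q fun v => T t u v q)
    (hl' : ∀ v q, TensAt q fun u => T' u v q) (hr' : ∀ u q, TensAt q fun v => T' u v q)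
    (h : ∀ u v, FunDeriv I J s (fun t => T t u v) (T' u v)) :
    FunDeriv I J s (fun t q => C.contr q fun e e' => T t e e' q)
      (fun q => C.contr q fun e e' => T' e e' q) := by
  refine of_local fun p => ?_
  obtain ⟨e, f, hef⟩ := C.exists_dual_frames p
  refine ⟨_, _, sum Finset.univ fun i _ => h (e i) (f i), ?_⟩
  filter_upwards [hef] with q hq
  exact ⟨fun t => contr_eq_sum (hl t · q) (hr t · q) hq, contr_eq_sum (hl' · q) (hr' · q) hq⟩

end FunDeriv

namespace SecDeriv
open CourantAlgebroid
variable {C : CourantAlgebroid I F E} {J : Set ℝ} {s : ℝ} {σ τ : ℝ → Sec I F E}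
  {σ' τ' : Sec I F E}

theorem const (u : Sec I F E) : SecDeriv C J s (fun _ => u) 0 := fun w =>
  (FunDeriv.const (contMDiff_ip u w)).congr (fun _ _ => rfl) fun q => by simp

theorem add (h : SecDeriv C J s σ σ') (k : SecDeriv C J s τ τ') :
    SecDeriv C J s (fun t => σ t + τ t) (σ' + τ') := fun w =>
  ((h w).add (k w)).congr (fun _ _ => by simp) fun q => by simp

theorem sub (h : SecDeriv C J s σ σ') (k : SecDeriv C J s τ τ') :
    SecDeriv C J s (fun t => σ t - τ t) (σ' - τ') := fun w =>
  ((h w).sub (k w)).congr (fun _ _ => by simp) fun q => by simp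

theorem smul (c : ℝ) (h : SecDeriv C J s σ σ') : SecDeriv C J s (fun t => c • σ t) (c • σ') :=
  fun w => ((h w).const_mul c).congr (fun _ _ => by simp) fun q => by simp

theorem congr (h : SecDeriv C J s σ σ') (hτ : ∀ t, τ t = σ t) (hτ' : τ' = σ') :
    SecDeriv C J s τ τ' := by
  obtain rfl : τ = σ := funext hτ
  rwa [hτ']

theorem ip (h : SecDeriv C J s σ σ') (k : SecDeriv C J s τ τ') :
    FunDeriv I J s (fun t => C.ip (σ t) (τ t)) (fun q => C.ip σ' (τ s) q + C.ip (σ s) τ' q) := by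
  refine (FunDeriv.apply_sec (Φ := fun t u => C.ip u (τ t)) (Φ' := fun u => C.ip u τ')
    (fun t q => tensAt_ip_left _ q) (fun q => tensAt_ip_left _ q) (fun u => ?_) h).congr
    (fun _ _ => rfl) fun q => add_comm _ _
  refine (k u).congr (fun t q => C.ip_symm _ _ _) fun q => C.ip_symm _ _ _

theorem D [I.Boundaryless] (hJ : IsOpen J) (hs : s ∈ J) (D : Connection C)
    (h : SecDeriv C J s σ σ') (k : SecDeriv C J s τ τ') :
    SecDeriv C J s (fun t => D.D (σ t) (τ t)) (D.D σ' (τ s) + D.D (σ s) τ') := by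
  intro w
  refine (FunDeriv.apply_sec (Φ := fun t u => C.ip (D.D u (τ t)) w)
    (Φ' := fun u => C.ip (D.D u τ') w)
    (fun t q => D.tensAt_ip_D _ _ q) (fun q => D.tensAt_ip_D _ _ q) (fun u => ?_) h).congr
    (fun _ _ => rfl) fun q => by rw [ip_add_left, add_comm]
  -- Metricity expresses `⟨D_u τ_t, w⟩` by a derivative of a function and a term without derivatives
  -- of `τ_t`.
  refine (((k w).adv (C := C) hJ hs u).sub (k (D.D u w))).congr (fun t q => ?_) fun q => ?_ <;>
  · rw [D.adv_ip]; ring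

theorem onSec {T : ℝ → BundleEnd I F E} {T' : BundleEnd I F E}
    (hT : ∀ u, SecDeriv C J s (fun t => (T t).onSec u) (T'.onSec u)) (h : SecDeriv C J s σ σ') :
    SecDeriv C J s (fun t => (T t).onSec (σ t)) (T'.onSec (σ s) + (T s).onSec σ') := by
  intro w
  have ht : ∀ (S : BundleEnd I F E) q, TensAt q fun u => C.ip (S.onSec u) w q := fun S q =>
    ⟨fun u v => by simp, fun f u => by simp [Connection.onSec_fsmul]⟩
  exact (FunDeriv.apply_sec (Φ := fun t u => C.ip ((T t).onSec u) w)
    (Φ' := fun u => C.ip (T'.onSec u) w) (fun t q => ht _ q) (fun q => ht _ q)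
    (fun u => hT u w) h).congr (fun _ _ => rfl) fun q => by simp

/-- Pairing with `w` gives `⟨D_w σ, τ⟩` when there is no torsion, so the bracket never has to be
differentiated in the parameter. -/
theorem curl [I.Boundaryless] (hJ : IsOpen J) (hs : s ∈ J) {D : Connection C}
    (hD : ∀ u v w x, D.torsion u v w x = 0)
    (h : SecDeriv C J s σ σ') (k : SecDeriv C J s τ τ') :
    SecDeriv C J s (fun t => D.curl (σ t) (τ t)) (D.curl σ' (τ s) + D.curl (σ s) τ') := by
  intro w
  refine (((const w).D hJ hs D h).ip k).congr (fun t q => D.ip_curl hD _ _ _ _) fun q => ?_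
  simp [Connection.ip_curl hD]

end SecDeriv

/-! ### Families of metrics -/

namespace SecDeriv
open CourantAlgebroid Connection
variable {C : CourantAlgebroid I F E} {J : Set ℝ} {s : ℝ} {σ τ : ℝ → Sec I F E}
  {σ' τ' : Sec I F E} {D : Connection C} {G : ℝ → PseudoMetric C} {χ : BundleEnd I F E}

theorem covEnd_metric (hD : D.IsLeviCivita (G s)) (u v : Sec I F E) :
    D.covEnd u (G s).onSec v = 0 := by
  rw [covEnd_apply, hD.compatible, sub_self]

/-- The variations of the two sections are multiplied by `D G_s = 0`; only the variation of the
metric remains. -/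
theorem covEnd [I.Boundaryless] (hJ : IsOpen J) (hs : s ∈ J) (hD : D.IsLeviCivita (G s))
    (hG : ∀ u, SecDeriv C J s (fun t => (G t).onSec u) (χ.onSec u))
    (h : SecDeriv C J s σ σ') (k : SecDeriv C J s τ τ') :
    SecDeriv C J s (fun t => D.covEnd (σ t) (G t).onSec (τ t)) (D.covEnd (σ s) χ.onSec (τ s)) := by
  refine ((h.D hJ hs D (onSec (T := fun t => (G t).toBundleEnd) hG k)).sub
    (onSec (T := fun t => (G t).toBundleEnd) hG (h.D hJ hs D k))).congr (fun t => rfl) ?_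
  simp only [covEnd_apply, map_add, hD.compatible]
  abel

theorem gradEnd_metric (hD : D.IsLeviCivita (G s)) (u v : Sec I F E) :
    D.gradEnd (G s).onSec u v = 0 := by
  refine C.eq_of_ip fun w x => ?_
  rw [ip_gradEnd hD.torsion_eq_zero (ip_onSec' _), covEnd_metric hD, ip_zero_left, ip_zero_left]

theorem gradEnd [I.Boundaryless] (hJ : IsOpen J) (hs : s ∈ J) (hD : D.IsLeviCivita (G s))
    (hG : ∀ u, SecDeriv C J s (fun t => (G t).onSec u) (χ.onSec u))
    (h : SecDeriv C J s σ σ') (k : SecDeriv C J s τ τ') :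
    SecDeriv C J s (fun t => D.gradEnd (G t).onSec (σ t) (τ t))
      (D.gradEnd χ.onSec (σ s) (τ s)) := by
  have hc := fun {a b a' b'} (h : SecDeriv C J s a a') (k : SecDeriv C J s b b') =>
    h.curl hJ hs hD.torsion_eq_zero k
  refine ((hc (onSec (T := fun t => (G t).toBundleEnd) hG h) k).sub
    (hc h (onSec (T := fun t => (G t).toBundleEnd) hG k))).congr (fun t => rfl) ?_
  have h1 := gradEnd_metric hD (σ s) τ'
  have h2 := gradEnd_metric hD σ' (τ s)
  simp only [Connection.gradEnd, Connection.curl, map_add, LinearMap.add_apply] at h1 h2 ⊢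
  -- Adds the two vanishing gradients of `G_s` to match the terms with differentiated arguments.
  rw [← add_zero (_ - _), ← h1, ← add_zero (_ - _), ← h2]
  abel

theorem deformTensor_metric (hD : D.IsLeviCivita (G s)) (u v : Sec I F E) :
    D.deformTensor (G s).toBundleEnd (G s).onSec u v = 0 := by
  simp [deformTensor_apply, gradEnd_metric hD, covEnd_metric hD]

/-- Every summand has a factor built from `D G_t`, which vanishes at `s`. Neither the outer `G_t`
nor the arguments therefore contribute to the derivative. -/
theorem deformTensor [I.Boundaryless] (hJ : IsOpen J) (hs : s ∈ J) (hD : D.IsLeviCivita (G s))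
    (hG : ∀ u, SecDeriv C J s (fun t => (G t).onSec u) (χ.onSec u))
    (h : SecDeriv C J s σ σ') (k : SecDeriv C J s τ τ') :
    SecDeriv C J s (fun t => D.deformTensor (G t).toBundleEnd (G t).onSec (σ t) (τ t))
      (D.deformTensor (G s).toBundleEnd χ.onSec (σ s) (τ s)) := by
  have hGk := onSec (T := fun t => (G t).toBundleEnd) hG k
  have hc := fun {a b a' b'} (h : SecDeriv C J s a a') (k : SecDeriv C J s b b') =>
    h.covEnd hJ hs hD hG k
  have hg := fun {a b a' b'} (h : SecDeriv C J s a a') (k : SecDeriv C J s b b') =>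
    h.gradEnd hJ hs hD hG k
  have ho := fun {a a'} (h : SecDeriv C J s a a') =>
    onSec (T := fun t => (G t).toBundleEnd) hG h
  refine (((ho (hc h k)).smul (1 / 2)).add (((((ho (hc k h)).add (hc hGk h)).sub
    (hg hGk h)).sub (ho (hg k h))).smul (1 / 4))).congr (fun t => rfl) ?_
  simp only [deformTensor_apply, covEnd_metric hD, gradEnd_metric hD, map_zero, zero_add]

theorem cov_deformTensor [I.Boundaryless] (hJ : IsOpen J) (hs : s ∈ J)
    (hD : D.IsLeviCivita (G s))
    (hG : ∀ u, SecDeriv C J s (fun t => (G t).onSec u) (χ.onSec u)) {υ : ℝ → Sec I F E}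
    {υ' : Sec I F E}
    (h : SecDeriv C J s σ σ') (k : SecDeriv C J s τ τ') (l : SecDeriv C J s υ υ') :
    SecDeriv C J s
      (fun t => D.cov (D.deformTensor (G t).toBundleEnd (G t).onSec) (σ t) (τ t) (υ t))
      (D.cov (D.deformTensor (G s).toBundleEnd χ.onSec) (σ s) (τ s) (υ s)) := by
  have hd := fun {a b a' b'} (h : SecDeriv C J s a a') (k : SecDeriv C J s b b') =>
    h.deformTensor hJ hs hD hG k
  refine (((h.D hJ hs D (hd k l)).sub (hd (h.D hJ hs D k) l)).sub
    (hd k (h.D hJ hs D l))).congr (fun t => rfl) ?_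
  simp only [Connection.cov, deformTensor_metric hD, map_zero, zero_add]

end SecDeriv

end CourantGeometry

end

noncomputable section

namespace CourantGeometry

variable {EM : Type*} [NormedAddCommGroup EM] [NormedSpace ℝ EM] [FiniteDimensional ℝ EM]
  {H : Type*} [TopologicalSpace H] {I : ModelWithCorners ℝ EM H}
  {M : Type*} [TopologicalSpace M] [ChartedSpace H M] [IsManifold I ∞ M] [T2Space M]
  {F : Type*} [NormedAddCommGroup F] [NormedSpace ℝ F] [FiniteDimensional ℝ F]
  {E : M → Type*} [TopologicalSpace (Bundle.TotalSpace F E)]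
  [∀ x, TopologicalSpace (E x)] [FiberBundle F E]
  [∀ x, AddCommGroup (E x)] [∀ x, Module ℝ (E x)] [VectorBundle ℝ F E]
  [ContMDiffVectorBundle ∞ F E I]

/-! ### The derivative of a family of metrics -/

namespace Connection
open CourantAlgebroid
variable {C : CourantAlgebroid I F E}

theorem secondEnd_apply (D : Connection C) (z u : Sec I F E) (T : Sec I F E →ₗ[ℝ] Sec I F E)
    (v : Sec I F E) :
    D.secondEnd z u T v = D.D z (D.covEnd u T v) - D.covEnd u T (D.D z v) -
      D.covEnd (D.D z u) T v := rfl

theorem exists_fiber_secondEnd (D : Connection C) (T : BundleEnd I F E) (p : M) :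
    ∃ Z : E p →ₗ[ℝ] E p →ₗ[ℝ] E p →ₗ[ℝ] E p,
      ∀ z u v : Sec I F E, D.secondEnd z u T.onSec v p = Z (z p) (u p) (v p) := by
  obtain ⟨Z, hZ⟩ := (D.isTensorial_covEndBilin T).exists_fiber_cov D p
  refine ⟨Z, fun z u v => ?_⟩
  rw [← hZ, secondEnd_apply, cov]
  simp only [covEndBilin_apply, sub_right_comm]

theorem ip_secondEnd_symm (D : Connection C) {T : BundleEnd I F E}
    (hT : ∀ u v x, C.ip (T.onSec u) v x = C.ip u (T.onSec v) x) (z u v w : Sec I F E) (x : M) :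
    C.ip (D.secondEnd z u T.onSec v) w x = C.ip (D.secondEnd z u T.onSec w) v x := by
  have hs := D.ip_covEnd_symm hT
  have h1 := D.adv_ip z (D.covEnd u T.onSec v) w x
  have h2 := D.adv_ip z (D.covEnd u T.onSec w) v x
  rw [show C.ip (D.covEnd u T.onSec v) w = C.ip (D.covEnd u T.onSec w) v from
    funext fun x => hs u v w x, h2] at h1
  simp only [secondEnd_apply, ip_sub_left]
  rw [hs u (D.D z v), hs u (D.D z w), hs (D.D z u) v w]
  linarith

theorem secondEnd_anti {D : Connection C} {G : PseudoMetric C} (hD : D.IsLeviCivita G)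
    {T : BundleEnd I F E} (hGT : ∀ v, T.onSec (G.onSec v) = -G.onSec (T.onSec v))
    (z u v : Sec I F E) :
    D.secondEnd z u T.onSec (G.onSec v) = -G.onSec (D.secondEnd z u T.onSec v) := by
  simp only [secondEnd_apply, covEnd_apply, hGT, hD.compatible, map_neg, map_sub]
  abel

theorem antiComm_secondEnd {D : Connection C} {G : PseudoMetric C} (hD : D.IsLeviCivita G)
    {T : BundleEnd I F E} (hT : ∀ u v x, C.ip (T.onSec u) v x = C.ip u (T.onSec v) x)
    (hGT : ∀ v, T.onSec (G.onSec v) = -G.onSec (T.onSec v)) {p : M}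
    {Z : E p →ₗ[ℝ] E p →ₗ[ℝ] E p →ₗ[ℝ] E p}
    (hZ : ∀ z u v : Sec I F E, D.secondEnd z u T.onSec v p = Z (z p) (u p) (v p)) (x : E p) :
    AntiComm C (G.toFun p) (Z x) := by
  refine ⟨G.involutive p, G.selfAdjoint p, fun u v w => ?_, fun u v => ?_⟩
  · have := D.ip_secondEnd_symm hT (secLift C p x) (secLift C p u) (secLift C p v)
      (secLift C p w) p
    simpa [ip, hZ] using this
  · have := congrArg (fun s : Sec I F E => s p)
      (secondEnd_anti hD hGT (secLift C p x) (secLift C p u) (secLift C p v))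
    simpa [hZ] using this

theorem ip_cov_deformTensor_eq_lam {D : Connection C} {G : PseudoMetric C}
    (hD : D.IsLeviCivita G) {T : BundleEnd I F E}
    (hT : ∀ u v x, C.ip (T.onSec u) v x = C.ip u (T.onSec v) x) {p : M}
    {Z : E p →ₗ[ℝ] E p →ₗ[ℝ] E p →ₗ[ℝ] E p}
    (hZ : ∀ z u v : Sec I F E, D.secondEnd z u T.onSec v p = Z (z p) (u p) (v p))
    (z u v w : Sec I F E) :
    C.ip (D.cov (D.deformTensor G.toBundleEnd T.onSec) z u v) w p =
      C.lam (G.toFun p) (Z (z p)) (u p) (v p) (w p) := by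
  rw [ip_cov_deformTensor hD hT]
  simp [ip, hZ, lam]

/-- This slot is differentiated twice by `D`. Tensoriality is visible only after `riemann_eq` has
collected these terms into `curv`. -/
theorem tensAt_fullRicci_left {D : Connection C} (hD : ∀ u v w x, D.torsion u v w x = 0)
    (u : Sec I F E) (p : M) : TensAt p fun v => D.fullRicci v u p := by
  simp only [fullRicci, riemann_eq hD]
  constructor
  · intro v v'
    rw [← contr_add]
    refine contr_congr fun e e' => ?_
    simp [curv, comm, second]
    ring
  · intro f v
    rw [smul_eq_mul, ← contr_mul_left]
    refine contr_congr fun e e' => ?_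
    simp [curv_fsmul_left, comm_fsmul_left]
    ring

/-- This slot is never differentiated, so the defining formula suffices. -/
theorem tensAt_fullRicci_right (D : Connection C) (v : Sec I F E) (p : M) :
    TensAt p fun u => D.fullRicci v u p := by
  simp only [fullRicci, riemann]
  constructor
  · intro u u'
    rw [← contr_add]
    refine contr_congr fun e e' => ?_
    simp only [comm_add_middle, ip_add_left, ip_add_right, add_mul, contr_add]
    ring
  · intro f u
    rw [smul_eq_mul, ← contr_mul_left]
    refine contr_congr fun e e' => ?_
    simp only [comm_fsmul_middle, ip_fsmul_left, ip_fsmul_right, mul_assoc, contr_mul_left]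
    ring

end Connection

/-! ### Differentiating the Ricci tensor of the deformed connections. -/

section Families
open CourantAlgebroid Connection Filter Topology
variable {C : CourantAlgebroid I F E} {J : Set ℝ} {s : ℝ} {σ τ : ℝ → Sec I F E}
  {σ' τ' : Sec I F E} {D : Connection C} {G : ℝ → PseudoMetric C} {χ : BundleEnd I F E}

theorem derivative_symm (hG : ∀ u, SecDeriv C J s (fun t => (G t).onSec u) (χ.onSec u))
    (u v : Sec I F E) (x : M) : C.ip (χ.onSec u) v x = C.ip u (χ.onSec v) x := by
  have h1 := (hG u v).deriv x
  have h2 := (hG v u).deriv x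
  refine h1.unique ?_
  rw [C.ip_symm]
  refine h2.congr_of_eventuallyEq (.of_forall fun t => ?_)
  change C.ip _ _ _ = C.ip _ _ _
  rw [ip_onSec, C.ip_symm]

/-- The derivative of `⟨G v, G w⟩ = ⟨v, w⟩`, combined with the symmetry of `χ`. -/
theorem derivative_anti (hG : ∀ u, SecDeriv C J s (fun t => (G t).onSec u) (χ.onSec u))
    (v : Sec I F E) : χ.onSec ((G s).onSec v) = -(G s).onSec (χ.onSec v) := by
  refine C.eq_of_ip fun w x => ?_
  have h1 := ((hG v).ip (hG w)).deriv x
  have h2 : HasDerivAt (fun t => C.ip ((G t).onSec v) ((G t).onSec w) x) 0 s := by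
    refine (hasDerivAt_const s (C.ip v w x)).congr_of_eventuallyEq (.of_forall fun t => ?_)
    change C.ip _ _ _ = C.ip _ _ _
    rw [ip_onSec, onSec_onSec]
  have h3 := h1.unique h2
  rw [← ip_onSec, ← derivative_symm hG] at h3
  rw [ip_neg_left]
  linarith

namespace SecDeriv

/-- The pointwise counterpart of `FunDeriv.apply_sec`: the tensorial operation need only be
differentiable in the parameter, with no smoothness along `M`. -/
theorem hasDerivAt_apply {p : M} {φ : ℝ → Sec I F E → ℝ} {φ' : Sec I F E → ℝ}
    (hφ : ∀ t, TensAt p (φ t)) (hφ' : TensAt p φ')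
    (h : ∀ u, HasDerivAt (fun t => φ t u) (φ' u) s) (hσ : SecDeriv C J s σ σ') :
    HasDerivAt (fun t => φ t (σ t)) (φ' (σ s) + φ s σ') s := by
  obtain ⟨e, f, hef⟩ := C.exists_dual_frames p
  have hq := hef.self_of_nhds
  have key : ∀ {φ : Sec I F E → ℝ}, TensAt p φ → ∀ u, φ u = ∑ i, C.ip u (e i) p * φ (f i) := by
    intro φ hφ u
    obtain ⟨ℓ, hℓ⟩ := hφ.exists_lin C
    simp only [hℓ]
    conv_lhs => rw [← hq (u p), map_sum]
    refine Finset.sum_congr rfl fun i _ => ?_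
    rw [map_smul, C.ip_symm]
    rfl
  simp only [fun t => key (hφ t) (σ t)]
  rw [key hφ' (σ s), key (hφ s) σ', ← Finset.sum_add_distrib]
  simp only [add_comm (C.ip (σ s) _ p * _)]
  exact HasDerivAt.fun_sum fun i _ => ((hσ (e i)).deriv p).mul (h (f i))

theorem hasDerivAt_apply₂ {p : M} {φ : Sec I F E → Sec I F E → ℝ}
    (hl : ∀ v, TensAt p fun u => φ u v) (hr : ∀ u, TensAt p fun v => φ u v)
    (hσ : SecDeriv C J s σ σ') (hτ : SecDeriv C J s τ τ') :
    HasDerivAt (fun t => φ (σ t) (τ t)) (φ σ' (τ s) + φ (σ s) τ') s := by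
  rw [add_comm]
  refine hσ.hasDerivAt_apply (φ := fun t u => φ u (τ t)) (fun t => hl _) (hl τ') fun u => ?_
  have := hτ.hasDerivAt_apply (φ := fun _ v => φ u v) (φ' := 0) (fun _ => hr u)
    ⟨by simp, by simp⟩ fun v => hasDerivAt_const _ _
  simpa using this

end SecDeriv

/-- At a fixed point the frame in the contraction is independent of the parameter, so no
tensoriality is required. -/
theorem hasDerivAt_contr {p : M} {T : ℝ → Sec I F E → Sec I F E → ℝ}
    {T' : Sec I F E → Sec I F E → ℝ} (h : ∀ e e', HasDerivAt (fun t => T t e e') (T' e e') s) :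
    HasDerivAt (fun t => C.contr p (T t)) (C.contr p T') s :=
  HasDerivAt.fun_sum fun _ _ => h _ _

/-- The derivative of the full Ricci tensor of the deformed connections. -/
theorem hasDerivAt_fullRicci_deformed [I.Boundaryless] (hJ : IsOpen J) (hs : s ∈ J)
    (hD : D.IsLeviCivita (G s))
    (hG : ∀ u, SecDeriv C J s (fun t => (G t).onSec u) (χ.onSec u))
    (hσ : SecDeriv C J s σ σ') (hτ : SecDeriv C J s τ τ') (p : M) :
    HasDerivAt
      (fun t => (D.deformed hD.torsion_eq_zero (G t)).fullRicci (σ t) (τ t) p)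
      (D.fullRicci σ' (τ s) p + D.fullRicci (σ s) τ' p + 1 / 2 * C.contr p fun e e' =>
        (C.ip (D.cov (D.deformTensor (G s).toBundleEnd χ.onSec) e (τ s) (σ s)
          - D.cov (D.deformTensor (G s).toBundleEnd χ.onSec) (τ s) e (σ s)) e' p
        + C.ip (D.cov (D.deformTensor (G s).toBundleEnd χ.onSec) (σ s) e' e
          - D.cov (D.deformTensor (G s).toBundleEnd χ.onSec) e' (σ s) e) (τ s) p)) s := by
  have hT := fun t => (deformed_isLeviCivita D hD.torsion_eq_zero (G t)).torsion_eq_zero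
  simp only [fun t => fullRicci_change' hD.torsion_eq_zero (hT t) (σ t) (τ t) p, diff_deformed]
  refine (hσ.hasDerivAt_apply₂ (tensAt_fullRicci_left hD.torsion_eq_zero · p)
    (D.tensAt_fullRicci_right · p) hτ).add
    ((hasDerivAt_contr fun e e' => ?_).const_mul _)
  have hc := fun {a b c a' b' c'} (h : SecDeriv C J s a a') (k : SecDeriv C J s b b')
    (l : SecDeriv C J s c c') => h.cov_deformTensor hJ hs hD hG k l
  have ha := fun {a b a' b'} (h : SecDeriv C J s a a') (k : SecDeriv C J s b b') =>
    h.deformTensor hJ hs hD hG k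
  have he := SecDeriv.const (C := C) (J := J) (s := s) e
  have he' := SecDeriv.const (C := C) (J := J) (s := s) e'
  have h1 := (((hc he hτ hσ).sub (hc hτ he hσ)).add (ha he (ha hτ hσ))).sub (ha hτ (ha he hσ))
  have h2 := ((((hc hσ he' he).sub (hc he' hσ he)).add (ha hσ (ha he' he))).sub
    (ha he' (ha hσ he))).sub (ha ((ha hσ he').sub (ha he' hσ)) he)
  have h3 := ((h1 e').add (h2.ip hτ)).deriv p
  -- The quadratic terms of the curvature change contribute nothing, since the deformation tensor
  -- vanishes at `s`.
  refine h3.congr_deriv ?_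
  simp [SecDeriv.deformTensor_metric hD, cov]

end Families

end CourantGeometry

end

noncomputable section

namespace CourantGeometry

variable {EM : Type*} [NormedAddCommGroup EM] [NormedSpace ℝ EM] [FiniteDimensional ℝ EM]
  {H : Type*} [TopologicalSpace H] {I : ModelWithCorners ℝ EM H}
  {M : Type*} [TopologicalSpace M] [ChartedSpace H M] [IsManifold I ∞ M] [T2Space M]
  {F : Type*} [NormedAddCommGroup F] [NormedSpace ℝ F] [FiniteDimensional ℝ F]
  {E : M → Type*} [TopologicalSpace (Bundle.TotalSpace F E)]
  [∀ x, TopologicalSpace (E x)] [FiberBundle F E]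
  [∀ x, AddCommGroup (E x)] [∀ x, Module ℝ (E x)] [VectorBundle ℝ F E]
  [ContMDiffVectorBundle ∞ F E I]

/-! ### The derivative of the curvature along a family -/

open CourantAlgebroid Connection Filter Topology
variable {C : CourantAlgebroid I F E} {J : Set ℝ} {s : ℝ} {σ τ : ℝ → Sec I F E}
  {σ' τ' : Sec I F E} {D : Connection C} {G : ℝ → PseudoMetric C} {χ : BundleEnd I F E}

/-! ### Contractions of the differentiated deformation tensor. -/

section Traces
variable {p : M} {Z : E p →ₗ[ℝ] E p →ₗ[ℝ] E p →ₗ[ℝ] E p}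

theorem contr_cov_deformTensor {G : PseudoMetric C} (hD : D.IsLeviCivita G)
    (hχ : ∀ u v x, C.ip (χ.onSec u) v x = C.ip u (χ.onSec v) x)
    (hGχ : ∀ v, χ.onSec (G.onSec v) = -G.onSec (χ.onSec v))
    (hZ : ∀ z u v : Sec I F E, D.secondEnd z u χ.onSec v p = Z (z p) (u p) (v p))
    (z w : Sec I F E) :
    C.contr p (fun e e' => C.ip (D.cov (D.deformTensor G.toBundleEnd χ.onSec) z e w) e' p) =
      -1 / 2 * C.trace p fun x y => C.pairing p (Z (z p) x (G.toFun p (w p))) y := by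
  have hA := antiComm_secondEnd hD hχ hGχ hZ
  simp only [ip_cov_deformTensor_eq_lam hD hχ hZ]
  rw [C.contr_eq_trace fun x y => C.lam (G.toFun p) (Z (z p)) x (w p) y, (hA _).trace_lam]

/-- Antisymmetry of `lam` and the symmetry of the contraction bring the four terms to two shapes.
The outer derivative is either contracted, left for `trace_lam_second`, or free, computed by
`trace_lam`. -/
theorem contr_ricci_deformTensor {G : PseudoMetric C} (hD : D.IsLeviCivita G)
    (hχ : ∀ u v x, C.ip (χ.onSec u) v x = C.ip u (χ.onSec v) x)
    (hGχ : ∀ v, χ.onSec (G.onSec v) = -G.onSec (χ.onSec v))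
    (hZ : ∀ z u v : Sec I F E, D.secondEnd z u χ.onSec v p = Z (z p) (u p) (v p))
    (v u : Sec I F E) :
    C.contr p (fun e e' =>
        (C.ip (D.cov (D.deformTensor G.toBundleEnd χ.onSec) e u v
          - D.cov (D.deformTensor G.toBundleEnd χ.onSec) u e v) e' p
        + C.ip (D.cov (D.deformTensor G.toBundleEnd χ.onSec) v e' e
          - D.cov (D.deformTensor G.toBundleEnd χ.onSec) e' v e) u p)) =
      C.trace p (fun x y => C.lam (G.toFun p) (Z x) (u p) (v p) y)
        + C.trace p (fun x y => C.lam (G.toFun p) (Z x) (v p) (u p) y)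
        + 1 / 2 * C.trace p (fun x y => C.pairing p (Z (u p) x (G.toFun p (v p))) y)
        + 1 / 2 * C.trace p (fun x y => C.pairing p (Z (v p) x (G.toFun p (u p))) y) := by
  have hA := antiComm_secondEnd hD hχ hGχ hZ
  have e1 := (hA (u p)).trace_lam (v p)
  have e2 : C.trace p (fun x y => C.lam (G.toFun p) (Z (v p)) y x (u p)) =
      1 / 2 * C.trace p fun x y => C.pairing p (Z (v p) x (G.toFun p (u p))) y := by
    simp only [fun x y => (hA (v p)).lam_anti y x (u p), trace_neg]
    rw [← trace_comm (b := fun x y => C.lam (G.toFun p) (Z (v p)) x (u p) y)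
      (by constructor <;> intros <;> simp [lam] <;> ring), (hA _).trace_lam]
    ring
  have e3 : C.trace p (fun x y => C.lam (G.toFun p) (Z y) (v p) x (u p)) =
      -C.trace p (fun x y => C.lam (G.toFun p) (Z x) (v p) (u p) y) := by
    simp only [fun x y => (hA y).lam_anti (v p) x (u p), trace_neg]
    rw [← trace_comm (b := fun x y => C.lam (G.toFun p) (Z x) (v p) (u p) y)
      (by constructor <;> intros <;> simp [lam] <;> ring)]
  simp only [ip_sub_left, ip_cov_deformTensor_eq_lam hD hχ hZ]
  rw [C.contr_eq_trace fun x y => C.lam (G.toFun p) (Z x) (u p) (v p) y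
    - C.lam (G.toFun p) (Z (u p)) x (v p) y
    + (C.lam (G.toFun p) (Z (v p)) y x (u p) - C.lam (G.toFun p) (Z y) (v p) x (u p)),
    trace_add, trace_sub, trace_sub, e1, e2, e3]
  ring

end Traces

/-! ### The gap between the divergences and its derivative. -/

section Divergence

/-- The difference between the divergence `δ` and that of the connection obtained by deforming a
connection with divergence `δ₀`. -/
def divGap (D : Connection C) (G : PseudoMetric C) (δ₀ δ : Divergence C) (w : Sec I F E) (q : M) :
    ℝ :=
  δ.toFun w q - δ₀.toFun w q
    - C.contr q fun e e' => C.ip (D.deformTensor G.toBundleEnd G.onSec e w) e' q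

/-- The connection `D'` enters only through its prescribed divergence. This is why the chosen family
of connections needs no regularity in the parameter. -/
theorem divGap_eq {D D' : Connection C} {G₀ G : PseudoMetric C} {δ₀ δ : Divergence C}
    (hD : D.MemLC G₀ δ₀) (hD' : D'.MemLC G δ) (w : Sec I F E) (q : M) :
    D'.divergence w q - (D.deformed hD.torsion_eq_zero G).divergence w q =
      divGap D G δ₀ δ w q := by
  rw [hD'.divergence_eq, divGap, ← hD.divergence_eq]
  simp only [divergence, deformed, LinearMap.add_apply, ip_add_left, contr_add]
  ring

theorem tensAt_contr_deformTensor (hD : ∀ u v w x, D.torsion u v w x = 0) (G : PseudoMetric C)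
    (hχ : ∀ u v x, C.ip (χ.onSec u) v x = C.ip u (χ.onSec v) x) (q : M) :
    TensAt q fun w =>
      C.contr q fun e e' => C.ip (D.deformTensor G.toBundleEnd χ.onSec e w) e' q := by
  have h := isTensorial_deformTensor hD G hχ
  exact ⟨fun w w' => by rw [← contr_add]; simp, fun f w => by
    rw [smul_eq_mul, ← contr_mul_left]; simp [h.right]⟩

theorem tensAt_divGap_deriv {ε : Sec I F E} (hD : ∀ u v w x, D.torsion u v w x = 0)
    (G : PseudoMetric C) (hχ : ∀ u v x, C.ip (χ.onSec u) v x = C.ip u (χ.onSec v) x) (q : M) :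
    TensAt q fun w => C.ip ε w q - C.contr q fun e e' =>
      C.ip (D.deformTensor G.toBundleEnd χ.onSec e w) e' q := by
  have h := tensAt_contr_deformTensor hD G hχ q
  exact ⟨fun w w' => by rw [h.add, ip_add_right]; ring,
    fun f w => by rw [h.fsmul, ip_fsmul_right, smul_eq_mul, smul_eq_mul]; ring⟩

/-- The anchor terms in the Leibniz rules of the two divergences cancel. -/
theorem tensAt_divGap (hD : ∀ u v w x, D.torsion u v w x = 0) (G : PseudoMetric C)
    (δ₀ δ : Divergence C) (q : M) : TensAt q fun w => divGap D G δ₀ δ w q := by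
  have h := tensAt_contr_deformTensor (χ := G.toBundleEnd) hD G (ip_onSec' G) q
  refine ⟨fun w w' => ?_, fun f w => ?_⟩
  · have := h.add w w'
    simp only [divGap, map_add, ContMDiffMap.coe_add, Pi.add_apply] at this ⊢
    linarith
  · have := h.fsmul f w
    simp only [divGap, Divergence.leibniz, smul_eq_mul] at this ⊢
    rw [this]
    ring

variable {δ : ℝ → Divergence C} {ε : Sec I F E}

theorem divGap_self (hD : D.IsLeviCivita (G s)) (w : Sec I F E) (q : M) :
    divGap D (G s) (δ s) (δ s) w q = 0 := by
  simp [divGap, SecDeriv.deformTensor_metric hD, contr]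

theorem funDeriv_divGap [I.Boundaryless] (hJ : IsOpen J) (hs : s ∈ J)
    (hD : D.IsLeviCivita (G s)) (hG : ∀ u, SecDeriv C J s (fun t => (G t).onSec u) (χ.onSec u))
    (hδ : ∀ u, FunDeriv I J s (fun t => (δ t).toFun u) (C.ip ε u)) (w : Sec I F E) :
    FunDeriv I J s (fun t => divGap D (G t) (δ s) (δ t) w)
      fun q => C.ip ε w q
        - C.contr q fun e e' => C.ip (D.deformTensor (G s).toBundleEnd χ.onSec e w) e' q := by
  have hχ := derivative_symm hG
  have h := fun t => isTensorial_deformTensor hD.torsion_eq_zero (G t) (ip_onSec' (G t))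
  have h' := isTensorial_deformTensor hD.torsion_eq_zero (G s) hχ
  refine (((hδ w).sub (.const ((δ s).toFun w).contMDiff)).sub (.contr (C := C)
    (T := fun t e e' q => C.ip (D.deformTensor (G t).toBundleEnd (G t).onSec e w) e' q)
    (T' := fun e e' q => C.ip (D.deformTensor (G s).toBundleEnd χ.onSec e w) e' q)
    (fun t v q => ⟨by simp, fun f u => by simp [(h t).left]⟩) (fun t u q => tensAt_ip_right _ _)
    (fun v q => ⟨by simp, fun f u => by simp [h'.left]⟩) (fun u q => tensAt_ip_right _ _)
    fun e f => ?_)).congr (fun t q => rfl) fun q => by simp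
  exact (SecDeriv.const e).deformTensor hJ hs hD hG (.const w) f

/-- The derivative of the covariant derivative of the difference of the divergences. -/
theorem hasDerivAt_divDiff [I.Boundaryless] (hJ : IsOpen J) (hs : s ∈ J) {D : ℝ → Connection C}
    (hD : ∀ s ∈ J, (D s).MemLC (G s) (δ s))
    (hG : ∀ u, SecDeriv C J s (fun t => (G t).onSec u) (χ.onSec u))
    (hδ : ∀ u, FunDeriv I J s (fun t => (δ t).toFun u) (C.ip ε u))
    (hσ : SecDeriv C J s σ σ') (hτ : SecDeriv C J s τ τ') (p : M) :
    HasDerivAt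
      (fun t => ((D s).deformed (hD s hs).torsion_eq_zero (G t)).divDiff (D t) (σ t) (τ t) p)
      (C.ip ((D s).D (σ s) ε) (τ s) p - C.contr p fun e e' =>
        C.ip ((D s).cov ((D s).deformTensor (G s).toBundleEnd χ.onSec) (σ s) e (τ s)) e' p) s := by
  have hL := (hD s hs).toIsLeviCivita
  have ht := hL.torsion_eq_zero
  have hχ := derivative_symm hG
  have hA' := isTensorial_deformTensor ht (G s) hχ
  have hϑ := fun w => funDeriv_divGap hJ hs hL hG hδ w
  have hϑ' := tensAt_divGap_deriv (ε := ε) ht (G s) hχ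
  have hz := fun w q => divGap_self (δ := δ) hL w q
  have h1 := FunDeriv.apply_sec (fun t q => tensAt_divGap ht (G t) (δ s) (δ t) q) hϑ' hϑ hτ
  have h2 := FunDeriv.apply_sec (Φ := fun t u => C.adv u (divGap (D s) (G t) (δ s) (δ t) (τ t)))
    (fun t q => tensAt_adv _ q) (fun q => tensAt_adv _ q) (fun u => h1.adv (C := C) hJ hs u) hσ
  -- The derivative of `τ` is taken with the deformed connection, hence `D_σ τ` plus the deformation
  -- tensor.
  have h3 := FunDeriv.apply_sec (fun t q => tensAt_divGap ht (G t) (δ s) (δ t) q) hϑ' hϑ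
    ((hσ.D hJ hs (D s) hτ).add (hσ.deformTensor hJ hs hL hG hτ))
  have h4 := (h2.sub h3).deriv p
  -- The gap vanishes at `s` on all of `M`, so its derivative along a section vanishes too, and the
  -- variations of `σ`, `τ` and the connection drop out.
  have h5 : divGap (D s) (G s) (δ s) (δ s) (τ s) = fun _ => 0 := funext fun q => hz _ q
  simp only [hz, add_zero, h5, adv_const, SecDeriv.deformTensor_metric hL] at h4
  have hT : SmoothTensor fun e e' q =>
      C.ip ((D s).deformTensor (G s).toBundleEnd χ.onSec e (τ s)) e' q :=
    ⟨fun u v => contMDiff_ip _ _, fun v q => ⟨by simp, fun f u => by simp [hA'.left]⟩,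
      fun u q => tensAt_ip_right _ _⟩
  refine (h4.congr_deriv ?_).congr_of_eventuallyEq ?_
  · rw [adv_sub _ ((contMDiff_ip _ _).mdiffAt p) (hT.contMDiff_contr.mdiffAt p),
      (D s).adv_contr hT]
    rw [show C.adv (σ s) (fun q => C.ip ε (τ s) q) p = _ from (D s).adv_ip _ _ _ _]
    simp only [ip_cov, contr_sub]
    ring
  · filter_upwards [hJ.mem_nhds hs] with t htJ
    simp only [divDiff, divGap_eq (hD s hs) (hD t htJ)]
    rfl

end Divergence

end CourantGeometry

end

noncomputable section

namespace CourantGeometry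

variable {EM : Type*} [NormedAddCommGroup EM] [NormedSpace ℝ EM] [FiniteDimensional ℝ EM]
  {H : Type*} [TopologicalSpace H] {I : ModelWithCorners ℝ EM H}
  {M : Type*} [TopologicalSpace M] [ChartedSpace H M] [IsManifold I ∞ M] [T2Space M]
  {F : Type*} [NormedAddCommGroup F] [NormedSpace ℝ F] [FiniteDimensional ℝ F]
  {E : M → Type*} [TopologicalSpace (Bundle.TotalSpace F E)]
  [∀ x, TopologicalSpace (E x)] [FiberBundle F E]
  [∀ x, AddCommGroup (E x)] [∀ x, Module ℝ (E x)] [VectorBundle ℝ F E]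
  [ContMDiffVectorBundle ∞ F E I]

/-! ### The first variation of the Ricci tensor and of the scalar curvature -/

open CourantAlgebroid Connection Filter Topology
variable {C : CourantAlgebroid I F E}

namespace Connection
variable {D : Connection C} {G : PseudoMetric C} {χ : BundleEnd I F E} {p : M}
  {Z : E p →ₗ[ℝ] E p →ₗ[ℝ] E p →ₗ[ℝ] E p}

/-- The torsion identity exchanges each bracket for derivatives of `w`; the terms `D_w G u` and `G
D_w u` cancel since `G` is parallel. -/
theorem ip_lieEnd (hD : D.IsLeviCivita G) (w v u : Sec I F E) (x : M) :
    C.ip v (C.lieEnd w G.onSec u) x = -C.ip (D.D (G.onSec u) w) v x + C.ip (D.D v w) (G.onSec u) x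
      + C.ip (D.D u w) (G.onSec v) x - C.ip (D.D (G.onSec v) w) u x := by
  have h1 := hD.torsion_eq_zero w (G.onSec u) v x
  have h2 := hD.torsion_eq_zero w u (G.onSec v) x
  have h3 := ip_onSec G (C.bracket w u) v x
  have h4 := ip_onSec G (D.D w u) v x
  simp only [torsion, ip_sub_left, hD.compatible] at h1 h2
  rw [C.ip_symm, lieEnd, LinearMap.sub_apply, ip_sub_left]
  simp only [LinearMap.comp_apply]
  linarith

theorem ip_trCov (D : Connection C) (χ : BundleEnd I F E) (w : Sec I F E) (q : M) :
    C.ip (D.trCov χ) w q = C.contr q fun e e' => C.ip (D.covEnd e χ.onSec e') w q := by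
  change C.pairing q (C.contrVec (fun e e' => D.covEndBilin χ.onSec e e') q) (w q) = _
  simp only [contrVec, contr, map_sum, LinearMap.sum_apply]
  rfl

/-- Covariant differentiation passes through the contraction by `adv_contr`, and the symmetry of
`DDχ` moves the contracted index to the second argument of the pairing. -/
theorem ip_D_trCov (hχ : ∀ u v x, C.ip (χ.onSec u) v x = C.ip u (χ.onSec v) x)
    (hZ : ∀ z u v : Sec I F E, D.secondEnd z u χ.onSec v p = Z (z p) (u p) (v p))
    (z w : Sec I F E) :
    C.ip (D.D z (D.trCov χ)) w p = C.trace p fun x y => C.pairing p (Z (z p) x (w p)) y := by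
  have hA := D.isTensorial_covEndBilin χ
  have hT : SmoothTensor fun e e' q => C.ip (D.covEnd e χ.onSec e') w q :=
    ⟨fun u v => contMDiff_ip _ _,
      fun v q => ⟨fun u u' => by simp only [← covEndBilin_apply, map_add, LinearMap.add_apply,
        ip_add_left], fun f u => by simp only [← covEndBilin_apply, hA.left, ip_fsmul_left,
        smul_eq_mul]⟩,
      fun u q => ⟨fun v v' => by simp, fun f v => by simp only [← covEndBilin_apply, hA.right,
        ip_fsmul_left, smul_eq_mul]⟩⟩
  have h := D.adv_ip z (D.trCov χ) w p
  rw [show C.ip (D.trCov χ) w = _ from funext fun q => D.ip_trCov χ w q, D.adv_contr hT,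
    ip_trCov] at h
  rw [← C.contr_eq_trace fun x y => C.pairing p (Z (z p) x (w p)) y, ← sub_eq_iff_eq_add.2 h,
    ← contr_sub]
  refine contr_congr fun e e' => ?_
  have h2 := D.ip_secondEnd_symm hχ z e e' w p
  have h3 : C.pairing p (Z (z p) (e p) (w p)) (e' p) = C.ip (D.secondEnd z e χ.onSec w) e' p := by
    rw [ip, hZ]
  rw [h3, ← h2, D.adv_ip, secondEnd_apply]
  simp only [ip_sub_left]
  ring

theorem opAHalf_eq (hχ : ∀ u v x, C.ip (χ.onSec u) v x = C.ip u (χ.onSec v) x)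
    (hZ : ∀ z u v : Sec I F E, D.secondEnd z u χ.onSec v p = Z (z p) (u p) (v p))
    (v u : Sec I F E) :
    D.opAHalf G χ v u p = 1 / 2 *
      (C.trace p (fun x y => C.pairing p (Z x (G.toFun p (u p)) (v p)) y)
      - C.trace p (fun x y => C.pairing p (Z (G.toFun p (u p)) x (v p)) y)
      - C.trace p (fun x y => C.pairing p (Z x (v p) (G.toFun p (u p))) y)
      + C.trace p (fun x y => C.pairing p (Z (v p) x (G.toFun p (u p))) y)) := by
  have key : ∀ a b : Sec I F E, C.contr p (fun e e' => C.ip a (D.commEnd e b χ.onSec e') p) =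
      C.trace p (fun x y => C.pairing p (Z x (b p) (a p)) y)
        - C.trace p (fun x y => C.pairing p (Z (b p) x (a p)) y) := by
    intro a b
    rw [← trace_sub, ← C.contr_eq_trace fun x y =>
      C.pairing p (Z x (b p) (a p)) y - C.pairing p (Z (b p) x (a p)) y]
    refine contr_congr fun e e' => ?_
    rw [C.ip_symm, commEnd, LinearMap.sub_apply, ip_sub_left, D.ip_secondEnd_symm hχ e b e' a,
      D.ip_secondEnd_symm hχ b e e' a, ip, ip, hZ, hZ]
  rw [opAHalf, key, key, BundleEnd.onSec_apply]
  ring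

end Connection

/-! ### Full contractions of the second covariant derivative of the metric. -/

section Traces
variable {p : M} {g : E p →ₗ[ℝ] E p} {Z : E p →ₗ[ℝ] E p →ₗ[ℝ] E p →ₗ[ℝ] E p}

/-- This and the next lemmas reduce each double contraction in the scalar variation to the single
number `D_α D_β χ^{βα}`. The symmetry of `Z x` and its anticommutation with `g` fix the factor. -/
theorem trace_second_lam' (h : ∀ x, AntiComm C g (Z x)) :
    C.trace p (fun z w => C.trace p fun x y => C.lam g (Z x) (g z) w y) =
      -1 / 2 * C.trace p fun x y => C.trace p fun z w => C.pairing p (Z x z w) y := by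
  rw [trace_trace, ← trace_mul_left]
  refine trace_congr fun x y => ?_
  rw [(h x).trace_symm, ← (h x).trace_lam_conj]
  exact trace_move (b := fun z w => C.lam g (Z x) z w y)
    (by constructor <;> intros <;> simp [lam] <;> ring) (h 0).adj

theorem trace_second_lam (h : ∀ x, AntiComm C g (Z x)) :
    C.trace p (fun z w => C.trace p fun x y => C.lam g (Z x) w (g z) y) =
      -1 / 2 * C.trace p fun x y => C.trace p fun z w => C.pairing p (Z x z w) y := by
  rw [trace_trace, ← trace_mul_left]
  refine trace_congr fun x y => ?_
  rw [(h x).trace_symm, ← (h x).trace_lam_conj]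
  exact trace_comm (by constructor <;> intros <;> simp [lam] <;> ring)

theorem trace_second (h : ∀ x, AntiComm C g (Z x)) :
    C.trace p (fun z w => C.trace p fun x y => C.pairing p (Z z x w) y) =
      C.trace p fun x y => C.trace p fun z w => C.pairing p (Z x z w) y :=
  trace_congr fun z w => trace_congr fun x y => (h z).symm x w y

theorem trace_second_flip (h : ∀ x, AntiComm C g (Z x)) :
    C.trace p (fun z w => C.trace p fun x y => C.pairing p (Z w x z) y) =
      C.trace p fun x y => C.trace p fun z w => C.pairing p (Z x z w) y := by
  rw [← trace_second h]
  exact trace_comm (by constructor <;> intros <;>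
    simp [trace, Finset.sum_add_distrib, Finset.mul_sum])

theorem trace_second_conj (h : ∀ x, AntiComm C g (Z x)) :
    C.trace p (fun z w => C.trace p fun x y => C.pairing p (Z (g z) x (g w)) y) =
      C.trace p fun x y => C.trace p fun z w => C.pairing p (Z x z w) y := by
  rw [trace_move (b := fun z w => C.trace p fun x y => C.pairing p (Z z x (g w)) y)
    (by constructor <;> intros <;> simp [trace, Finset.sum_add_distrib, Finset.mul_sum]) (h 0).adj]
  simp only [(h 0).invol]
  exact trace_second h

theorem trace_second_metric (h : ∀ x, AntiComm C g (Z x)) :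
    C.trace p (fun x y => C.trace p fun z w => C.pairing p (Z (g x) (g z) w) y) =
      -C.trace p fun x y => C.trace p fun z w => C.pairing p (Z x z w) y := by
  rw [trace_move (b := fun x y => C.trace p fun z w => C.pairing p (Z x (g z) w) y)
    (by constructor <;> intros <;> simp [trace, Finset.sum_add_distrib, Finset.mul_sum]) (h 0).adj]
  simp only [(h _).move, trace_neg]
  refine congrArg _ (trace_congr fun x y => ?_)
  rw [trace_move (b := fun z w => C.pairing p (Z x z (g w)) y)
    (by constructor <;> intros <;> simp) (h 0).adj]
  simp only [(h 0).invol]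

end Traces

/-! ### The two variation formulas. -/

section Variation
variable {J : Set ℝ} {s : ℝ} {G : ℝ → PseudoMetric C} {δ : ℝ → Divergence C}
  {D : ℝ → Connection C} {χ : BundleEnd I F E} {ε : Sec I F E}

/-- The curvature at `t` is that of the deformed connection plus the contribution of the divergence
gap. The free-derivative terms from both sources combine with `trace_lam_second` into the Laplacian,
the Lie derivative and `𝒜`. -/
theorem hasDerivAt_ricci [I.Boundaryless] (hJ : IsOpen J) (hs : s ∈ J)
    (hD : ∀ s ∈ J, (D s).MemLC (G s) (δ s))
    (hG : ∀ u, SecDeriv C J s (fun t => (G t).onSec u) (χ.onSec u))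
    (hδ : ∀ u, FunDeriv I J s (fun t => (δ t).toFun u) (C.ip ε u)) (v u : Sec I F E) (x : M) :
    HasDerivAt (fun t => (D t).ricci (G t) v u x)
      (-(1 / 2) * (D s).laplaceEnd (G s) χ v u x
        - 1 / 2 * C.ip v (C.lieEnd ((D s).trCov χ + (G s).onSec ε) (G s).onSec u) x
        + (D s).opA (G s) χ v u x
        + (D s).ricci (G s) ((G s).onSec (χ.onSec v)) u x
        + ((D s).fullRicci (χ.onSec ((G s).onSec v)) u x
          - (D s).fullRicci ((G s).onSec v) (χ.onSec u) x)) s := by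
  have hL := (hD s hs).toIsLeviCivita
  have ht := hL.torsion_eq_zero
  have hχ := derivative_symm hG
  have hGχ := derivative_anti hG
  obtain ⟨Z, hZ⟩ := (D s).exists_fiber_secondEnd χ x
  have hA := antiComm_secondEnd hL hχ hGχ hZ
  have cu := SecDeriv.const (C := C) (J := J) (s := s) u
  have cv := SecDeriv.const (C := C) (J := J) (s := s) v
  have h1 := hasDerivAt_fullRicci_deformed hJ hs hL hG cv cu x
  -- The part `G Ric G`: its arguments move with derivatives `χ v` and `χ u`, the source of the
  -- terms that are algebraic in `χ`.
  have h2 := hasDerivAt_fullRicci_deformed hJ hs hL hG (hG v) (hG u) x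
  have h3 := ((((hasDerivAt_divDiff hJ hs hD hG hδ cu cv x).fun_neg.sub
    (hasDerivAt_divDiff hJ hs hD hG hδ cv cu x)).add
    (hasDerivAt_divDiff hJ hs hD hG hδ (hG u) (hG v) x)).add
    (hasDerivAt_divDiff hJ hs hD hG hδ (hG v) (hG u) x)).const_mul (1 / 2)
  refine (((h1.sub h2).add h3).congr_deriv ?_).congr_of_eventuallyEq ?_
  · simp only [contr_ricci_deformTensor hL hχ hGχ hZ, contr_cov_deformTensor hL hχ hGχ hZ]
    have e1 := trace_lam_second hA (u x) (v x)
    have e2 : (D s).laplaceEnd (G s) χ v u x =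
        C.trace x fun a b => C.pairing x (v x) (Z ((G s).toFun x a) b (u x)) := by
      rw [laplaceEnd, ← C.contr_eq_trace fun a b =>
        C.pairing x (v x) (Z ((G s).toFun x a) b (u x))]
      refine contr_congr fun e e' => ?_
      rw [ip, hZ, BundleEnd.onSec_apply]
    have e3 := tensAt_fullRicci_left ht u x
    -- As `χ G = -G χ`, this cancels the first half of `χ G Rc`, leaving just the derivatives of the
    -- two arguments of `G Ric G`.
    have e4 : (D s).fullRicci (χ.onSec ((G s).onSec v)) u x =
        -(D s).fullRicci ((G s).onSec (χ.onSec v)) u x := by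
      rw [hGχ, ← neg_one_smul ℝ, e3.smul, neg_one_smul]
    rw [e2, e4, opA, opAHalf_eq hχ hZ, opAHalf_eq hχ hZ, ip_lieEnd hL]
    simp only [map_add, ip_add_left, ip_D_trCov hχ hZ, hL.compatible, ip_onSec, onSec_onSec, ricci,
      BundleEnd.onSec_apply, (G s).involutive]
    have z1 : (D s).fullRicci 0 u x = 0 := by simpa using e3.smul 0 0
    have z2 : (D s).fullRicci v 0 x = 0 := by
      simpa using ((D s).tensAt_fullRicci_right v x).smul 0 0
    linear_combination (1 / 2) * e1 + z1 + z2
  · filter_upwards [hJ.mem_nhds hs] with t htJ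
    have hLt := deformed_isLeviCivita (D s) ht (G t)
    rw [ricci_eq_of_isLeviCivita hLt (hD t htJ).toIsLeviCivita, ricci]
    rfl

/-- The second derivatives of `χ` coming from the deformed connection cancel on contraction with
`G`; the double divergence in the formula comes entirely from the variation of the divergence. -/
theorem hasDerivAt_scalar [I.Boundaryless] (hJ : IsOpen J) (hs : s ∈ J)
    (hD : ∀ s ∈ J, (D s).MemLC (G s) (δ s))
    (hG : ∀ u, SecDeriv C J s (fun t => (G t).onSec u) (χ.onSec u))
    (hδ : ∀ u, FunDeriv I J s (fun t => (δ t).toFun u) (C.ip ε u)) (x : M) :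
    HasDerivAt (fun t => (D t).scalar (G t) x)
      ((C.contr x fun e e' => C.contr x fun f f' =>
          C.ip ((D s).secondEnd ((G s).onSec e) ((G s).onSec f) χ.onSec f') e' x)
        - 2 * (C.contr x fun e e' => C.ip ((D s).D ((G s).onSec e) ε) e' x)
        + 1 / 2 * (C.contr x fun e e' => (D s).ricci (G s) e (χ.onSec e') x)) s := by
  have hL := (hD s hs).toIsLeviCivita
  have ht := hL.torsion_eq_zero
  have hχ := derivative_symm hG
  have hGχ := derivative_anti hG
  obtain ⟨Z, hZ⟩ := (D s).exists_fiber_secondEnd χ x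
  have hA := antiComm_secondEnd hL hχ hGχ hZ
  have cc := fun e => SecDeriv.const (C := C) (J := J) (s := s) e
  have h1 := hasDerivAt_contr (C := C) (p := x) fun e e' =>
    hasDerivAt_fullRicci_deformed hJ hs hL hG (hG e) (cc e') x
  have h2 := hasDerivAt_contr (C := C) (p := x) fun e e' =>
    hasDerivAt_divDiff hJ hs hD hG hδ (cc e) (hG e') x
  -- Both factors vanish at `s`, so their product has zero derivative.
  have h3 : HasDerivAt (fun t => C.contr x fun e e' =>
      divGap (D s) (G t) (δ s) (δ t) e x * divGap (D s) (G t) (δ s) (δ t) ((G t).onSec e') x)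
      (C.contr x fun _ _ => 0) s := hasDerivAt_contr fun e e' => by
    have hϑ := fun w => (funDeriv_divGap hJ hs hL hG hδ w).deriv x
    have k := (hϑ e).mul ((hG e').hasDerivAt_apply (fun t => tensAt_divGap ht (G t) (δ s) (δ t) x)
      (tensAt_divGap_deriv ht (G s) hχ x) hϑ)
    refine k.congr_deriv ?_
    simp [divGap_self hL]
  refine (((h1.sub (h2.const_mul 2)).sub h3).congr_deriv ?_).congr_of_eventuallyEq ?_
  · simp only [contr_ricci_deformTensor hL hχ hGχ hZ, contr_cov_deformTensor hL hχ hGχ hZ]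
    have z2 : ∀ v, (D s).fullRicci v 0 x = 0 := fun v => by
      simpa using ((D s).tensAt_fullRicci_right v x).smul 0 0
    obtain ⟨R, hR⟩ := exists_tensor₂ C (tensAt_fullRicci_left ht · x)
      ((D s).tensAt_fullRicci_right · x)
    obtain ⟨k, hk⟩ := ((D s).tensAt_D ε x).exists_lin C
    set g := (G s).toFun x with hg
    set X := χ.toFun x with hX
    have hgs : ∀ a b, C.pairing x (g a) b = C.pairing x a (g b) := (G s).selfAdjoint x
    have hgg : ∀ a, g (g a) = a := (G s).involutive x
    have hXs : ∀ a b, C.pairing x (X a) b = C.pairing x a (X b) := fun a b => by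
      simpa [ip] using hχ (secLift C x a) (secLift C x b) x
    have hXg : ∀ a, X (g a) = -g (X a) := fun a => by
      simpa using congrArg (fun s : Sec I F E => s x) (hGχ (secLift C x a))
    have t0 : (C.contr x fun _ _ => 0) = 0 := by simp [contr]
    have t1 := C.contr_eq_trace (p := x) fun a b => R (X a) b + 1 / 2 *
      (C.trace x (fun y z => C.lam g (Z y) b (g a) z) + C.trace x (fun y z => C.lam g (Z y) (g a) b z)
        + 1 / 2 * C.trace x (fun y z => C.pairing x (Z b y a) z)
        + 1 / 2 * C.trace x (fun y z => C.pairing x (Z (g a) y (g b)) z))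
    have t2 := C.contr_eq_trace (p := x) fun a b => C.pairing x (k a) (g b)
      - -1 / 2 * C.trace x (fun y z => C.pairing x (Z a y b) z)
    have t3 := C.contr_eq_trace (p := x) fun a b => C.pairing x (k (g a)) b
    have t4 := C.contr_eq_trace (p := x) fun a b => R a (X b) - R (g a) (g (X b))
    have t5 : (C.contr x fun e e' => C.contr x fun f f' =>
        C.ip ((D s).secondEnd ((G s).onSec e) ((G s).onSec f) χ.onSec f') e' x) =
        C.trace x fun a b => C.trace x fun c d => C.pairing x (Z (g a) (g c) d) b := by
      rw [← C.contr_eq_trace]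
      refine contr_congr fun e e' => ?_
      rw [← C.contr_eq_trace fun c d => C.pairing x (Z (g (e x)) (g c) d) (e' x)]
      refine contr_congr fun f f' => ?_
      rw [ip, hZ]
      rfl
    have t6 : C.trace x (fun a b => C.pairing x (k (g a)) b) =
        C.trace x fun a b => C.pairing x (k a) (g b) :=
      trace_move (b := fun a b => C.pairing x (k a) b) (by constructor <;> intros <;> simp) hgs
    have t7 : C.trace x (fun a b => R a (X b)) = C.trace x fun a b => R (X a) b :=
      (trace_move (b := fun a b => R a b) (by constructor <;> intros <;> simp) hXs).symm
    -- Contracted with `χ`, the tensors `G Ric G` and `-Ric` agree. Hence half the contraction of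
    -- `χ` with `Rc` equals its contraction with `Ric`, the term from varying `G` in `Tr (G Ric)`.
    have t8 : C.trace x (fun a b => R (g a) (g (X b))) = -C.trace x fun a b => R (X a) b := by
      rw [← trace_move (b := fun a b => R (g a) (g b)) (by constructor <;> intros <;> simp) hXs]
      rw [← trace_neg]
      have := trace_move (C := C) (b := fun a b => -R (X a) (g b))
        (by constructor <;> intros <;> simp <;> ring) hgs
      simpa [hXg, hgg] using this
    rw [t5, t0]
    simp only [z2, hR, BundleEnd.onSec_apply, ip, hk, hgg, ricci, add_zero,
      ← hg, ← hX] at t1 t2 t3 t4 ⊢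
    rw [t1, t2, t3, t4, t6]
    simp only [trace_add, trace_sub, trace_mul_left, t7, t8, trace_second_lam hA,
      trace_second_lam' hA, trace_second hA, trace_second_conj hA, trace_second_flip hA,
      trace_second_metric hA]
    ring
  · filter_upwards [hJ.mem_nhds hs] with t htJ
    have hLt := deformed_isLeviCivita (D s) ht (G t)
    rw [scalar_eq_of_isLeviCivita hLt (hD t htJ).toIsLeviCivita, scalar]
    simp only [divGap_eq (hD s hs) (hD t htJ)]
    rfl

end Variation

end CourantGeometry

end

noncomputable section

namespace CourantGeometry

variable {EM : Type*} [NormedAddCommGroup EM] [NormedSpace ℝ EM] [FiniteDimensional ℝ EM]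
  {H : Type*} [TopologicalSpace H] {I : ModelWithCorners ℝ EM H}
  {M : Type*} [TopologicalSpace M] [ChartedSpace H M] [IsManifold I ∞ M] [T2Space M]
  {F : Type*} [NormedAddCommGroup F] [NormedSpace ℝ F] [FiniteDimensional ℝ F]
  {E : M → Type*} [TopologicalSpace (Bundle.TotalSpace F E)]
  [∀ x, TopologicalSpace (E x)] [FiberBundle F E]
  [∀ x, AddCommGroup (E x)] [∀ x, Module ℝ (E x)] [VectorBundle ℝ F E]
  [ContMDiffVectorBundle ∞ F E I]

/-! ### The operator `𝒜` -/

open CourantAlgebroid Connection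
variable {C : CourantAlgebroid I F E}

namespace Connection
variable (D : Connection C)

theorem commEnd_apply (u v : Sec I F E) (T : Sec I F E →ₗ[ℝ] Sec I F E) (z : Sec I F E) :
    D.commEnd u v T z = D.comm u v (T z) - T (D.comm u v z) := by
  simp only [commEnd, LinearMap.sub_apply, secondEnd_apply, covEnd_apply, comm, second, map_sub]
  abel

theorem commEnd_fsmul_left (f : Fun I M) (u v : Sec I F E) (T : BundleEnd I F E)
    (z : Sec I F E) : D.commEnd (fsmul f u) v T.onSec z = fsmul f (D.commEnd u v T.onSec z) := by
  ext
  simp [commEnd_apply, comm_fsmul_left, onSec_fsmul, smul_sub]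

theorem commEnd_fsmul_middle (f : Fun I M) (u v : Sec I F E) (T : BundleEnd I F E)
    (z : Sec I F E) : D.commEnd u (fsmul f v) T.onSec z = fsmul f (D.commEnd u v T.onSec z) := by
  ext
  simp [commEnd_apply, comm_fsmul_middle, onSec_fsmul, smul_sub]

/-- The derivatives of `f` produced by `comm` on `T z` and on `z` cancel, since `T` is
`C^∞(M)`-linear. -/
theorem commEnd_fsmul_right (f : Fun I M) (u v : Sec I F E) (T : BundleEnd I F E)
    (z : Sec I F E) : D.commEnd u v T.onSec (fsmul f z) = fsmul f (D.commEnd u v T.onSec z) := by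
  ext
  simp [commEnd_apply, comm_fsmul_right, onSec_fsmul, smul_sub]

theorem commEnd_add_left (u u' v : Sec I F E) (T : Sec I F E →ₗ[ℝ] Sec I F E)
    (z : Sec I F E) : D.commEnd (u + u') v T z = D.commEnd u v T z + D.commEnd u' v T z := by
  simp only [commEnd_apply, comm_add_left, map_add]; abel

theorem commEnd_add_middle (u v v' : Sec I F E) (T : Sec I F E →ₗ[ℝ] Sec I F E)
    (z : Sec I F E) : D.commEnd u (v + v') T z = D.commEnd u v T z + D.commEnd u v' T z := by
  simp only [commEnd_apply, comm_add_middle, map_add]; abel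

theorem commEnd_add_end (u v : Sec I F E) (S T : BundleEnd I F E) (z : Sec I F E) :
    D.commEnd u v (S + T).onSec z = D.commEnd u v S.onSec z + D.commEnd u v T.onSec z := by
  have h : ∀ w, (S + T).onSec w = S.onSec w + T.onSec w := fun w => rfl
  simp only [commEnd_apply, h, comm_add_right]
  abel

/-- The second derivatives of `f` cancel in the commutator and only its derivative along the curl of
`u` and `v` is left. This is the sole derivative falling on `T`. -/
theorem commEnd_fsmul_end (f : Fun I M) (u v : Sec I F E) (T : BundleEnd I F E)
    (z : Sec I F E) : D.commEnd u v (BundleEnd.fsmul f T).onSec z =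
      fsmul f (D.commEnd u v T.onSec z) + fsmul (C.advF (D.curl u v) f) (T.onSec z) := by
  have h : ∀ w, (BundleEnd.fsmul f T).onSec w = fsmul f (T.onSec w) := fun w => rfl
  ext
  simp [commEnd_apply, h, comm_fsmul_right, smul_sub]
  abel

/-- The contraction `T(e_α, u)^α` of the commutator of covariant derivatives. -/
def commTrace (T : BundleEnd I F E) (v u : Sec I F E) (p : M) : ℝ :=
  C.contr p fun e e' => C.ip v (D.commEnd e u T.onSec e') p

theorem opAHalf_eq_commTrace (G : PseudoMetric C) (T : BundleEnd I F E) (v u : Sec I F E) (p : M) :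
    D.opAHalf G T v u p =
      1 / 2 * (D.commTrace T v (G.onSec u) p - D.commTrace T (G.onSec u) v p) := rfl

/-- The defect from multiplying `T` by `f` is `C^∞(M)`-linear in `T`, so a second commutator with a
function annihilates it. -/
theorem isFirstOrderOperator_commTrace : IsFirstOrderOperator D.commTrace where
  smooth T v u := by
    refine SmoothTensor.contMDiff_contr (T := fun e e' q => C.ip v (D.commEnd e u T.onSec e') q)
      ⟨fun _ _ => contMDiff_ip _ _, fun w q => ⟨fun a b => ?_, fun f a => ?_⟩,
      fun w q => ⟨fun a b => ?_, fun f a => ?_⟩⟩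
    · rw [commEnd_add_left, ip_add_right]
    · rw [commEnd_fsmul_left, ip_fsmul_right, smul_eq_mul]
    · rw [map_add, ip_add_right]
    · rw [commEnd_fsmul_right, ip_fsmul_right, smul_eq_mul]
  add_left T v v' u x := by simp [commTrace, contr_add]
  fsmul_left T f v u x := by simp [commTrace, contr_mul_left]
  add_right T v u u' x := by simp [commTrace, commEnd_add_middle, contr_add]
  fsmul_right T f v u x := by simp [commTrace, commEnd_fsmul_middle, contr_mul_left]
  add S T v u x := by simp [commTrace, commEnd_add_end, contr_add]
  const_smul c T v u x := by
    have h : ∀ w q, C.adv w (ContMDiffMap.const c : Fun I M) q = 0 := fun w q => adv_const w c q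
    have hc : (ContMDiffMap.const c : Fun I M) x = c := rfl
    simp [commTrace, commEnd_fsmul_end, contr_mul_left, h, hc]
  commutator f g T v u x := by
    have h : ∀ (f : Fun I M) (S : BundleEnd I F E), D.commTrace (BundleEnd.fsmul f S) v u x =
        f x * D.commTrace S v u x +
          C.contr x fun e e' => C.adv (D.curl e u) f x * C.ip v (S.onSec e') x := fun f S => by
      simp only [commTrace, commEnd_fsmul_end, ip_add_right, ip_fsmul_right, contr_add,
        contr_mul_left, advF_apply]
    have h2 : C.contr x (fun e e' => C.adv (D.curl e u) f x *
        C.ip v ((BundleEnd.fsmul g T).onSec e') x) =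
        g x * C.contr x fun e e' => C.adv (D.curl e u) f x * C.ip v (T.onSec e') x := by
      rw [← contr_mul_left]
      refine contr_congr fun e e' => ?_
      rw [show (BundleEnd.fsmul g T).onSec e' = fsmul g (T.onSec e') from rfl, ip_fsmul_right]
      ring
    rw [h f, h f, h2]
    ring

end Connection

/-! ### Closure properties of first-order operators. -/

namespace IsFirstOrderOperator
variable {P Q : BundleEnd I F E → Sec I F E → Sec I F E → M → ℝ}

theorem add' (hP : IsFirstOrderOperator P) (hQ : IsFirstOrderOperator Q) :
    IsFirstOrderOperator fun T v u x => P T v u x + Q T v u x where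
  smooth T v u := (hP.smooth T v u).add (hQ.smooth T v u)
  add_left T v v' u x := by rw [hP.add_left, hQ.add_left]; ring
  fsmul_left T f v u x := by rw [hP.fsmul_left, hQ.fsmul_left]; ring
  add_right T v u u' x := by rw [hP.add_right, hQ.add_right]; ring
  fsmul_right T f v u x := by rw [hP.fsmul_right, hQ.fsmul_right]; ring
  add S T v u x := by rw [hP.add, hQ.add]; ring
  const_smul c T v u x := by rw [hP.const_smul, hQ.const_smul]; ring
  commutator f g T v u x := by
    linear_combination hP.commutator f g T v u x + hQ.commutator f g T v u x

theorem const_mul (c : ℝ) (hP : IsFirstOrderOperator P) :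
    IsFirstOrderOperator fun T v u x => c * P T v u x where
  smooth T v u := contMDiff_const.mul (hP.smooth T v u)
  add_left T v v' u x := by rw [hP.add_left]; ring
  fsmul_left T f v u x := by rw [hP.fsmul_left]; ring
  add_right T v u u' x := by rw [hP.add_right]; ring
  fsmul_right T f v u x := by rw [hP.fsmul_right]; ring
  add S T v u x := by rw [hP.add]; ring
  const_smul c T v u x := by rw [hP.const_smul]; ring
  commutator f g T v u x := by linear_combination c * hP.commutator f g T v u x

theorem flip (hP : IsFirstOrderOperator P) : IsFirstOrderOperator fun T v u => P T u v where
  smooth T v u := hP.smooth T u v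
  add_left T v v' u x := hP.add_right T u v v' x
  fsmul_left T f v u x := hP.fsmul_right T f u v x
  add_right T v u u' x := hP.add_left T u u' v x
  fsmul_right T f v u x := hP.fsmul_left T f u v x
  add S T v u x := hP.add S T u v x
  const_smul c T v u x := hP.const_smul c T u v x
  commutator f g T v u x := hP.commutator f g T u v x

theorem comp_right (hP : IsFirstOrderOperator P) (S : BundleEnd I F E) :
    IsFirstOrderOperator fun T v u => P T v (S.onSec u) where
  smooth T v u := hP.smooth T v (S.onSec u)
  add_left T v v' u x := hP.add_left T v v' _ x
  fsmul_left T f v u x := hP.fsmul_left T f v _ x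
  add_right T v u u' x := by rw [map_add, hP.add_right]
  fsmul_right T f v u x := by rw [onSec_fsmul, hP.fsmul_right]
  add S' T v u x := hP.add S' T v _ x
  const_smul c T v u x := hP.const_smul c T v _ x
  commutator f g T v u x := hP.commutator f g T v _ x

end IsFirstOrderOperator

/-- The operator `𝒜` is built from `commTrace` by exchanging arguments, applying `G` to an argument
and taking linear combinations. -/
theorem Connection.isFirstOrderOperator_opA (D : Connection C) (G : PseudoMetric C) :
    IsFirstOrderOperator (D.opA G) := by
  have h := D.isFirstOrderOperator_commTrace.comp_right G.toBundleEnd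
  have h' := (h.add' ((D.isFirstOrderOperator_commTrace.flip.comp_right
    G.toBundleEnd).const_mul (-1))).const_mul (1 / 2)
  have e : D.opAHalf G = fun T v u x => 1 / 2 * (D.commTrace T v (G.onSec u) x +
      -1 * D.commTrace T (G.onSec u) v x) := by
    funext T v u x
    rw [opAHalf_eq_commTrace]
    ring
  have h2 : IsFirstOrderOperator (D.opAHalf G) := by rw [e]; exact h'
  exact h2.add' h2.flip

end CourantGeometry

end

/-! ### The first variation theorem. -/

open CourantGeometry in
theorem mainTheorem9
    {EM : Type*} [NormedAddCommGroup EM] [NormedSpace ℝ EM] [FiniteDimensional ℝ EM]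
    {H : Type*} [TopologicalSpace H] {I : ModelWithCorners ℝ EM H} [I.Boundaryless]
    {M : Type*} [TopologicalSpace M] [ChartedSpace H M] [IsManifold I ∞ M]
    [T2Space M] [SigmaCompactSpace M]
    {F : Type*} [NormedAddCommGroup F] [NormedSpace ℝ F] [FiniteDimensional ℝ F]
    {E : M → Type*} [TopologicalSpace (Bundle.TotalSpace F E)]
    [∀ x, TopologicalSpace (E x)] [FiberBundle F E]
    [∀ x, AddCommGroup (E x)] [∀ x, Module ℝ (E x)] [VectorBundle ℝ F E]
    [ContMDiffVectorBundle ∞ F E I]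
    (C : CourantAlgebroid I F E)
    -- a smooth one-parameter family of generalized pseudometrics and divergences
    {J : Set ℝ} (hJ : IsOpen J) (G : ℝ → PseudoMetric C) (δ : ℝ → Divergence C)
    (hG : ∀ u v : Sec I F E, ContMDiffOn (𝓘(ℝ, ℝ).prod I) 𝓘(ℝ, ℝ) ∞
      (fun q : ℝ × M => C.ip ((G q.1).onSec u) v q.2) (J ×ˢ Set.univ))
    (hδ : ∀ u : Sec I F E, ContMDiffOn (𝓘(ℝ, ℝ).prod I) 𝓘(ℝ, ℝ) ∞
      (fun q : ℝ × M => (δ q.1).toFun u q.2) (J ×ˢ Set.univ))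
    -- its derivative
    (χ : ℝ → BundleEnd I F E) (ε : ℝ → Sec I F E)
    (hχ : ∀ s ∈ J, ∀ (u v : Sec I F E) (x : M),
      HasDerivAt (fun t => C.ip ((G t).onSec u) v x) (C.ip ((χ s).onSec u) v x) s)
    (hε : ∀ s ∈ J, ∀ (u : Sec I F E) (x : M),
      HasDerivAt (fun t => (δ t).toFun u x) (C.ip (ε s) u x) s)
    -- any choice of Levi-Civita connections with the given divergences
    (D : ℝ → Connection C) (hD : ∀ s ∈ J, (D s).MemLC (G s) (δ s)) :
    ∀ s ∈ J,
      (∀ (v u : Sec I F E) (x : M),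
        HasDerivAt (fun t => (D t).ricci (G t) v u x)
          (-(1 / 2) * (D s).laplaceEnd (G s) (χ s) v u x
            - 1 / 2 * C.ip v
                (C.lieEnd ((D s).trCov (χ s) + (G s).onSec (ε s)) (G s).onSec u) x
            + (D s).opA (G s) (χ s) v u x
            + (D s).ricci (G s) ((G s).onSec ((χ s).onSec v)) u x
            + ((D s).fullRicci ((χ s).onSec ((G s).onSec v)) u x
              - (D s).fullRicci ((G s).onSec v) ((χ s).onSec u) x)) s) ∧
      (∀ x : M,
        HasDerivAt (fun t => (D t).scalar (G t) x)
          ((C.contr x fun e e' => C.contr x fun f f' =>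
              C.ip ((D s).secondEnd ((G s).onSec e) ((G s).onSec f) (χ s).onSec f') e' x)
            - 2 * (C.contr x fun e e' => C.ip ((D s).D ((G s).onSec e) (ε s)) e' x)
            + 1 / 2 * (C.contr x fun e e' => (D s).ricci (G s) e ((χ s).onSec e') x)) s) ∧
      IsFirstOrderOperator ((D s).opA (G s)) := by
  intro s hs
  have hG' : ∀ u, SecDeriv C J s (fun t => (G t).onSec u) ((χ s).onSec u) := fun u w =>
    ⟨hG u w, fun q => hχ s hs u w q⟩
  have hδ' : ∀ u, FunDeriv I J s (fun t => (δ t).toFun u) (C.ip (ε s) u) := fun u =>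
    ⟨hδ u, fun q => hε s hs u q⟩
  exact ⟨fun v u x => hasDerivAt_ricci hJ hs hD hG' hδ' v u x,
    fun x => hasDerivAt_scalar hJ hs hD hG' hδ' x, (D s).isFirstOrderOperator_opA (G s)⟩
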